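/- **Lemma (norm equivalence of $\bar R_h$).** Let $d=2$, $k\ge 3$ or $d=3$, $k\ge 5$, and let $\Omega\subset\mathbb R^d$ be a bounded open convex polytopal domain. For a conforming simplicial triangulation $\mathcal T_h$ of $\Omega$ let $h_T=\operatorname{diam}T$; it is shape regular with constant $\sigma$ if each $T\in\mathcal T_h$ contains a ball of radius $r_T>0$ with $h_T\le\sigma r_T$. Let $$V_h=\{v\in H^1_0(\Omega): v|_T\in\mathcal P_k(T)\ \forall T\in\mathcal T_h,\ v\text{ is }C^1\text{ at all vertices}\}\qquad(d=2),$$ $$V_h=\{v\in H^1_0(\Omega): v|_T\in\mathcal P_k(T)\ \forall T\in\mathcal T_h,\ v\text{ is }C^1\text{ on all edges and }C^2\text{ at all vertices}\}\qquad(d=3)$$ be the $\mathcal P_k$-Hermite, respectively $\mathcal P_k$-Argyris, space. For $\lambda>0$ define the SPD operator $A_{\lambda,h}:V_h\to V_h'$ by $$\langle A_{\lambda,h}w,v\rangle=\sum_{T\in\mathcal T_h}(D^2w,D^2v)_T+2\lambda(\nabla w,\nabla v)_\Omega+\lambda^2(w,v)_\Omega .$$ *Degrees of freedom.* They have the form $N_\alpha(v)=\frac1{|D_\alpha|}\int_{D_\alpha}\nabla^{k_\alpha}v(t_1,\dots,t_{k_\alpha})$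 with a simplex $D_\alpha$ (possibly a point, where the average is the value), $k_\alpha\in\{0,1,2\}$ and unit vectors $t_i$: values at the interior vertices; first derivatives at the vertices and, if $d=3$, second derivatives at the vertices and normal derivatives averaged over simplices $D_\alpha$ in the edges; and averages of $v$ over simplices $D_\alpha$ in the subsimplices of dimension $\ge1$ that are not contained in $\partial\Omega$. In barycentric coordinates the $D_\alpha$ follow a fixed pattern $P$ independent of the mesh, with respect to some numbering of the vertices of each subsimplex. The pattern is unisolvent: on the $m$-dimensional reference simplex the averages of values determine uniquely, with arbitrary prescribed values, the polynomials of degree $\le k$ divisible by $(\beta_0\cdots\beta_m)^{d+1-m}$ (barycentric coordinates $\beta_i$), for $1\le m\le d$; and if $d=3$ the averages for the normal derivatives on an edge do so for the polynomials of degree $\le k-1$ divisible by $(\beta_0\beta_1)^2$. At every vertex (and on every edge, for $d=3$) the derivatives in the chosen directions are coordinates, with condition constant $\kappa$, on the space $J$ of those gradients (Hessians, normal derivatives) that are compatible with zero boundary values: the resulting map $J\to\mathbb R^n$ is onto, and $|g|^2\le\kappa\sum_i|N_i(g)|^2$ for $g\in J$, where $N_i(g)$ are its components. Let $(\varphi_i)_{i=1}^n$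 be the nodal basis of $V_h$, $N_i(\varphi_j)=\delta_{ij}$, in any order. *Smoothers.* In the nodal basis let $A=(\langle A_{\lambda,h}\varphi_j,\varphi_i\rangle)_{ij}$, let $D_h$ be the diagonal of $A$ (so that $D_h^{-1}$ is the Jacobi smoother), let $R_h$ be the inverse of the lower triangular part of $A$, diagonal included (the Gauss–Seidel smoother), and let the symmetric Gauss–Seidel smoother $\bar R_h$ be given by $I-\bar R_hA=(I-R_h'A)(I-R_hA)$. Put $\|v\|_B^2=\langle Bv,v\rangle$. Then there is a constant $C>0$ that depends only on $d$, $k$, $\Omega$, $\sigma$, $P$ and $\kappa$ such that for every triangulation $\mathcal T_h$ of $\Omega$ that is shape regular with constant $\sigma$, all degrees of freedom as above and every $\lambda>0$: $A$ and $\bar R_h$ are symmetric positive definite, the lower triangular part of $A$ is invertible, and for all $v\in V_h$ $$C^{-1}\|v\|_{D_h}^2\le\|v\|_{\bar R_h^{-1}}^2\le C\|v\|_{D_h}^2,\qquad C^{-1}\|v\|_{D_h}^2\le\sum_{T\in\mathcal T_h}(h_T^{-2}+\lambda)^2\|v\|_{L^2(T)}^2\le C\|v\|_{D_h}^2 .$$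 In particular $C$ is independent of $\lambda$ and $h$. -/

import Mathlib

open MeasureTheory Filter Topology
open scoped ContDiff ENNReal Matrix

namespace SmootherFEM

/-- `ℝ^d` with the Euclidean norm. -/
abbrev Space (d : ℕ) : Type := EuclideanSpace ℝ (Fin d)

/-- The standard coordinate vectors of `ℝ^d`. -/
noncomputable def unitVec {d : ℕ} (i : Fin d) : Space d := EuclideanSpace.single i (1 : ℝ)

/-! ### The domain and its triangulations -/

/-- `Ω` is a bounded open convex polytopal domain: the (non-empty) interior of the convex hull of
finitely many points. -/
def IsConvexPolytope {d : ℕ} (Ω : Set (Space d)) : Prop :=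
  Ω.Nonempty ∧ ∃ S : Finset (Space d), Ω = interior (convexHull ℝ (S : Set (Space d)))

/-- A conforming simplicial triangulation of `Ω`: a finite simplicial complex, all of whose maximal
simplices are `d`-dimensional, that fills the closure of `Ω`.  Simplices are given by their vertex
sets. -/
structure Mesh (d : ℕ) (Ω : Set (Space d)) where
  complex : Geometry.SimplicialComplex ℝ (Space d)
  finite : complex.faces.Finite
  space_eq : complex.space = closure Ω
  pure : ∀ s ∈ complex.faces, ∃ T ∈ complex.faces, s ⊆ T ∧ T.card = d + 1

/-- The closed simplex with the given vertices. -/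
def hull {d : ℕ} (s : Finset (Space d)) : Set (Space d) := convexHull ℝ (s : Set (Space d))

/-- The diameter `h_T`. -/
noncomputable def diameter {d : ℕ} (T : Finset (Space d)) : ℝ := Metric.diam (hull T)

namespace Mesh

variable {d : ℕ} {Ω : Set (Space d)}

/-- The subsimplices (of all dimensions) of the triangulation. -/
def faces (M : Mesh d Ω) : Set (Finset (Space d)) := M.complex.faces

/-- The elements `T` of the triangulation. -/
noncomputable def cells (M : Mesh d Ω) : Finset (Finset (Space d)) :=
  M.finite.toFinset.filter fun T => T.card = d + 1

/-- Shape regularity with constant `σ`: each element `T` contains a ball of radius `r > 0` with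
`h_T ≤ σ r`. -/
def ShapeRegular (M : Mesh d Ω) (σ : ℝ) : Prop :=
  ∀ T ∈ M.cells, ∃ (x : Space d) (r : ℝ),
    0 < r ∧ Metric.closedBall x r ⊆ hull T ∧ diameter T ≤ σ * r

theorem uniqueDiffOn (M : Mesh d Ω) {T : Finset (Space d)} (hT : T ∈ M.cells) :
    UniqueDiffOn ℝ (hull T) := by
  obtain ⟨h1, h2⟩ := Finset.mem_filter.1 hT
  have hind := M.complex.indep (M.finite.mem_toFinset.1 h1)
  refine uniqueDiffOn_convex (convex_convexHull ℝ _) ?_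
  rw [hull, interior_convexHull_nonempty_iff_affineSpan_eq_top]
  have hc : Fintype.card T = Module.finrank ℝ (Space d) + 1 := by simp [h2]
  have := hind.affineSpan_eq_top_iff_card_eq_finrank_add_one.2 hc
  rwa [Subtype.range_coe] at this

end Mesh

/-! ### The finite element space -/

/-- `v ∈ H¹₀(Ω)`: `v` is the limit in `H¹(Ω)` of smooth functions with compact support in `Ω`. -/
def MemH10 {d : ℕ} (Ω : Set (Space d)) (v : Space d → ℝ) : Prop :=
  MemLp v 2 (volume.restrict Ω) ∧
  ∃ G : Space d → Space d, MemLp G 2 (volume.restrict Ω) ∧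
  ∃ ψ : ℕ → Space d → ℝ,
    (∀ n, ContDiff ℝ ∞ (ψ n) ∧ HasCompactSupport (ψ n) ∧ tsupport (ψ n) ⊆ Ω) ∧
    Tendsto (fun n => eLpNorm (ψ n - v) 2 (volume.restrict Ω)) atTop (𝓝 0) ∧
    Tendsto (fun n => eLpNorm (gradient (ψ n) - G) 2 (volume.restrict Ω)) atTop (𝓝 0)

/-- `v|_T ∈ 𝒫_k(T)`. -/
def IsPolyOn {d : ℕ} (k : ℕ) (v : Space d → ℝ) (T : Finset (Space d)) : Prop :=
  ∃ p : MvPolynomial (Fin d) ℝ, p.totalDegree ≤ k ∧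
    ∀ x ∈ hull T, v x = MvPolynomial.eval (fun i => x i) p

/-- `∇^j (v|_T)` as a function on the closed element `T`. -/
noncomputable def derivOn {d : ℕ} (j : ℕ) (v : Space d → ℝ) (T : Finset (Space d)) (x : Space d) :
    ContinuousMultilinearMap ℝ (fun _ : Fin j => Space d) ℝ :=
  iteratedFDerivWithin ℝ j v (hull T) x

/-- `v` is `C^r` at the point `x`: the derivatives of order at most `r` of `v` at `x`, taken from
the elements that contain `x`, agree. -/
def SmoothAt {d : ℕ} {Ω : Set (Space d)} (M : Mesh d Ω) (r : ℕ) (v : Space d → ℝ)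
    (x : Space d) : Prop :=
  ∀ T ∈ M.cells, ∀ T' ∈ M.cells, x ∈ hull T → x ∈ hull T' →
    ∀ j ≤ r, derivOn j v T x = derivOn j v T' x

section closure

variable {d : ℕ} {Ω : Set (Space d)}

theorem IsPolyOn.contDiffWithinAt {k : ℕ} {v : Space d → ℝ} {T : Finset (Space d)}
    (h : IsPolyOn k v T) {x : Space d} (hx : x ∈ hull T) (n : ℕ) :
    ContDiffWithinAt ℝ n v (hull T) x := by
  obtain ⟨p, -, hp⟩ := h
  have hc : ContDiff ℝ n fun x : Space d => MvPolynomial.eval (fun i => x i) p := by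
    simp only [MvPolynomial.eval_eq]
    refine ContDiff.sum fun s _ => contDiff_const.mul (contDiff_prod fun i _ => ?_)
    exact ContDiff.pow ((EuclideanSpace.proj (𝕜 := ℝ) i).contDiff) _
  exact hc.contDiffWithinAt.congr hp (hp x hx)

theorem gradient_add_of_smooth {f g : Space d → ℝ} (hf : ContDiff ℝ ∞ f) (hg : ContDiff ℝ ∞ g) :
    gradient (f + g) = gradient f + gradient g := by
  funext x
  simp only [gradient, Pi.add_apply, ← map_add]
  congr 1
  exact fderiv_add (hf.differentiable (by simp) x) (hg.differentiable (by simp) x)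

theorem gradient_smul_of_smooth {f : Space d → ℝ} (hf : ContDiff ℝ ∞ f) (c : ℝ) :
    gradient (c • f) = c • gradient f := by
  funext x
  simp only [gradient, Pi.smul_apply]
  rw [fderiv_const_smul (hf.differentiable (by simp) x) c]
  simp

theorem continuous_gradient {f : Space d → ℝ} (hf : ContDiff ℝ ∞ f) : Continuous (gradient f) := by
  unfold gradient
  exact (InnerProductSpace.toDual ℝ (Space d)).symm.continuous.comp
    (hf.continuous_fderiv (by simp))

theorem MemH10.zero : MemH10 Ω (0 : Space d → ℝ) := by
  have h1 : MemLp (0 : Space d → ℝ) 2 (volume.restrict Ω) := MemLp.zero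
  have h2 : MemLp (0 : Space d → Space d) 2 (volume.restrict Ω) := MemLp.zero
  refine ⟨h1, 0, h2, fun _ => 0, fun n => ⟨contDiff_const, ?_, ?_⟩, ?_, ?_⟩
  · exact HasCompactSupport.zero
  · simp [tsupport]
  · simp
  · have h3 : gradient (0 : Space d → ℝ) = 0 := by
      funext x
      simp [gradient]
    simp [h3]

theorem MemH10.add {v w : Space d → ℝ} (hv : MemH10 Ω v) (hw : MemH10 Ω w) :
    MemH10 Ω (v + w) := by
  obtain ⟨hv, G, hG, f, hf, hf0, hf1⟩ := hv
  obtain ⟨hw, H, hH, g, hg, hg0, hg1⟩ := hw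
  have cf : ∀ n, Continuous (f n) := fun n => (hf n).1.continuous
  have cg : ∀ n, Continuous (g n) := fun n => (hg n).1.continuous
  have cf' : ∀ n, Continuous (gradient (f n)) := fun n => continuous_gradient (hf n).1
  have cg' : ∀ n, Continuous (gradient (g n)) := fun n => continuous_gradient (hg n).1
  have s1 : ∀ n, ContDiff ℝ ∞ (f n + g n) := fun n => ContDiff.add (hf n).1 (hg n).1
  have s2 : ∀ n, HasCompactSupport (f n + g n) := fun n =>
    HasCompactSupport.add (hf n).2.1 (hg n).2.1
  have s3 : ∀ n, tsupport (f n + g n) ⊆ Ω := fun n =>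
    (tsupport_add (f n) (g n)).trans (Set.union_subset (hf n).2.2 (hg n).2.2)
  refine ⟨hv.add hw, G + H, hG.add hH, fun n => f n + g n, fun n => ⟨s1 n, s2 n, s3 n⟩, ?_, ?_⟩
  · have h0 := hf0.add hg0
    rw [add_zero] at h0
    refine tendsto_of_tendsto_of_tendsto_of_le_of_le tendsto_const_nhds h0 (fun _ => zero_le) ?_
    intro n
    have : f n + g n - (v + w) = (f n - v) + (g n - w) := by abel
    simp only [this]
    exact eLpNorm_add_le ((cf n).aestronglyMeasurable.sub hv.1)
      ((cg n).aestronglyMeasurable.sub hw.1) (by norm_num)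
  · have h0 := hf1.add hg1
    rw [add_zero] at h0
    refine tendsto_of_tendsto_of_tendsto_of_le_of_le tendsto_const_nhds h0 (fun _ => zero_le) ?_
    intro n
    have : gradient (f n + g n) - (G + H) = (gradient (f n) - G) + (gradient (g n) - H) := by
      rw [gradient_add_of_smooth (hf n).1 (hg n).1]; abel
    simp only [this]
    exact eLpNorm_add_le ((cf' n).aestronglyMeasurable.sub hG.1)
      ((cg' n).aestronglyMeasurable.sub hH.1) (by norm_num)

theorem MemH10.smul (c : ℝ) {v : Space d → ℝ} (hv : MemH10 Ω v) : MemH10 Ω (c • v) := by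
  obtain ⟨hv, G, hG, f, hf, hf0, hf1⟩ := hv
  refine ⟨hv.const_smul c, c • G, hG.const_smul c, fun n => c • f n,
    fun n => ⟨contDiff_const.smul (hf n).1, ?_, ?_⟩, ?_, ?_⟩
  · exact (hf n).2.1.mono (Function.support_const_smul_subset c (f n))
  · exact (closure_mono (Function.support_const_smul_subset c (f n))).trans (hf n).2.2
  · have h0 := ENNReal.Tendsto.const_mul (a := ‖c‖ₑ) hf0 (Or.inr (by simp))
    rw [mul_zero] at h0
    refine h0.congr fun n => ?_
    rw [← smul_sub, eLpNorm_const_smul]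
  · have h0 := ENNReal.Tendsto.const_mul (a := ‖c‖ₑ) hf1 (Or.inr (by simp))
    rw [mul_zero] at h0
    refine h0.congr fun n => ?_
    rw [gradient_smul_of_smooth (hf n).1 c, ← smul_sub, eLpNorm_const_smul]

theorem IsPolyOn.add {k : ℕ} {v w : Space d → ℝ} {T : Finset (Space d)}
    (hv : IsPolyOn k v T) (hw : IsPolyOn k w T) : IsPolyOn k (v + w) T := by
  obtain ⟨p, hp, hp'⟩ := hv
  obtain ⟨q, hq, hq'⟩ := hw
  exact ⟨p + q, (MvPolynomial.totalDegree_add p q).trans (max_le hp hq),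
    fun x hx => by simp [hp' x hx, hq' x hx]⟩

theorem IsPolyOn.smul {k : ℕ} (c : ℝ) {v : Space d → ℝ} {T : Finset (Space d)}
    (hv : IsPolyOn k v T) : IsPolyOn k (c • v) T := by
  obtain ⟨p, hp, hp'⟩ := hv
  exact ⟨c • p, (MvPolynomial.totalDegree_smul_le c p).trans hp, fun x hx => by simp [hp' x hx]⟩

theorem SmoothAt.add {M : Mesh d Ω} {k r : ℕ} {v w : Space d → ℝ} {x : Space d}
    (hv : ∀ T ∈ M.cells, IsPolyOn k v T) (hw : ∀ T ∈ M.cells, IsPolyOn k w T)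
    (h1 : SmoothAt M r v x) (h2 : SmoothAt M r w x) : SmoothAt M r (v + w) x := by
  intro T hT T' hT' hx hx' j hj
  have key : ∀ S ∈ M.cells, x ∈ hull S → derivOn j (v + w) S x = derivOn j v S x + derivOn j w S x :=
    fun S hS hxS => iteratedFDerivWithin_add_apply ((hv S hS).contDiffWithinAt hxS j)
      ((hw S hS).contDiffWithinAt hxS j) (M.uniqueDiffOn hS) hxS
  rw [key T hT hx, key T' hT' hx', h1 T hT T' hT' hx hx' j hj, h2 T hT T' hT' hx hx' j hj]

theorem SmoothAt.smul {M : Mesh d Ω} {k r : ℕ} (c : ℝ) {v : Space d → ℝ} {x : Space d}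
    (hv : ∀ T ∈ M.cells, IsPolyOn k v T) (h1 : SmoothAt M r v x) : SmoothAt M r (c • v) x := by
  intro T hT T' hT' hx hx' j hj
  have key : ∀ S ∈ M.cells, x ∈ hull S → derivOn j (c • v) S x = c • derivOn j v S x :=
    fun S hS hxS => iteratedFDerivWithin_const_smul_apply ((hv S hS).contDiffWithinAt hxS j)
      (M.uniqueDiffOn hS) hxS
  rw [key T hT hx, key T' hT' hx', h1 T hT T' hT' hx hx' j hj]

theorem SmoothAt.zero {M : Mesh d Ω} {r : ℕ} {x : Space d} :
    SmoothAt M r (0 : Space d → ℝ) x := by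
  intro T _ T' _ _ _ j _
  have key : ∀ S : Finset (Space d), derivOn j (0 : Space d → ℝ) S x = 0 := fun S => by
    unfold derivOn
    exact congrFun (iteratedFDerivWithin_fun_zero (𝕜 := ℝ) (i := j) (s := hull S)) x
  rw [key, key]

end closure

/-- The finite element space `V_h` of degree `k`: functions in `H¹₀(Ω)` that are polynomials of
degree at most `k` on every element and that are
* `C¹` at all vertices, if `d = 2` (Hermite element);
* `C¹` on all edges and `C²` at all vertices, if `d = 3` (Argyris element).
A member is represented by its continuous representative on the closure of `Ω`, which is a
polynomial on each *closed* element and has the value zero on the boundary, and it is extended by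
zero to the complement of `Ω`. -/
def feSpace {d : ℕ} {Ω : Set (Space d)} (M : Mesh d Ω) (k : ℕ) :
    Submodule ℝ (Space d → ℝ) where
  carrier := {v | MemH10 Ω v ∧ (∀ x ∉ Ω, v x = 0) ∧ (∀ T ∈ M.cells, IsPolyOn k v T) ∧
    (d = 2 → ∀ z, {z} ∈ M.faces → SmoothAt M 1 v z) ∧
    (d = 3 → (∀ s ∈ M.faces, s.card = 2 → ∀ x ∈ hull s, SmoothAt M 1 v x) ∧
      ∀ z, {z} ∈ M.faces → SmoothAt M 2 v z)}
  zero_mem' := ⟨MemH10.zero, fun _ _ => rfl, fun _ _ => ⟨0, by simp, by simp⟩,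
    fun _ _ _ => SmoothAt.zero, fun _ => ⟨fun _ _ _ _ _ => SmoothAt.zero,
      fun _ _ => SmoothAt.zero⟩⟩
  add_mem' := fun {v w} ⟨a, b, c, e, f⟩ ⟨a', b', c', e', f'⟩ =>
    ⟨a.add a', fun x hx => by simp [b x hx, b' x hx], fun T hT => (c T hT).add (c' T hT),
      fun h z hz => SmoothAt.add c c' (e h z hz) (e' h z hz),
      fun h => ⟨fun s hs h2 x hx => SmoothAt.add c c' ((f h).1 s hs h2 x hx)
        ((f' h).1 s hs h2 x hx), fun z hz => SmoothAt.add c c' ((f h).2 z hz) ((f' h).2 z hz)⟩⟩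
  smul_mem' := fun r v ⟨a, b, c, e, f⟩ =>
    ⟨a.smul r, fun x hx => by simp [b x hx], fun T hT => (c T hT).smul r,
      fun h z hz => SmoothAt.smul r c (e h z hz),
      fun h => ⟨fun s hs h2 x hx => SmoothAt.smul r c ((f h).1 s hs h2 x hx),
        fun z hz => SmoothAt.smul r c ((f h).2 z hz)⟩⟩

/-- The inner product
`(w,v)_{λ,h} = ∑_T (D²w,D²v)_T + 2λ(∇w,∇v)_Ω + λ²(w,v)_Ω`. -/
noncomputable def energy {d : ℕ} {Ω : Set (Space d)} (M : Mesh d Ω) (lam : ℝ)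
    (w v : Space d → ℝ) : ℝ :=
  (∑ T ∈ M.cells, ∫ x in hull T, ∑ i : Fin d, ∑ j : Fin d,
      derivOn 2 w T x ![unitVec i, unitVec j] * derivOn 2 v T x ![unitVec i, unitVec j])
    + 2 * lam * (∫ x in Ω, inner ℝ (gradient w x) (gradient v x))
    + lam ^ 2 * ∫ x in Ω, w x * v x

/-- `∑_T (h_T⁻² + λ)² ‖v‖²_{L²(T)}`. -/
noncomputable def weightedL2 {d : ℕ} {Ω : Set (Space d)} (M : Mesh d Ω) (lam : ℝ)
    (v : Space d → ℝ) : ℝ :=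
  ∑ T ∈ M.cells, ((diameter T ^ 2)⁻¹ + lam) ^ 2 * ∫ x in hull T, v x ^ 2

/-! ### Degrees of freedom

Every degree of freedom has the form `N(v) = ⨍_D ∇^r v (t₁,…,t_r)`, where `D` is a simplex (for
instance a point or a whole subsimplex of the mesh), `r ∈ {0,1,2}` and the `t_i` are unit vectors. -/

/-- The reference simplex in `ℝ^m`. -/
def refSimplex (m : ℕ) : Set (Fin m → ℝ) := {x | (∀ i, 0 ≤ x i) ∧ ∑ i, x i ≤ 1}

/-- The barycentric coordinates of a point of `ℝ^m` with respect to the reference simplex. -/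
def bary {m : ℕ} (x : Fin m → ℝ) : Fin (m + 1) → ℝ := Fin.cons (1 - ∑ i, x i) x

/-- The integral average `⨍_D f` over the `j`-dimensional simplex `D` with vertices
`w_0, …, w_j`, through its affine parametrization; for `j = 0` this is `f w_0`. -/
noncomputable def simplexAverage {F : Type*} [AddCommGroup F] [Module ℝ F] {j : ℕ}
    (w : Fin (j + 1) → F) (f : F → ℝ) : ℝ :=
  ⨍ s in refSimplex j, f (∑ l, bary s l • w l)

/-- A simplex (of some dimension `dim ≤ m`) inside the `m`-dimensional simplex; its vertices are
given by their barycentric coordinates. -/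
structure RefDomain (m : ℕ) where
  dim : ℕ
  pts : Fin (dim + 1) → Fin (m + 1) → ℝ
  mem : ∀ l, pts l ∈ stdSimplex ℝ (Fin (m + 1))
  indep : AffineIndependent ℝ pts

/-- The average of a polynomial over a simplex inside the reference simplex. -/
noncomputable def RefDomain.average {m : ℕ} (D : RefDomain m) (p : MvPolynomial (Fin m) ℝ) : ℝ :=
  simplexAverage (fun l => fun i : Fin m => D.pts l i.succ) fun x => MvPolynomial.eval x p

/-- The bubble polynomial `λ_0 λ_1 ⋯ λ_m` of the reference simplex. -/
noncomputable def bubble (m : ℕ) : MvPolynomial (Fin m) ℝ :=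
  (1 - ∑ i, MvPolynomial.X i) * ∏ i, MvPolynomial.X i

/-- The averages over the simplices `D_i` are unisolvent for the polynomials of degree at most `n`
on the reference simplex that vanish to order `r` on its boundary. -/
def Unisolvent (m r n : ℕ) {I : ℕ} (D : Fin I → RefDomain m) : Prop :=
  ∀ c : Fin I → ℝ, ∃! p : MvPolynomial (Fin m) ℝ,
    p.totalDegree ≤ n ∧ bubble m ^ r ∣ p ∧ ∀ i, (D i).average p = c i

/-- The position, relative to a mesh simplex, of the domains of the degrees of freedom of the
`𝒫_k` element in dimension `d` that are not located at the vertices: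
function values (averages) on the subsimplices of each dimension `1 ≤ m ≤ d`, and, for `d = 3`,
normal derivatives on the edges.  They determine what is left of a polynomial of degree `k` (on an
edge, in the case of derivatives: of degree `k - 1`) once the data on the boundary are zero. -/
structure DofPattern (d k : ℕ) where
  nVal : ℕ → ℕ
  val : ∀ m, Fin (nVal m) → RefDomain m
  nEdge : ℕ
  edge : Fin nEdge → RefDomain 1
  val_unisolvent : ∀ m, 1 ≤ m → m ≤ d → Unisolvent m (d + 1 - m) k (val m)
  edge_unisolvent : d = 3 → Unisolvent 1 2 (k - 1) edge

/-- A degree of freedom `v ↦ ⨍_D ∇^order (v|_cell)(dir_1, …)`, where `D` is the simplex with the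
vertices `vert` in the element `cell`. -/
structure Dof (d : ℕ) where
  cell : Finset (Space d)
  dim : ℕ
  vert : Fin (dim + 1) → Space d
  order : ℕ
  dir : Fin order → Space d

/-- The value of a degree of freedom. -/
noncomputable def Dof.eval {d : ℕ} (N : Dof d) (v : Space d → ℝ) : ℝ :=
  simplexAverage N.vert fun y => derivOn N.order v N.cell y N.dir

/-- The gradients at `x` that are compatible with zero values on `∂Ω`: all of `ℝ^d` if `x ∈ Ω`,
the vectors that are orthogonal to `∂Ω` if `x ∈ ∂Ω`. -/
def gradSpace {d : ℕ} (Ω : Set (Space d)) (x : Space d) : Set (Space d) :=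
  {g | ∀ y, segment ℝ x y ⊆ frontier Ω → inner ℝ g (y - x) = 0}

/-- The Hessians at `x` that are compatible with zero values on `∂Ω`: all symmetric bilinear forms
if `x ∈ Ω`, and those with zero second tangential derivatives if `x ∈ ∂Ω`. -/
def hessSpace {d : ℕ} (Ω : Set (Space d)) (x : Space d) :
    Set (LinearMap.BilinForm ℝ (Space d)) :=
  {H | (∀ a b, H a b = H b a) ∧ ∀ y, segment ℝ x y ⊆ frontier Ω → H (y - x) (y - x) = 0}

/-- The normal derivatives on the edge `s` that are compatible with zero values on `∂Ω`. -/
noncomputable def edgeSpace {d : ℕ} (Ω : Set (Space d)) (s : Finset (Space d)) : Set (Space d) :=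
  {g | g ∈ gradSpace Ω (s.centroid ℝ id) ∧ ∀ a ∈ s, ∀ b ∈ s, inner ℝ g (a - b) = 0}

/-- The unit directions `t_i` determine the members of a space `J` of gradients: the derivatives in
these directions are coordinates on `J`, with conditioning at most `κ`. -/
def IsGradFrame {d : ℕ} (J : Set (Space d)) (κ : ℝ) {n : ℕ} (t : Fin n → Space d) : Prop :=
  (∀ i, ‖t i‖ = 1) ∧ (∀ c : Fin n → ℝ, ∃ g ∈ J, ∀ i, inner ℝ g (t i) = c i) ∧
    ∀ g ∈ J, ‖g‖ ^ 2 ≤ κ * ∑ i, inner ℝ g (t i) ^ 2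

/-- The same for pairs of unit directions and a space `J` of Hessians. -/
def IsHessFrame {d : ℕ} (J : Set (LinearMap.BilinForm ℝ (Space d))) (κ : ℝ) {n : ℕ}
    (t : Fin n → Fin 2 → Space d) : Prop :=
  (∀ i l, ‖t i l‖ = 1) ∧ (∀ c : Fin n → ℝ, ∃ H ∈ J, ∀ i, H (t i 0) (t i 1) = c i) ∧
    ∀ H ∈ J, (∑ a, ∑ b, H (unitVec a) (unitVec b) ^ 2) ≤ κ * ∑ i, H (t i 0) (t i 1) ^ 2

/-- The choices that fix the degrees of freedom of `V_h` on a given mesh: a numbering of the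
vertices of each subsimplex (which places the pattern), the directions of the derivatives, with
conditioning at most `κ`, and for each subsimplex an element `cell s` that contains it, from which
derivatives are taken (for members of `V_h` they do not depend on it). -/
structure DofChoice {d k : ℕ} {Ω : Set (Space d)} (M : Mesh d Ω) (P : DofPattern d k)
    (κ : ℝ) where
  cell : Finset (Space d) → Finset (Space d)
  cell_spec : ∀ s ∈ M.faces, cell s ∈ M.cells ∧ s ⊆ cell s
  num : ∀ m : ℕ, Finset (Space d) → Fin (m + 1) → Space d
  num_spec : ∀ m, ∀ s ∈ M.faces, s.card = m + 1 →
    Function.Injective (num m s) ∧ ∀ i, num m s i ∈ s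
  nGrad : Space d → ℕ
  gradDir : ∀ z, Fin (nGrad z) → Space d
  grad_frame : ∀ z, {z} ∈ M.faces → IsGradFrame (gradSpace Ω z) κ (gradDir z)
  nHess : Space d → ℕ
  hessDir : ∀ z, Fin (nHess z) → Fin 2 → Space d
  hess_frame : d = 3 → ∀ z, {z} ∈ M.faces → IsHessFrame (hessSpace Ω z) κ (hessDir z)
  nNormal : Finset (Space d) → ℕ
  normalDir : ∀ s, Fin (nNormal s) → Space d
  normal_frame : d = 3 → ∀ s ∈ M.faces, s.card = 2 →
    IsGradFrame (edgeSpace Ω s) κ (normalDir s) ∧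
      ∀ i, ∀ a ∈ s, ∀ b ∈ s, inner ℝ (normalDir s i) (a - b) = 0

/-- The labels of the degrees of freedom of `V_h`: values at the interior vertices; first
derivatives at the vertices; for `d = 3`, second derivatives at the vertices; values on the
subsimplices of dimension `m ≥ 1` that do not lie in `∂Ω`; for `d = 3`, normal derivatives on the
edges. -/
inductive DofIndex {d k : ℕ} {Ω : Set (Space d)} {M : Mesh d Ω} {P : DofPattern d k} {κ : ℝ}
    (S : DofChoice M P κ) : Type
  | vertexValue (z : Space d) (hz : {z} ∈ M.faces) (hzΩ : z ∈ Ω)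
  | vertexGrad (z : Space d) (hz : {z} ∈ M.faces) (i : Fin (S.nGrad z))
  | vertexHess (hd : d = 3) (z : Space d) (hz : {z} ∈ M.faces) (i : Fin (S.nHess z))
  | faceValue (m : ℕ) (hm : 1 ≤ m) (s : Finset (Space d)) (hs : s ∈ M.faces)
      (hc : s.card = m + 1) (hb : ¬ hull s ⊆ frontier Ω) (a : Fin (P.nVal m))
  | edgeNormal (hd : d = 3) (s : Finset (Space d)) (hs : s ∈ M.faces) (hc : s.card = 2)
      (a : Fin P.nEdge) (i : Fin (S.nNormal s))

/-- The degree of freedom with a given label. -/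
noncomputable def DofChoice.dof {d k : ℕ} {Ω : Set (Space d)} {M : Mesh d Ω} {P : DofPattern d k}
    {κ : ℝ} (S : DofChoice M P κ) : DofIndex S → Dof d
  | .vertexValue z _ _ => ⟨S.cell {z}, 0, fun _ => z, 0, ![]⟩
  | .vertexGrad z _ i => ⟨S.cell {z}, 0, fun _ => z, 1, ![S.gradDir z i]⟩
  | .vertexHess _ z _ i => ⟨S.cell {z}, 0, fun _ => z, 2, S.hessDir z i⟩
  | .faceValue m _ s _ _ _ a =>
      ⟨S.cell s, (P.val m a).dim, fun l => ∑ j, (P.val m a).pts l j • S.num m s j, 0, ![]⟩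
  | .edgeNormal _ s _ _ a i =>
      ⟨S.cell s, (P.edge a).dim, fun l => ∑ j, (P.edge a).pts l j • S.num 1 s j, 1,
        ![S.normalDir s i]⟩

/-- `φ_1, …, φ_n` is the nodal basis of `V_h`, with respect to the enumeration `e` of the degrees of
freedom: `N_i(φ_j) = δ_{ij}`. -/
def IsNodalBasis {d k : ℕ} {Ω : Set (Space d)} {M : Mesh d Ω} {P : DofPattern d k} {κ : ℝ}
    (S : DofChoice M P κ) {n : ℕ} (e : Fin n ≃ DofIndex S)
    (φ : Module.Basis (Fin n) ℝ (feSpace M k)) : Prop :=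
  ∀ i j, (S.dof (e i)).eval (φ j : Space d → ℝ) = if i = j then 1 else 0

/-! ### The smoothers

In the nodal basis, a member of `V_h` is identified with its vector of coefficients, and
`f ∈ V_h'` with the vector `(⟨f, φ_i⟩)_i`.  Then `A_{λ,h} : V_h → V_h'` and the smoothers
`V_h' → V_h` are matrices, and `⟨B v, v⟩ = xᵀ B x` for `B : V_h → V_h'`, if `x` is the vector of
`v`. -/

/-- The matrix of `A_{λ,h}`. -/
noncomputable def stiffness {d k : ℕ} {Ω : Set (Space d)} (M : Mesh d Ω) (lam : ℝ) {n : ℕ}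
    (φ : Module.Basis (Fin n) ℝ (feSpace M k)) : Matrix (Fin n) (Fin n) ℝ :=
  Matrix.of fun i j => energy M lam (φ j : Space d → ℝ) (φ i : Space d → ℝ)

/-- The lower triangular part of a matrix, with the diagonal. -/
def lowerPart {n : ℕ} (A : Matrix (Fin n) (Fin n) ℝ) : Matrix (Fin n) (Fin n) ℝ :=
  Matrix.of fun i j => if j ≤ i then A i j else 0

/-- The Gauss–Seidel smoother `R` of `A`. -/
noncomputable def gaussSeidel {n : ℕ} (A : Matrix (Fin n) (Fin n) ℝ) : Matrix (Fin n) (Fin n) ℝ :=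
  (lowerPart A)⁻¹

/-- The symmetric Gauss–Seidel smoother `R̄` of an invertible matrix `A`, given by
`I - R̄ A = (I - Rᵀ A)(I - R A)`. -/
noncomputable def symGaussSeidel {n : ℕ} (A : Matrix (Fin n) (Fin n) ℝ) :
    Matrix (Fin n) (Fin n) ℝ :=
  (1 - (1 - (gaussSeidel A)ᵀ * A) * (1 - gaussSeidel A * A)) * A⁻¹

/-- `D`, the diagonal part of `A`; its inverse is the Jacobi smoother of `A`. -/
def diagonalPart {n : ℕ} (A : Matrix (Fin n) (Fin n) ℝ) : Matrix (Fin n) (Fin n) ℝ :=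
  Matrix.diagonal fun i => A i i

/-- `‖v‖²_B = ⟨B v, v⟩`, with the matrix of `B : V_h → V_h'` in the basis `φ`. -/
noncomputable def sqNorm {d k : ℕ} {Ω : Set (Space d)} {M : Mesh d Ω} {n : ℕ}
    (φ : Module.Basis (Fin n) ℝ (feSpace M k)) (B : Matrix (Fin n) (Fin n) ℝ)
    (v : feSpace M k) : ℝ :=
  (φ.repr v : Fin n → ℝ) ⬝ᵥ (B *ᵥ (φ.repr v : Fin n → ℝ))

end SmootherFEM

namespace SmootherFEM

open MvPolynomial

/-! The proof combines a statement about matrices with estimates on a single element, which are then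
summed over the mesh.

Matrices. Let L be the lower triangle of A including the diagonal D. Since L + Lᵀ = A + D, the
symmetric smoother equals L⁻ᵀ D L⁻¹, so its inverse is L D⁻¹ Lᵀ. Positivity of A gives xᵀDx ≤ 2
xᵀLᵀx, and Young's inequality turns this into D ≤ 4 R̄⁻¹ (`diagonalPart_form_le`). Conversely, A is
a sum of element matrices that satisfy a Cauchy–Schwarz inequality and have at most K active
indices; Cauchy–Schwarz over the elements and over the local indices gives R̄⁻¹ ≤ K² D for every
ordering of the unknowns (`symGaussSeidel_inv_form_le`).

Elements. For v = ∑ xᵢ φᵢ, the form of D is the sum over T of ∑ xᵢ² a_T(φᵢ, φᵢ), where a_T is the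
energy on T. Two facts compare it with the weighted L² norm. First, ∫_T v² is comparable to ∑ xᵢ²
∫_T φᵢ² (`exists_nodal_stability`). Second, a_T(φᵢ, φᵢ) is comparable to (h_T⁻² + λ)² ∫_T φᵢ². The
upper bound here is an inverse estimate (`exists_cellForm_le`). The lower bound is false for general
v as λ → 0, because affine functions have no Hessian. But a degree of freedom sits at one
subsimplex, so φᵢ vanishes to first order at some vertex of T (`IsNodalBasis.exists_vertex`), and a
Poincaré inequality applies (`exists_le_cellForm`).

Stability rests on one principle: on a finite-dimensional space of polynomials, a separating family
of functionals bounds every linear map (`exists_bound_of_separating`). Unisolvence says that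
boundary data and averages are separating on each reference simplex. Climbing from vertices through
edges and faces to the element bounds a polynomial by its degrees of freedom, scaled by h_T to the
order of the derivative (`exists_local_bound_two`, `exists_local_bound_three`). Data that are
missing at ∂Ω are supplied by the zero trace: it makes values vanish and forces gradients, Hessians
and averaged normal derivatives into the compatible spaces on which the chosen directions are
coordinates (`exists_cellPoly_bound`). All constants come from reference simplices, σ and κ, hence
depend neither on λ nor on the mesh. -/

/-- Real polynomials in `m` variables. -/
abbrev Poly (m : ℕ) : Type := MvPolynomial (Fin m) ℝ

/-- The value of a polynomial at a point of Euclidean space. -/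
noncomputable abbrev pev {d : ℕ} (p : Poly d) (y : Space d) : ℝ := eval (fun i => y i) p

/-! ### Directional derivatives of polynomials -/

/-- The derivative of polynomials in the direction `t`. -/
noncomputable def dirDeriv {d : ℕ} (t : Space d) : Derivation ℝ (Poly d) (Poly d) :=
  mkDerivation ℝ fun i => C (t i)

theorem dirDeriv_X {d : ℕ} (t : Space d) (i : Fin d) : dirDeriv t (X i) = C (t i) :=
  mkDerivation_X _ _ _

theorem dirDeriv_add {d : ℕ} (t u : Space d) (p : Poly d) :
    dirDeriv (t + u) p = dirDeriv t p + dirDeriv u p := by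
  have : dirDeriv (t + u) = dirDeriv t + dirDeriv u := by
    refine derivation_ext fun i => ?_
    simp [dirDeriv_X]
  rw [this]; rfl

theorem dirDeriv_smul {d : ℕ} (c : ℝ) (t : Space d) (p : Poly d) :
    dirDeriv (c • t) p = c • dirDeriv t p := by
  have : dirDeriv (c • t) = c • dirDeriv t := by
    refine derivation_ext fun i => ?_
    simp [dirDeriv_X, smul_eq_C_mul]
  rw [this]; rfl

/-- `dirDeriv` as a linear map in the direction. -/
noncomputable def dirDerivₗ {d : ℕ} (p : Poly d) : Space d →ₗ[ℝ] Poly d where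
  toFun t := dirDeriv t p
  map_add' t u := dirDeriv_add t u p
  map_smul' c t := dirDeriv_smul c t p

theorem dirDerivₗ_apply {d : ℕ} (p : Poly d) (t : Space d) : dirDerivₗ p t = dirDeriv t p := rfl

theorem dirDeriv_sum {d : ℕ} {ι : Type*} (s : Finset ι) (t : ι → Space d) (p : Poly d) :
    dirDeriv (∑ i ∈ s, t i) p = ∑ i ∈ s, dirDeriv (t i) p :=
  map_sum (dirDerivₗ p) t s

theorem dirDeriv_unitVec {d : ℕ} (i : Fin d) (p : Poly d) :
    dirDeriv (unitVec i) p = pderiv i p := by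
  have : dirDeriv (unitVec i) = pderiv i := by
    refine derivation_ext fun j => ?_
    rw [dirDeriv_X, pderiv_X]
    by_cases h : i = j
    · subst h; simp [unitVec]
    · simp [unitVec, Ne.symm h]
  rw [this]

theorem sum_unitVec {d : ℕ} (t : Space d) : ∑ i, t i • unitVec i = t := by
  ext j
  simp [unitVec, Pi.single_apply]

theorem dirDeriv_eq_sum {d : ℕ} (t : Space d) (p : Poly d) :
    dirDeriv t p = ∑ i, t i • pderiv i p := by
  conv_lhs => rw [← sum_unitVec t]
  rw [dirDeriv_sum]
  exact Finset.sum_congr rfl fun i _ => by rw [dirDeriv_smul, dirDeriv_unitVec]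

/-- The commutator of two derivations is a derivation, and it kills the variables because their
derivatives are constants. -/
theorem dirDeriv_comm {d : ℕ} (t u : Space d) (p : Poly d) :
    dirDeriv t (dirDeriv u p) = dirDeriv u (dirDeriv t p) := by
  have h : ⁅dirDeriv t, dirDeriv u⁆ = 0 := by
    refine derivation_ext fun l => ?_
    rw [Derivation.commutator_apply, dirDeriv_X, dirDeriv_X]
    simp only [← algebraMap_eq, Derivation.map_algebraMap, sub_zero]
    rfl
  have := congrArg (fun D : Derivation ℝ (Poly d) (Poly d) => D p) h
  simp only [Derivation.commutator_apply] at this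
  exact sub_eq_zero.1 this

theorem totalDegree_pderiv_le {m : ℕ} (i : Fin m) (p : Poly m) :
    (pderiv i p).totalDegree ≤ p.totalDegree - 1 := by
  rw [p.as_sum, map_sum]
  conv_rhs => rw [← p.as_sum]
  refine totalDegree_finsetSum_le fun s hs => ?_
  rw [pderiv_monomial]
  rcases Nat.eq_zero_or_pos (s i) with h | h
  · simp [h]
  · refine (totalDegree_monomial_le _ _).trans ?_
    have h1 : (s.sum fun _ e => e) ≤ p.totalDegree := le_totalDegree hs
    have h2 : (Finsupp.single i 1) ≤ s := by
      rw [Finsupp.single_le_iff]; exact h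
    have h3 : s = (s - Finsupp.single i 1) + Finsupp.single i 1 := (tsub_add_cancel_of_le h2).symm
    have h4 : (s.sum fun _ e => e)
        = ((s - Finsupp.single i 1).sum fun _ e => e) + 1 := by
      conv_lhs => rw [h3]
      rw [Finsupp.sum_add_index' (fun _ => rfl) (fun _ _ _ => rfl), Finsupp.sum_single_index rfl]
    have h5 : ((s - Finsupp.single i 1).sum fun _ e => e)
      = (s - Finsupp.single i 1).sum fun _ => id := rfl
    omega

theorem totalDegree_dirDeriv_le {d : ℕ} (t : Space d) (p : Poly d) :
    (dirDeriv t p).totalDegree ≤ p.totalDegree - 1 := by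
  rw [dirDeriv_eq_sum]
  exact totalDegree_finsetSum_le fun i _ =>
    (totalDegree_smul_le _ _).trans (totalDegree_pderiv_le i p)

/-! ### Barycentric parametrization -/

/-- The affine parametrization, by the reference simplex, of the simplex with vertices `w`. -/
noncomputable def param {d m : ℕ} (w : Fin (m + 1) → Space d) (x : Fin m → ℝ) : Space d :=
  ∑ l, bary x l • w l

theorem param_eq {d m : ℕ} (w : Fin (m + 1) → Space d) (x : Fin m → ℝ) :
    param w x = w 0 + ∑ j, x j • (w j.succ - w 0) := by
  simp only [param, Fin.sum_univ_succ, bary, Fin.cons_zero, Fin.cons_succ, smul_sub,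
    Finset.sum_sub_distrib, ← Finset.sum_smul, sub_smul, one_smul]
  abel

/-- The pull-back of a polynomial under `param w`. -/
noncomputable def pull {d m : ℕ} (w : Fin (m + 1) → Space d) : Poly d →ₐ[ℝ] Poly m :=
  aeval fun i => C (w 0 i) + ∑ j : Fin m, C ((w j.succ - w 0) i) * X j

theorem pull_X {d m : ℕ} (w : Fin (m + 1) → Space d) (i : Fin d) :
    pull w (X i) = C (w 0 i) + ∑ j : Fin m, C ((w j.succ - w 0) i) * X j := aeval_X _ _

theorem eval_pull {d m : ℕ} (w : Fin (m + 1) → Space d) (p : Poly d) (x : Fin m → ℝ) :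
    eval x (pull w p) = pev p (param w x) := by
  induction p using MvPolynomial.induction_on with
  | C a => simp [pull]
  | add p q hp hq => simp [hp, hq]
  | mul_X p i hp =>
    rw [map_mul, map_mul, hp, pull_X, pev, pev, map_mul, eval_X, param_eq]
    simp [mul_comm]

/-- Chain rule for the affine map `param w`. Reference partial derivatives correspond to derivatives
along the edges at `w 0`, not normalised; no Jacobian appears, which keeps the constants below free
of the shape of the simplex. -/
theorem pderiv_pull {d m : ℕ} (w : Fin (m + 1) → Space d) (p : Poly d) (j : Fin m) :
    pderiv j (pull w p) = pull w (dirDeriv (w j.succ - w 0) p) := by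
  induction p using MvPolynomial.induction_on with
  | C a =>
    simp only [← algebraMap_eq, AlgHom.commutes, Derivation.map_algebraMap, map_zero]
  | add p q hp hq => simp only [map_add, hp, hq]
  | mul_X p i hp =>
    rw [map_mul, Derivation.leibniz, hp, Derivation.leibniz, dirDeriv_X, pull_X]
    simp only [map_add, map_sum, smul_eq_mul, map_mul, Derivation.leibniz, pderiv_X, pderiv_C,
      pull_X]
    congr 2
    · simp [Pi.single_apply, pull]

theorem totalDegree_pull_le {d m : ℕ} (w : Fin (m + 1) → Space d) (p : Poly d) :
    (pull w p).totalDegree ≤ p.totalDegree := by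
  conv_lhs => rw [p.as_sum, map_sum]
  refine totalDegree_finsetSum_le fun s hs => ?_
  rw [pull, aeval_monomial]
  refine (totalDegree_mul _ _).trans ?_
  have h0 : (algebraMap ℝ (Poly m) (coeff s p)).totalDegree = 0 := totalDegree_C _
  rw [h0, zero_add]
  refine (totalDegree_finsetProd _ _).trans (le_trans ?_ (le_totalDegree hs))
  refine Finset.sum_le_sum fun i _ => (totalDegree_pow _ _).trans ?_
  refine (Nat.mul_le_mul_left _ ?_).trans (mul_one _).le
  refine (totalDegree_add _ _).trans (max_le (by simp) ?_)
  refine totalDegree_finsetSum_le fun j _ => (totalDegree_mul _ _).trans ?_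
  rw [totalDegree_C, totalDegree_X, zero_add]

/-! ### Polynomials that vanish on faces of the reference simplex -/

/-- The barycentric coordinates as polynomials. -/
noncomputable def baryPoly {m : ℕ} : Fin (m + 1) → Poly m := Fin.cons (1 - ∑ i, X i) X

theorem eval_baryPoly {m : ℕ} (x : Fin m → ℝ) (j : Fin (m + 1)) :
    eval x (baryPoly j) = bary x j := by
  refine Fin.cases ?_ (fun i => ?_) j <;> simp [baryPoly, bary]

theorem bubble_eq_prod (m : ℕ) : bubble m = ∏ j, baryPoly j := by
  simp [bubble, baryPoly, Fin.prod_univ_succ]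

/-- A variable is prime, so it suffices to find a zero of it at which the other coordinate does not
vanish: the origin for the coordinate of index 0, a unit vector for another variable. -/
theorem isRelPrime_baryPoly {m : ℕ} {i j : Fin (m + 1)} (hij : i ≠ j) :
    IsRelPrime (baryPoly i : Poly m) (baryPoly j) := by
  have key : ∀ (l : Fin m) (j : Fin (m + 1)), j ≠ l.succ →
      IsRelPrime (baryPoly l.succ : Poly m) (baryPoly j) := by
    intro l j hj
    have hX : (baryPoly l.succ : Poly m) = X l := by simp [baryPoly]
    rw [hX, (X_prime (i := l)).irreducible.isRelPrime_iff_not_dvd]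
    rintro ⟨q, hq⟩
    revert hj hq
    refine Fin.cases (fun _ hq => ?_) (fun i hj hq => ?_) j
    · have := congrArg (eval (0 : Fin m → ℝ)) hq
      rw [eval_baryPoly] at this
      simp [bary] at this
    · have := congrArg (eval (Pi.single i 1 : Fin m → ℝ)) hq
      have hil : l ≠ i := fun h => hj (by rw [h])
      simp [baryPoly, hil] at this
  rcases Fin.eq_zero_or_eq_succ i with rfl | ⟨l, rfl⟩
  · rcases Fin.eq_zero_or_eq_succ j with rfl | ⟨l, rfl⟩
    · exact absurd rfl hij
    · exact (key l 0 hij).symm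
  · exact key l j hij.symm

theorem bubble_pow_dvd {m r : ℕ} {q : Poly m} (h : ∀ j, baryPoly j ^ r ∣ q) : bubble m ^ r ∣ q := by
  rw [bubble_eq_prod, ← Finset.prod_pow]
  exact Fintype.prod_dvd_of_isRelPrime (fun i j hij => (isRelPrime_baryPoly hij).pow) h

/-- Congruence modulo `β` is preserved by sums and products. This serves as a factor theorem without
division: if the substitution `g` projects onto the zero set of `β`, where `q` vanishes, only `-q`
remains. -/
theorem dvd_aeval_sub {m : ℕ} {β : Poly m} {g : Fin m → Poly m} (hg : ∀ i, β ∣ g i - X i)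
    (q : Poly m) : β ∣ aeval g q - q := by
  induction q using MvPolynomial.induction_on with
  | C a => simp
  | add p q hp hq =>
    have : aeval g (p + q) - (p + q) = (aeval g p - p) + (aeval g q - q) := by
      rw [map_add]; ring
    rw [this]; exact dvd_add hp hq
  | mul_X p i hp =>
    have : aeval g (p * X i) - p * X i = (aeval g p - p) * g i + p * (g i - X i) := by
      rw [map_mul, aeval_X]; ring
    rw [this]
    exact dvd_add (hp.mul_right _) ((hg i).mul_left _)

/-- Project along a coordinate onto the hyperplane of the facet. A small box is mapped into the
facet itself, which is the only place where `q` is known to vanish. -/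
theorem baryPoly_dvd {m : ℕ} {q : Poly (m + 1)} (j : Fin (m + 2))
    (h : ∀ x ∈ refSimplex (m + 1), bary x j = 0 → eval x q = 0) : baryPoly j ∣ q := by
  have main : ∀ g : Fin (m + 1) → Poly (m + 1), (∀ i, baryPoly j ∣ g i - X i) →
      (∀ x : Fin (m + 1) → ℝ, (∀ i, 0 < x i ∧ x i < 1 / (m + 1)) →
        (fun i => eval x (g i)) ∈ refSimplex (m + 1) ∧ bary (fun i => eval x (g i)) j = 0) →
      baryPoly j ∣ q := by
    intro g hg hx
    -- The composition vanishes on a product of infinite sets, hence identically.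
    have h0 : aeval g q = 0 := by
      refine funext_set (fun _ => Set.Ioo (0 : ℝ) (1 / (m + 1)))
        (fun _ => Set.Ioo_infinite (by positivity)) fun x hx' => ?_
      obtain ⟨h1, h2⟩ := hx x fun i => hx' i (Set.mem_univ _)
      rw [map_zero, ← h _ h1 h2]
      change (eval x) (aeval g q) = _
      rw [← MvPolynomial.coe_aeval_eq_eval x, ← MvPolynomial.coe_aeval_eq_eval]
      change ((aeval x).comp (aeval g)) q = _
      rw [comp_aeval]
      rfl
    have := dvd_aeval_sub hg q
    rw [h0, zero_sub, dvd_neg] at this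
    exact this
  have hsum : ∀ x : Fin (m + 1) → ℝ, (∀ i, 0 < x i ∧ x i < 1 / (m + 1)) → ∑ i, x i ≤ 1 := by
    intro x hx
    calc ∑ i, x i ≤ ∑ _i : Fin (m + 1), (1 / (m + 1) : ℝ) :=
          Finset.sum_le_sum fun i _ => (hx i).2.le
      _ = 1 := by simp; field_simp
  rcases Fin.eq_zero_or_eq_succ j with rfl | ⟨l, rfl⟩
  -- Adding the coordinate β₀ to the first variable projects onto β₀ = 0; for the other facets the
  -- variable is replaced by 0.
  · refine main (fun i => if i = 0 then X i + baryPoly 0 else X i) (fun i => ?_) fun x hx => ?_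
    · by_cases hi : i = 0 <;> simp [hi]
    · have h1 := hsum x hx
      rw [Fin.sum_univ_succ] at h1
      refine ⟨⟨fun i => ?_, ?_⟩, ?_⟩
      · by_cases hi : i = 0
        · simp only [hi, if_true, map_add, eval_X, eval_baryPoly, bary, Fin.cons_zero]
          rw [Fin.sum_univ_succ]
          linarith [(hx 0).1]
        · simp only [hi, if_false, eval_X]; exact (hx i).1.le
      · rw [Fin.sum_univ_succ]
        simp [eval_baryPoly, bary, Fin.sum_univ_succ, Fin.succ_ne_zero]
        linarith
      · simp [eval_baryPoly, bary, Fin.sum_univ_succ, Fin.succ_ne_zero]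
        ring
  · refine main (fun i => if i = l then 0 else X i) (fun i => ?_) fun x hx => ?_
    · by_cases hi : i = l
      · simp [hi, baryPoly]
      · simp [hi]
    · refine ⟨⟨fun i => ?_, ?_⟩, ?_⟩
      · by_cases hi : i = l
        · simp [hi]
        · simp only [hi, if_false, eval_X]; exact (hx i).1.le
      · refine le_trans (Finset.sum_le_sum fun i _ => ?_) (hsum x hx)
        by_cases hi : i = l
        · simp only [hi, if_true, map_zero]; exact (hx l).1.le
        · simp [hi]
      · simp [bary]

/-- A variable in which the `j`-th barycentric coordinate is not constant. -/
def baryVar {m : ℕ} (j : Fin (m + 2)) : Fin (m + 1) := Fin.cases 0 id j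

theorem pderiv_baryVar {m : ℕ} (j : Fin (m + 2)) :
    ∃ c : ℝ, c ≠ 0 ∧ pderiv (baryVar j) (baryPoly j : Poly (m + 1)) = C c := by
  rcases Fin.eq_zero_or_eq_succ j with rfl | ⟨l, rfl⟩
  · refine ⟨-1, by norm_num, ?_⟩
    simp [baryPoly, baryVar, pderiv_X, Pi.single_apply]
  · exact ⟨1, by norm_num, by simp [baryPoly, baryVar]⟩

/-- If q = β q₁, then on the facet β = 0 the transversal derivative of q is c q₁ with c ≠ 0, so q₁
vanishes there as well. -/
theorem baryPoly_sq_dvd {m : ℕ} {q : Poly (m + 1)} (j : Fin (m + 2))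
    (h : ∀ x ∈ refSimplex (m + 1), bary x j = 0 → eval x q = 0)
    (h' : ∀ x ∈ refSimplex (m + 1), bary x j = 0 → eval x (pderiv (baryVar j) q) = 0) :
    baryPoly j ^ 2 ∣ q := by
  obtain ⟨q1, hq1⟩ := baryPoly_dvd j h
  obtain ⟨c, hc, hc'⟩ := pderiv_baryVar j
  have h1 : baryPoly j ∣ q1 := by
    refine baryPoly_dvd j fun x hx hj => ?_
    have := h' x hx hj
    rw [hq1, Derivation.leibniz, hc'] at this
    simpa [eval_baryPoly, hj, hc] using this
  rw [hq1, sq]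
  exact mul_dvd_mul_left _ h1

/-- If q = β² q₁, the second transversal derivative on the facet is 2c² q₁. -/
theorem baryPoly_cube_dvd {m : ℕ} {q : Poly (m + 1)} (j : Fin (m + 2))
    (h : ∀ x ∈ refSimplex (m + 1), bary x j = 0 → eval x q = 0)
    (h' : ∀ x ∈ refSimplex (m + 1), bary x j = 0 → eval x (pderiv (baryVar j) q) = 0)
    (h'' : ∀ x ∈ refSimplex (m + 1), bary x j = 0 →
      eval x (pderiv (baryVar j) (pderiv (baryVar j) q)) = 0) :
    baryPoly j ^ 3 ∣ q := by
  obtain ⟨q1, hq1⟩ := baryPoly_sq_dvd j h h'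
  obtain ⟨c, hc, hc'⟩ := pderiv_baryVar j
  have h1 : baryPoly j ∣ q1 := by
    refine baryPoly_dvd j fun x hx hj => ?_
    have := h'' x hx hj
    rw [hq1] at this
    simp only [Derivation.leibniz, sq, hc', map_add, smul_eq_mul, map_mul,
      eval_baryPoly, hj, eval_C, pderiv_C, map_zero] at this
    have h3 : eval x q1 * (c * c) = 0 := by linarith
    simpa [hc] using h3
  rw [hq1, pow_succ]
  exact mul_dvd_mul_left _ h1

theorem Unisolvent.eq_zero {m r n I : ℕ} {D : Fin I → RefDomain m} (h : Unisolvent m r n D)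
    {q : Poly m} (hn : q.totalDegree ≤ n) (hb : bubble m ^ r ∣ q) (hD : ∀ i, (D i).average q = 0) :
    q = 0 := by
  refine (h fun _ => 0).unique ⟨hn, hb, hD⟩ ⟨by simp, dvd_zero _, fun i => ?_⟩
  simp [RefDomain.average, simplexAverage]

/-! ### The reference simplex -/

theorem continuous_eval {m : ℕ} (p : Poly m) : Continuous fun x : Fin m → ℝ => eval x p :=
  MvPolynomial.continuous_eval p

theorem le_one_of_mem_refSimplex {m : ℕ} {x : Fin m → ℝ} (hx : x ∈ refSimplex m) (i : Fin m) :
    x i ≤ 1 :=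
  (Finset.single_le_sum (fun j _ => hx.1 j) (Finset.mem_univ i)).trans hx.2

theorem isCompact_refSimplex (m : ℕ) : IsCompact (refSimplex m) := by
  refine IsCompact.of_isClosed_subset (isCompact_Icc (a := (0 : Fin m → ℝ)) (b := 1)) ?_
    fun x hx => ⟨hx.1, le_one_of_mem_refSimplex hx⟩
  have h1 : refSimplex m = (⋂ i, {x : Fin m → ℝ | 0 ≤ x i}) ∩ {x | ∑ i, x i ≤ 1} := by
    ext x; simp [refSimplex]
  rw [h1]
  exact (isClosed_iInter fun i => isClosed_le continuous_const (continuous_apply i)).inter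
    (isClosed_le (by fun_prop) continuous_const)

theorem bary_nonneg {m : ℕ} {x : Fin m → ℝ} (hx : x ∈ refSimplex m) (l : Fin (m + 1)) :
    0 ≤ bary x l := by
  refine Fin.cases ?_ (fun i => ?_) l
  · simpa [bary] using hx.2
  · simpa [bary] using hx.1 i

theorem sum_bary {m : ℕ} (x : Fin m → ℝ) : ∑ l, bary x l = 1 := by
  simp [bary, Fin.sum_univ_succ]

theorem bary_mem_stdSimplex {m : ℕ} {x : Fin m → ℝ} (hx : x ∈ refSimplex m) :
    bary x ∈ stdSimplex ℝ (Fin (m + 1)) := ⟨bary_nonneg hx, sum_bary x⟩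

theorem exists_bary_eq {m : ℕ} {c : Fin (m + 1) → ℝ} (hc : c ∈ stdSimplex ℝ (Fin (m + 1))) :
    ∃ x ∈ refSimplex m, bary x = c := by
  have h := hc.2
  rw [Fin.sum_univ_succ] at h
  refine ⟨fun i => c i.succ, ⟨fun i => hc.1 _, by linarith [hc.1 0]⟩, ?_⟩
  funext l
  refine Fin.cases ?_ (fun i => ?_) l
  · simp only [bary, Fin.cons_zero]; linarith
  · simp [bary]

/-- A box inside the reference simplex. -/
def refBox (m : ℕ) : Set (Fin m → ℝ) := Set.univ.pi fun _ => Set.Ioo (0 : ℝ) (1 / (m + 1))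

theorem isOpen_refBox (m : ℕ) : IsOpen (refBox m) :=
  isOpen_set_pi Set.finite_univ fun _ _ => isOpen_Ioo

theorem refBox_subset (m : ℕ) : refBox m ⊆ refSimplex m := by
  intro x hx
  have hx' : ∀ i, 0 < x i ∧ x i < 1 / (m + 1) := fun i => hx i (Set.mem_univ i)
  refine ⟨fun i => (hx' i).1.le, ?_⟩
  calc ∑ i, x i ≤ ∑ _i : Fin m, (1 / (m + 1) : ℝ) := Finset.sum_le_sum fun i _ => (hx' i).2.le
    _ = m / (m + 1) := by simp [div_eq_mul_inv]
    _ ≤ 1 := by rw [div_le_one (by positivity)]; linarith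

theorem nonempty_refBox (m : ℕ) : (refBox m).Nonempty := by
  rw [refBox, Set.univ_pi_nonempty_iff]
  exact fun _ => Set.nonempty_Ioo.2 (by positivity)

theorem eq_zero_of_refBox {m : ℕ} {p : Poly m} (h : ∀ x ∈ refBox m, eval x p = 0) : p = 0 :=
  funext_set (fun _ => Set.Ioo (0 : ℝ) (1 / (m + 1)))
    (fun _ => Set.Ioo_infinite (by positivity)) fun x hx => by rw [map_zero]; exact h x hx

theorem eq_zero_of_refSimplex {m : ℕ} {p : Poly m} (h : ∀ x ∈ refSimplex m, eval x p = 0) :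
    p = 0 :=
  eq_zero_of_refBox fun x hx => h x (refBox_subset m hx)

theorem integrableOn_eval {m : ℕ} (p : Poly m) :
    IntegrableOn (fun x : Fin m → ℝ => eval x p) (refSimplex m) :=
  (continuous_eval p).continuousOn.integrableOn_compact (isCompact_refSimplex m)

theorem volume_refSimplex_pos (m : ℕ) : 0 < volume (refSimplex m) :=
  lt_of_lt_of_le ((isOpen_refBox m).measure_pos volume (nonempty_refBox m))
    (measure_mono (refBox_subset m))

theorem volume_refSimplex_ne_top (m : ℕ) : volume (refSimplex m) ≠ ⊤ :=
  (isCompact_refSimplex m).measure_lt_top.ne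

/-- Integration over the reference simplex. -/
noncomputable def refInt (m : ℕ) : Poly m →ₗ[ℝ] ℝ where
  toFun p := ∫ x in refSimplex m, eval x p
  map_add' p q := by
    simp only [map_add]
    exact integral_add (integrableOn_eval p) (integrableOn_eval q)
  map_smul' c p := by
    simp only [smul_eval, RingHom.id_apply, smul_eq_mul]
    exact integral_const_mul _ _

theorem refInt_apply {m : ℕ} (p : Poly m) : refInt m p = ∫ x in refSimplex m, eval x p := rfl

theorem refInt_mul_self_nonneg {m : ℕ} (p : Poly m) : 0 ≤ refInt m (p * p) := by
  refine integral_nonneg fun x => ?_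
  simp only [map_mul]
  exact mul_self_nonneg _

theorem eq_zero_of_refInt {m : ℕ} {p : Poly m} (h : refInt m (p * p) = 0) : p = 0 := by
  have h1 := (setIntegral_eq_zero_iff_of_nonneg_ae
    (Eventually.of_forall fun x => by simpa using mul_self_nonneg (eval x p))
    (integrableOn_eval (p * p))).1 h
  have h2 : (fun x : Fin m → ℝ => eval x (p * p)) =ᵐ[volume.restrict (refBox m)] 0 :=
    ae_restrict_of_ae_restrict_of_subset (refBox_subset m) h1
  have h3 := Measure.eqOn_open_of_ae_eq h2 (isOpen_refBox m) (continuous_eval _).continuousOn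
    continuousOn_const
  refine eq_zero_of_refBox fun x hx => ?_
  have := h3 hx
  simpa using this

/-- Cauchy–Schwarz, from the discriminant of the non-negative quadratic t ↦ ∫ (p + t q)². -/
theorem refInt_mul_sq_le {m : ℕ} (p q : Poly m) :
    refInt m (p * q) ^ 2 ≤ refInt m (p * p) * refInt m (q * q) := by
  have h : ∀ t : ℝ, 0 ≤ refInt m (q * q) * (t * t) + 2 * refInt m (p * q) * t
      + refInt m (p * p) := by
    intro t
    have h1 := refInt_mul_self_nonneg (p + t • q)
    have h2 : (p + t • q) * (p + t • q) = (t * t) • (q * q) + (2 * t) • (p * q) + p * p := by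
      simp only [smul_eq_C_mul, map_mul, map_ofNat]; ring
    rw [h2] at h1
    simp only [map_add, map_smul, smul_eq_mul] at h1
    linarith
  have := discrim_le_zero h
  simp only [discrim] at this
  linarith

theorem simplexAverage_eq {F : Type*} [AddCommGroup F] [Module ℝ F] {j : ℕ}
    (w : Fin (j + 1) → F) (f : F → ℝ) :
    simplexAverage w f = (volume.real (refSimplex j))⁻¹ *
      ∫ s in refSimplex j, f (∑ l, bary s l • w l) := by
  rw [simplexAverage, setAverage_eq, smul_eq_mul]

theorem abs_simplexAverage_le {F : Type*} [AddCommGroup F] [Module ℝ F] {j : ℕ}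
    {w : Fin (j + 1) → F} {f : F → ℝ} {M : ℝ}
    (h : ∀ s ∈ refSimplex j, |f (∑ l, bary s l • w l)| ≤ M) : |simplexAverage w f| ≤ M := by
  have hv : 0 < volume.real (refSimplex j) :=
    ENNReal.toReal_pos (volume_refSimplex_pos j).ne' (volume_refSimplex_ne_top j)
  have h' : ∀ s ∈ refSimplex j, ‖f (∑ l, bary s l • w l)‖ ≤ M := h
  have h1 := norm_setIntegral_le_of_norm_le_const (μ := volume)
    (isCompact_refSimplex j).measure_lt_top h'
  rw [simplexAverage_eq, abs_mul, abs_of_pos (inv_pos.2 hv), inv_mul_le_iff₀ hv, mul_comm]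
  exact h1

theorem simplexAverage_congr {F : Type*} [AddCommGroup F] [Module ℝ F] {j : ℕ}
    {w : Fin (j + 1) → F} {F' : Type*} [AddCommGroup F'] [Module ℝ F']
    {w' : Fin (j + 1) → F'} {f : F → ℝ} {g : F' → ℝ}
    (h : ∀ s ∈ refSimplex j, f (∑ l, bary s l • w l) = g (∑ l, bary s l • w' l)) :
    simplexAverage w f = simplexAverage w' g := by
  rw [simplexAverage_eq, simplexAverage_eq]
  congr 1
  exact setIntegral_congr_fun (isCompact_refSimplex j).measurableSet h

theorem simplexAverage_const {F : Type*} [AddCommGroup F] [Module ℝ F] {j : ℕ}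
    (z : F) (f : F → ℝ) : simplexAverage (fun _ : Fin (j + 1) => z) f = f z := by
  have hv : 0 < volume.real (refSimplex j) :=
    ENNReal.toReal_pos (volume_refSimplex_pos j).ne' (volume_refSimplex_ne_top j)
  rw [simplexAverage_eq]
  simp only [← Finset.sum_smul, sum_bary, one_smul, setIntegral_const, smul_eq_mul]
  field_simp

namespace RefDomain

variable {m : ℕ} (D : RefDomain m)

theorem continuous_point (D : RefDomain m) : Continuous fun s : Fin D.dim → ℝ =>
    (∑ l, bary s l • fun i : Fin m => D.pts l i.succ) := by
  refine continuous_finsetSum _ fun l _ => ?_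
  have h : Continuous fun s : Fin D.dim → ℝ => bary s l := by
    refine Fin.cases ?_ (fun i => ?_) l
    · simp only [bary, Fin.cons_zero]; fun_prop
    · simp only [bary, Fin.cons_succ]; fun_prop
  exact h.smul continuous_const

/-- `average` as a linear functional. -/
noncomputable def averageₗ : Poly m →ₗ[ℝ] ℝ where
  toFun p := D.average p
  map_add' p q := by
    simp only [average, simplexAverage_eq, map_add]
    rw [integral_add, mul_add]
    all_goals
      exact ((continuous_eval _).comp D.continuous_point).continuousOn.integrableOn_compact
        (isCompact_refSimplex _)
  map_smul' c p := by
    simp only [average, simplexAverage_eq, smul_eval, RingHom.id_apply, smul_eq_mul]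
    rw [integral_const_mul]
    ring

theorem averageₗ_apply (p : Poly m) : D.averageₗ p = D.average p := rfl

/-- The barycentric coordinates of each vertex of `D` sum to one, so the coordinate of index 0,
dropped when passing to `Fin m → ℝ`, can be recovered. -/
theorem bary_point (s : Fin D.dim → ℝ) :
    bary (∑ l, bary s l • fun i : Fin m => D.pts l i.succ) = ∑ l, bary s l • D.pts l := by
  have h1 : ∑ i, (∑ l, bary s l • D.pts l) i = 1 := by
    simp only [Finset.sum_apply, Pi.smul_apply, smul_eq_mul]
    rw [Finset.sum_comm]
    simp only [← Finset.mul_sum, (D.mem _).2, mul_one, sum_bary]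
  funext l
  refine Fin.cases ?_ (fun i => ?_) l
  · rw [Fin.sum_univ_succ] at h1
    simp only [bary, Fin.cons_zero, Finset.sum_apply, Pi.smul_apply, smul_eq_mul] at h1 ⊢
    linarith
  · simp [bary]

theorem point_mem {s : Fin D.dim → ℝ} (hs : s ∈ refSimplex D.dim) :
    (∑ l, bary s l • fun i : Fin m => D.pts l i.succ) ∈ refSimplex m := by
  have h : ∀ l, 0 ≤ bary (∑ l, bary s l • fun i : Fin m => D.pts l i.succ) l := by
    intro l
    rw [bary_point, Finset.sum_apply]
    exact Finset.sum_nonneg fun j _ => mul_nonneg (bary_nonneg hs j) ((D.mem j).1 l)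
  refine ⟨fun i => by simpa [bary] using h i.succ, ?_⟩
  have := h 0
  simp only [bary, Fin.cons_zero] at this
  simp only [bary]
  linarith

theorem abs_average_le {p : Poly m} {M : ℝ} (h : ∀ x ∈ refSimplex m, |eval x p| ≤ M) :
    |D.average p| ≤ M :=
  abs_simplexAverage_le fun _ hs => h _ (D.point_mem hs)

end RefDomain

/-! ### Bounds on spaces of polynomials -/

/-- On a finite-dimensional space of polynomials, bounds for a separating family of linear
functionals give bounds for any linear map. -/
theorem exists_bound_of_separating {m m' k : ℕ} {ι : Type*} (ℓ : ι → Poly m →ₗ[ℝ] ℝ)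
    (hℓ : ∀ p : Poly m, p.totalDegree ≤ k → (∀ i, ℓ i p = 0) → p = 0)
    (L : Poly m →ₗ[ℝ] Poly m') :
    ∃ C : ℝ, 0 ≤ C ∧ ∀ p : Poly m, p.totalDegree ≤ k → ∀ M : ℝ, 0 ≤ M → (∀ i, |ℓ i p| ≤ M) →
      ∀ x ∈ refSimplex m', |eval x (L p)| ≤ C * M := by
  set V := restrictTotalDegree (Fin m) ℝ k with hV
  set ℓ' : ι → Module.Dual ℝ V := fun i => (ℓ i).comp V.subtype with hℓ'
  -- In finite dimension, functionals with trivial common kernel span the dual space.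
  have hspan : Submodule.span ℝ (Set.range ℓ') = ⊤ := by
    have h1 : (Submodule.span ℝ (Set.range ℓ')).dualCoannihilator = ⊥ := by
      rw [eq_bot_iff]
      intro p hp
      have hp' : p ∈ ((Submodule.span ℝ (Set.range ℓ')).dualCoannihilator : Set V) := hp
      rw [Submodule.coe_dualCoannihilator_span] at hp'
      have := hℓ p ((mem_restrictTotalDegree _ _ _).1 p.2) fun i => hp' _ ⟨i, rfl⟩
      exact (Submodule.mem_bot ℝ).2 (Subtype.ext this)
    rw [← Subspace.dualCoannihilator_dualAnnihilator_eq (W := Submodule.span ℝ (Set.range ℓ')),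
      h1, Submodule.dualAnnihilator_bot]
  -- Each functional is a finite combination of members of the family, and the sum of the absolute
  -- coefficients is the constant. The family itself may be infinite.
  have step1 : ∀ f : Module.Dual ℝ V, ∃ C : ℝ, 0 ≤ C ∧ ∀ p : V, ∀ M : ℝ, 0 ≤ M →
      (∀ i, |ℓ i p| ≤ M) → |f p| ≤ C * M := by
    intro f
    have hf : f ∈ Submodule.span ℝ (Set.range ℓ') := by rw [hspan]; trivial
    obtain ⟨c, rfl⟩ := Finsupp.mem_span_range_iff_exists_finsupp.1 hf
    refine ⟨∑ i ∈ c.support, |c i|, Finset.sum_nonneg fun _ _ => abs_nonneg _, ?_⟩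
    intro p M _ hpM
    rw [Finsupp.sum, LinearMap.sum_apply, Finset.sum_mul]
    refine (Finset.abs_sum_le_sum_abs _ _).trans (Finset.sum_le_sum fun i _ => ?_)
    rw [LinearMap.smul_apply, smul_eq_mul, abs_mul]
    exact mul_le_mul_of_nonneg_left (hpM i) (abs_nonneg _)
  let b := Module.finBasis ℝ V
  choose C hC0 hC using fun j => step1 (b.coord j)
  have hS : ∀ j, ∃ S : ℝ, ∀ x ∈ refSimplex m', ‖eval x (L (b j))‖ ≤ S := fun j =>
    (isCompact_refSimplex m').exists_bound_of_continuousOn (continuous_eval _).continuousOn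
  choose S hS using hS
  refine ⟨∑ j, C j * |S j|, Finset.sum_nonneg fun j _ => mul_nonneg (hC0 j) (abs_nonneg _), ?_⟩
  intro p hp M hM hpM x hx
  set p' : V := ⟨p, (mem_restrictTotalDegree _ _ _).2 hp⟩ with hp'
  have h1 : p = ∑ j, b.coord j p' • (b j : Poly m) := by
    have := congrArg (Submodule.subtype V) (b.sum_repr p')
    rw [map_sum] at this
    simpa using this.symm
  conv_lhs => rw [h1, map_sum, map_sum]
  rw [Finset.sum_mul]
  refine (Finset.abs_sum_le_sum_abs _ _).trans (Finset.sum_le_sum fun j _ => ?_)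
  rw [map_smul, smul_eval, abs_mul]
  calc |b.coord j p'| * |eval x (L (b j))| ≤ (C j * M) * |S j| :=
        mul_le_mul (hC j p' M hM hpM) ((hS j x hx).trans (le_abs_self _)) (abs_nonneg _)
          (mul_nonneg (hC0 j) hM)
    _ = C j * |S j| * M := by ring

/-- Point evaluation. -/
noncomputable def evalₗ {m : ℕ} (x : Fin m → ℝ) : Poly m →ₗ[ℝ] ℝ := (aeval x).toLinearMap

theorem evalₗ_apply {m : ℕ} (x : Fin m → ℝ) (p : Poly m) : evalₗ x p = eval x p := by
  rw [evalₗ, AlgHom.toLinearMap_apply]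
  exact RingHom.congr_fun (coe_aeval_eq_eval x) p

/-- Markov's inequality on the reference simplex: point evaluations form a separating family. -/
theorem exists_pderiv_bound (m k : ℕ) : ∃ C : ℝ, 0 ≤ C ∧ ∀ (i : Fin m) (p : Poly m),
    p.totalDegree ≤ k → ∀ M : ℝ, 0 ≤ M → (∀ x ∈ refSimplex m, |eval x p| ≤ M) →
      ∀ x ∈ refSimplex m, |eval x (pderiv i p)| ≤ C * M := by
  have h := fun i : Fin m => exists_bound_of_separating (k := k)
    (fun x : refSimplex m => evalₗ (x : Fin m → ℝ))
    (fun p _ hp => eq_zero_of_refSimplex fun x hx => by simpa [evalₗ_apply] using hp ⟨x, hx⟩)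
    (pderiv i).toLinearMap
  choose C hC0 hC using h
  refine ⟨∑ i, C i, Finset.sum_nonneg fun i _ => hC0 i, fun i p hp M hM h x hx => ?_⟩
  refine (hC i p hp M hM (fun x => by simpa [evalₗ_apply] using h x x.2) x hx).trans ?_
  exact mul_le_mul_of_nonneg_right
    (Finset.single_le_sum (f := C) (fun i _ => hC0 i) (Finset.mem_univ i)) hM

/-- The functionals p ↦ ∫ p r, with r in the unit ball of L², are separating, and by Cauchy–Schwarz
each is at most the L² norm of p. -/
theorem exists_refInt_bound (m k : ℕ) : ∃ C : ℝ, 0 ≤ C ∧ ∀ p : Poly m, p.totalDegree ≤ k →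
    ∀ x ∈ refSimplex m, eval x p ^ 2 ≤ C * refInt m (p * p) := by
  obtain ⟨C, hC0, hC⟩ := exists_bound_of_separating (k := k)
    (fun r : {r : Poly m // refInt m (r * r) ≤ 1} =>
      (refInt m).comp (LinearMap.mulRight ℝ (r : Poly m)))
    (fun p _ hp => by
      refine eq_zero_of_refInt ?_
      by_contra h
      have h0 : 0 < refInt m (p * p) := lt_of_le_of_ne (refInt_mul_self_nonneg p) (Ne.symm h)
      -- With this factor, c ≤ 1 and c ∫ p² ≤ 1, so `c • p` lies in the unit ball; no square root is
      -- needed.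
      set c := (1 + refInt m (p * p))⁻¹ with hc
      have hc0 : 0 < c := by positivity
      have h1 : refInt m ((c • p) * (c • p)) ≤ 1 := by
        rw [smul_mul_smul_comm, map_smul, smul_eq_mul]
        have h2 : c * refInt m (p * p) ≤ 1 := by
          rw [hc, inv_mul_le_iff₀ (by positivity)]; linarith
        have h3 : c ≤ 1 := by rw [hc]; exact inv_le_one_of_one_le₀ (by linarith)
        nlinarith
      have h2 := hp ⟨c • p, h1⟩
      simp only [LinearMap.comp_apply, LinearMap.mulRight_apply, mul_smul_comm, map_smul,
        smul_eq_mul, mul_eq_zero] at h2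
      rcases h2 with h2 | h2
      · exact hc0.ne' h2
      · exact h h2)
    LinearMap.id
  refine ⟨C ^ 2, by positivity, fun p hp x hx => ?_⟩
  have h1 := hC p hp (√(refInt m (p * p))) (Real.sqrt_nonneg _) (fun r => by
    refine Real.abs_le_sqrt ?_
    simp only [LinearMap.comp_apply, LinearMap.mulRight_apply]
    refine (refInt_mul_sq_le p r).trans ?_
    exact mul_le_of_le_one_right (refInt_mul_self_nonneg p) r.2) x hx
  rw [LinearMap.id_apply] at h1
  calc eval x p ^ 2 = |eval x p| ^ 2 := (sq_abs _).symm
    _ ≤ (C * √(refInt m (p * p))) ^ 2 := pow_le_pow_left₀ (abs_nonneg _) h1 2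
    _ = C ^ 2 * refInt m (p * p) := by rw [mul_pow, Real.sq_sqrt (refInt_mul_self_nonneg p)]

/-- The exponents that occur are d + 1 - m for values and 2 for normal derivatives; the largest is
3, on the edges of a tetrahedron. -/
theorem baryPoly_pow_dvd {m r : ℕ} (hr : r ≤ 3) {q : Poly (m + 1)} (j : Fin (m + 2))
    (h : ∀ x ∈ refSimplex (m + 1), bary x j = 0 → ∀ l < r,
      eval x ((pderiv (baryVar j))^[l] q) = 0) : baryPoly j ^ r ∣ q := by
  interval_cases r
  · simp
  · rw [pow_one]
    exact baryPoly_dvd j fun x hx hj => h x hx hj 0 (by norm_num)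
  · exact baryPoly_sq_dvd j (fun x hx hj => h x hx hj 0 (by norm_num))
      fun x hx hj => h x hx hj 1 (by norm_num)
  · exact baryPoly_cube_dvd j (fun x hx hj => h x hx hj 0 (by norm_num))
      (fun x hx hj => h x hx hj 1 (by norm_num)) fun x hx hj => h x hx hj 2 (by norm_num)

/-- A polynomial is controlled by its derivatives transversal to the faces of the reference simplex
and a unisolvent family of averages. -/
theorem Unisolvent.exists_bound {m r n I : ℕ} {D : Fin I → RefDomain (m + 1)}
    (hD : Unisolvent (m + 1) r n D) (hr : r ≤ 3) :
    ∃ C : ℝ, 0 ≤ C ∧ ∀ q : Poly (m + 1), q.totalDegree ≤ n → ∀ M : ℝ, 0 ≤ M →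
      (∀ x ∈ refSimplex (m + 1), ∀ j, bary x j = 0 → ∀ l < r,
        |eval x ((pderiv (baryVar j))^[l] q)| ≤ M) →
      (∀ i, |(D i).average q| ≤ M) → ∀ x ∈ refSimplex (m + 1), |eval x q| ≤ C * M := by
  -- The indices of the boundary data: a point of a facet, the facet, and an order of
  -- differentiation below `r`.
  let X := {y : (Fin (m + 1) → ℝ) × Fin (m + 2) × ℕ //
    y.1 ∈ refSimplex (m + 1) ∧ bary y.1 y.2.1 = 0 ∧ y.2.2 < r}
  let ℓ : X ⊕ Fin I → Poly (m + 1) →ₗ[ℝ] ℝ :=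
    Sum.elim (fun y => (evalₗ y.1.1).comp ((pderiv (baryVar y.1.2.1)).toLinearMap ^ y.1.2.2))
      fun i => (D i).averageₗ
  have hℓ : ∀ (y : X) (q : Poly (m + 1)),
      ℓ (Sum.inl y) q = eval y.1.1 ((pderiv (baryVar y.1.2.1))^[y.1.2.2] q) := by
    intro y q
    simp only [ℓ, Sum.elim_inl, LinearMap.comp_apply, evalₗ_apply, Module.End.pow_apply]
    rfl
  -- If all boundary data vanish, each facet coordinate divides q to the order r. These coordinates
  -- are relatively prime, so the power of the bubble divides q, and unisolvence applies.
  obtain ⟨C, hC0, hC⟩ := exists_bound_of_separating (k := n) ℓ (fun q hq h => by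
    have h1 : ∀ x ∈ refSimplex (m + 1), ∀ j, bary x j = 0 → ∀ l < r,
        eval x ((pderiv (baryVar j))^[l] q) = 0 := fun x hx j hj l hl => by
      rw [← hℓ ⟨(x, j, l), hx, hj, hl⟩]; exact h _
    refine hD.eq_zero hq (bubble_pow_dvd fun j => ?_) fun i => h (Sum.inr i)
    exact baryPoly_pow_dvd hr j fun x hx hj l hl => h1 x hx j hj l hl) LinearMap.id
  refine ⟨C, hC0, fun q hq M hM h1 h2 => hC q hq M hM ?_⟩
  rintro (y | i)
  · rw [hℓ]; exact h1 _ y.2.1 _ y.2.2.1 _ y.2.2.2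
  · exact h2 i

/-- A polynomial with a first-order zero at a vertex is controlled by its second derivatives. -/
theorem exists_bound_second_deriv (m k : ℕ) : ∃ C : ℝ, 0 ≤ C ∧ ∀ p : Poly m,
    p.totalDegree ≤ k → eval 0 p = 0 → (∀ i, eval 0 (pderiv i p) = 0) → ∀ M : ℝ, 0 ≤ M →
      (∀ i j, ∀ x ∈ refSimplex m, |eval x (pderiv i (pderiv j p))| ≤ M) →
      ∀ x ∈ refSimplex m, |eval x p| ≤ C * M := by
  -- In characteristic zero, every non-constant coefficient can be read off from a partial
  -- derivative.
  have hp0 : ∀ p : Poly m, eval 0 p = 0 → (∀ i, pderiv i p = 0) → p = 0 := by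
    intro p h0 h1
    have h2 : p = C (coeff 0 p) := by
      ext s
      rw [coeff_C]
      split_ifs with hs
      · rw [hs]
      · obtain ⟨i, hi⟩ : ∃ i, s i ≠ 0 := by
          by_contra! h
          exact hs (Finsupp.ext fun i => by simp [h i])
        have h3 := coeff_pderiv p (s - Finsupp.single i 1) (i := i)
        have h4 : s - Finsupp.single i 1 + Finsupp.single i 1 = s :=
          tsub_add_cancel_of_le (by rw [Finsupp.single_le_iff]; omega)
        rw [h1 i, coeff_zero, h4] at h3
        have h5 : (((s - Finsupp.single i 1 : Fin m →₀ ℕ) i : ℕ) : ℝ) + 1 ≠ 0 := by positivity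
        exact (mul_eq_zero.1 h3.symm).resolve_right h5
    rw [h2, eval_C] at h0
    rw [h2, h0, map_zero]
  -- The family consists of the value and the gradient at 0 and of all second derivatives. It
  -- separates by two applications of `hp0`; for the polynomials in question only the second
  -- derivatives contribute.
  obtain ⟨K, hK0, hK⟩ := exists_bound_of_separating (k := k)
    (fun y : Unit ⊕ Fin m ⊕ (Fin m × Fin m × refSimplex m) => match y with
      | Sum.inl _ => evalₗ (0 : Fin m → ℝ)
      | Sum.inr (Sum.inl i) => (evalₗ (0 : Fin m → ℝ)).comp (pderiv i).toLinearMap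
      | Sum.inr (Sum.inr (i, j, x)) =>
        (evalₗ (x : Fin m → ℝ)).comp ((pderiv i).toLinearMap.comp (pderiv j).toLinearMap))
    (fun p _ h => by
      refine hp0 p (by simpa only [evalₗ_apply] using h (Sum.inl ())) fun j => ?_
      refine hp0 _ ?_ fun i => ?_
      · have := h (Sum.inr (Sum.inl j))
        simp only [LinearMap.comp_apply, evalₗ_apply] at this
        exact this
      · refine eq_zero_of_refSimplex fun x hx => ?_
        have := h (Sum.inr (Sum.inr (i, j, ⟨x, hx⟩)))
        simp only [LinearMap.comp_apply, evalₗ_apply] at this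
        exact this)
    LinearMap.id
  refine ⟨K, hK0, fun p hp h0 h1 M hM h2 => hK p hp M hM ?_⟩
  rintro (_ | i | ⟨i, j, x⟩)
  · simpa only [evalₗ_apply, h0, abs_zero] using hM
  · simp only [LinearMap.comp_apply, evalₗ_apply]
    change |eval 0 (pderiv i p)| ≤ M
    rw [h1, abs_zero]; exact hM
  · simp only [LinearMap.comp_apply, evalₗ_apply]
    exact h2 i j x x.2

/-! ### The symmetric Gauss–Seidel smoother of a positive definite matrix -/

section matrix

variable {n : ℕ} {A : Matrix (Fin n) (Fin n) ℝ}

theorem isUnit_lowerPart (hA : A.PosDef) : IsUnit (lowerPart A) := by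
  rw [Matrix.isUnit_iff_isUnit_det, Matrix.det_of_isLowerTriangular, isUnit_iff_ne_zero,
    Finset.prod_ne_zero_iff]
  · intro i _
    simpa [lowerPart] using (hA.diag_pos (i := i)).ne'
  · intro i j hij
    have : ¬ j ≤ i := not_le.2 hij
    simp [lowerPart, this]

theorem lowerPart_add_transpose (hA : A.PosDef) :
    lowerPart A + (lowerPart A)ᵀ = A + diagonalPart A := by
  have hs : ∀ i j, A j i = A i j := fun i j => by
    have := congrFun (congrFun hA.isHermitian i) j
    simpa using this
  ext i j
  simp only [lowerPart, diagonalPart, Matrix.add_apply, Matrix.transpose_apply, Matrix.of_apply]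
  rcases lt_trichotomy i j with h | h | h
  · simp [not_le.2 h, h.le, h.ne, hs]
  · subst h; simp
  · simp [not_le.2 h, h.le, h.ne']

/-- With R = L⁻¹, the product expands to R + Rᵀ - Rᵀ A R = L⁻ᵀ (L + Lᵀ - A) L⁻¹, and the middle
factor is the diagonal. -/
theorem symGaussSeidel_eq (hA : A.PosDef) :
    symGaussSeidel A = ((lowerPart A)⁻¹)ᵀ * diagonalPart A * (lowerPart A)⁻¹ := by
  have hL := (Matrix.isUnit_iff_isUnit_det _).1 (isUnit_lowerPart hA)
  have hAu := (Matrix.isUnit_iff_isUnit_det _).1 hA.isUnit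
  have hLt : IsUnit ((lowerPart A)ᵀ).det := by rwa [Matrix.det_transpose]
  have h : diagonalPart A = lowerPart A + (lowerPart A)ᵀ - A := by
    rw [lowerPart_add_transpose hA]; abel
  rw [symGaussSeidel, gaussSeidel, h, Matrix.transpose_nonsing_inv]
  set L := lowerPart A
  have e1 : (1 - (1 - Lᵀ⁻¹ * A) * (1 - L⁻¹ * A)) * A⁻¹
      = Lᵀ⁻¹ * (A * A⁻¹) + L⁻¹ * (A * A⁻¹) - Lᵀ⁻¹ * A * L⁻¹ * (A * A⁻¹) := by noncomm_ring
  have e2 : Lᵀ⁻¹ * (L + Lᵀ - A) * L⁻¹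
      = Lᵀ⁻¹ * (L * L⁻¹) + (Lᵀ⁻¹ * Lᵀ) * L⁻¹ - Lᵀ⁻¹ * A * L⁻¹ := by noncomm_ring
  rw [e1, e2, Matrix.mul_nonsing_inv _ hAu, Matrix.mul_nonsing_inv _ hL,
    Matrix.nonsing_inv_mul _ hLt]
  simp

theorem posDef_diagonalPart (hA : A.PosDef) : (diagonalPart A).PosDef :=
  Matrix.PosDef.diagonal fun i => hA.diag_pos (i := i)

theorem posDef_symGaussSeidel (hA : A.PosDef) : (symGaussSeidel A).PosDef := by
  rw [symGaussSeidel_eq hA]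
  have hL := isUnit_lowerPart hA
  have h := (posDef_diagonalPart hA).conjTranspose_mul_mul_same (B := (lowerPart A)⁻¹)
    (Matrix.mulVec_injective_iff_isUnit.2 ((Matrix.isUnit_nonsing_inv_iff).2 hL))
  simpa [Matrix.conjTranspose_eq_transpose_of_trivial] using h

theorem symGaussSeidel_inv (hA : A.PosDef) :
    (symGaussSeidel A)⁻¹ = lowerPart A * (diagonalPart A)⁻¹ * (lowerPart A)ᵀ := by
  rw [symGaussSeidel_eq hA, Matrix.mul_inv_rev, Matrix.mul_inv_rev, Matrix.transpose_nonsing_inv,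
    Matrix.nonsing_inv_nonsing_inv _ ((Matrix.isUnit_iff_isUnit_det _).1 (isUnit_lowerPart hA)),
    Matrix.nonsing_inv_nonsing_inv, Matrix.mul_assoc]
  rw [Matrix.det_transpose]
  exact (Matrix.isUnit_iff_isUnit_det _).1 (isUnit_lowerPart hA)

theorem diagonalPart_form (x : Fin n → ℝ) :
    x ⬝ᵥ (diagonalPart A *ᵥ x) = ∑ i, A i i * x i ^ 2 := by
  simp only [diagonalPart, dotProduct, Matrix.mulVec_diagonal]
  exact Finset.sum_congr rfl fun i _ => by ring

theorem symGaussSeidel_inv_form (hA : A.PosDef) (x : Fin n → ℝ) :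
    x ⬝ᵥ ((symGaussSeidel A)⁻¹ *ᵥ x) = ∑ i, ((lowerPart A)ᵀ *ᵥ x) i ^ 2 / A i i := by
  have hD : (diagonalPart A)⁻¹ = Matrix.diagonal fun i => (A i i)⁻¹ := by
    refine Matrix.inv_eq_right_inv ?_
    rw [diagonalPart, Matrix.diagonal_mul_diagonal, ← Matrix.diagonal_one]
    congr 1
    funext i
    exact mul_inv_cancel₀ (hA.diag_pos (i := i)).ne'
  rw [symGaussSeidel_inv hA, hD, ← Matrix.mulVec_mulVec, ← Matrix.mulVec_mulVec,
    Matrix.dotProduct_mulVec, ← Matrix.mulVec_transpose]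
  simp only [dotProduct, Matrix.mulVec_diagonal]
  exact Finset.sum_congr rfl fun i _ => by rw [div_eq_mul_inv]; ring

/-- With y = Lᵀx, positivity of A in L + Lᵀ = A + D gives xᵀDx ≤ 2 xᵀy. Young's inequality xᵢyᵢ ≤
Aᵢᵢxᵢ²/4 + yᵢ²/Aᵢᵢ lets half of the left side be absorbed, which produces the factor 4. -/
theorem diagonalPart_form_le (hA : A.PosDef) (x : Fin n → ℝ) :
    x ⬝ᵥ (diagonalPart A *ᵥ x) ≤ 4 * (x ⬝ᵥ ((symGaussSeidel A)⁻¹ *ᵥ x)) := by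
  have h1 : x ⬝ᵥ ((lowerPart A)ᵀ *ᵥ x) = x ⬝ᵥ (lowerPart A *ᵥ x) := by
    rw [Matrix.mulVec_transpose, dotProduct_comm, ← Matrix.dotProduct_mulVec]
  have h2 : x ⬝ᵥ (diagonalPart A *ᵥ x) ≤ 2 * (x ⬝ᵥ ((lowerPart A)ᵀ *ᵥ x)) := by
    have h3 := hA.posSemidef.dotProduct_mulVec_nonneg x
    have h4 := congrArg (fun B => x ⬝ᵥ (B *ᵥ x)) (lowerPart_add_transpose hA)
    simp only [Matrix.add_mulVec, dotProduct_add] at h4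
    simp only [star_trivial] at h3
    linarith
  rw [diagonalPart_form] at h2 ⊢
  rw [symGaussSeidel_inv_form hA]
  set y := (lowerPart A)ᵀ *ᵥ x
  have h5 : x ⬝ᵥ y ≤ ∑ i, (A i i * x i ^ 2 / 4 + y i ^ 2 / A i i) := by
    refine Finset.sum_le_sum fun i _ => ?_
    have hi := hA.diag_pos (i := i)
    have : A i i * x i ^ 2 / 4 + y i ^ 2 / A i i - x i * y i
        = (A i i * x i - 2 * y i) ^ 2 / (4 * A i i) := by field_simp; ring
    have h6 : 0 ≤ (A i i * x i - 2 * y i) ^ 2 / (4 * A i i) := by positivity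
    linarith
  rw [Finset.sum_add_distrib, ← Finset.sum_div] at h5
  linarith

/-- If `A` is assembled from element matrices, each of which acts on at most `K` degrees of freedom,
then the symmetric Gauss–Seidel smoother is bounded by the Jacobi smoother. -/
theorem symGaussSeidel_inv_form_le (hA : A.PosDef) {ι : Type*} (s : Finset ι)
    (G : ι → Matrix (Fin n) (Fin n) ℝ) (hsum : ∀ i j, A i j = ∑ T ∈ s, G T i j)
    (hG0 : ∀ T i, 0 ≤ G T i i) (hG : ∀ T i j, G T i j ^ 2 ≤ G T i i * G T j j)
    (loc : ι → Finset (Fin n)) {K : ℝ} (hK : ∀ T ∈ s, ((loc T).card : ℝ) ≤ K)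
    (hloc : ∀ T ∈ s, ∀ i j, i ∉ loc T ∨ j ∉ loc T → G T i j = 0) (x : Fin n → ℝ) :
    x ⬝ᵥ ((symGaussSeidel A)⁻¹ *ᵥ x) ≤ K ^ 2 * (x ⬝ᵥ (diagonalPart A *ᵥ x)) := by
  classical
  rw [symGaussSeidel_inv_form hA, diagonalPart_form]
  have hs : ∀ i j, A j i = A i j := fun i j => by
    have := congrFun (congrFun hA.isHermitian i) j
    simpa using this
  have hGs : ∀ T i j, |G T i j| ≤ √(G T i i) * √(G T j j) := fun T i j => by
    rw [← Real.sqrt_mul (hG0 T i)]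
    exact Real.abs_le_sqrt (hG T i j)
  set Y : ι → ℝ := fun T => ∑ j ∈ loc T, √(G T j j) * |x j| with hY
  have hY0 : ∀ T, 0 ≤ Y T := fun T => Finset.sum_nonneg fun j _ => by positivity
  set Z : ι → ℝ := fun T => ∑ j ∈ loc T, G T j j * x j ^ 2 with hZ
  have hZ0 : ∀ T, 0 ≤ Z T := fun T =>
    Finset.sum_nonneg fun j _ => mul_nonneg (hG0 T j) (sq_nonneg _)
  have hYZ : ∀ T ∈ s, Y T ^ 2 ≤ K * Z T := by
    intro T hT
    have h1 : Y T ^ 2 ≤ (loc T).card * ∑ j ∈ loc T, (√(G T j j) * |x j|) ^ 2 :=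
      sq_sum_le_card_mul_sum_sq
    have h2 : ∑ j ∈ loc T, (√(G T j j) * |x j|) ^ 2 = Z T :=
      Finset.sum_congr rfl fun j _ => by rw [mul_pow, Real.sq_sqrt (hG0 T j), sq_abs]
    rw [h2] at h1
    exact h1.trans (mul_le_mul_of_nonneg_right (hK T hT) (hZ0 T))
  -- Passing to absolute values discards the triangular structure. Cauchy–Schwarz over the elements
  -- produces the factor ∑ G_T,ii = Aᵢᵢ, which cancels the division.
  have row : ∀ i, ((lowerPart A)ᵀ *ᵥ x) i ^ 2 / A i i
      ≤ ∑ T ∈ s, if i ∈ loc T then K * Z T else 0 := by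
    intro i
    have hi := hA.diag_pos (i := i)
    have h1 : |((lowerPart A)ᵀ *ᵥ x) i|
        ≤ ∑ T ∈ s, √(G T i i) * (if i ∈ loc T then Y T else 0) := by
      calc |((lowerPart A)ᵀ *ᵥ x) i| ≤ ∑ j, |A i j| * |x j| := by
            have h0 : ((lowerPart A)ᵀ *ᵥ x) i = ∑ j, (lowerPart A)ᵀ i j * x j := rfl
            rw [h0]
            refine (Finset.abs_sum_le_sum_abs _ _).trans (Finset.sum_le_sum fun j _ => ?_)
            rw [abs_mul]
            refine mul_le_mul_of_nonneg_right ?_ (abs_nonneg _)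
            simp only [Matrix.transpose_apply, lowerPart, Matrix.of_apply]
            split_ifs
            · rw [hs]
            · simp
        _ ≤ ∑ j, ∑ T ∈ s, |G T i j| * |x j| := by
            refine Finset.sum_le_sum fun j _ => ?_
            rw [hsum, ← Finset.sum_mul]
            exact mul_le_mul_of_nonneg_right (Finset.abs_sum_le_sum_abs _ _) (abs_nonneg _)
        _ = ∑ T ∈ s, ∑ j, |G T i j| * |x j| := Finset.sum_comm
        _ ≤ ∑ T ∈ s, √(G T i i) * (if i ∈ loc T then Y T else 0) := by
            refine Finset.sum_le_sum fun T hT => ?_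
            by_cases hiT : i ∈ loc T
            · rw [if_pos hiT, hY, Finset.mul_sum]
              rw [← Finset.sum_subset (Finset.subset_univ (loc T)) fun j _ hj => by
                rw [hloc T hT i j (Or.inr hj), abs_zero, zero_mul]]
              refine Finset.sum_le_sum fun j _ => ?_
              rw [← mul_assoc]
              exact mul_le_mul_of_nonneg_right (hGs T i j) (abs_nonneg _)
            · rw [if_neg hiT, mul_zero]
              refine (Finset.sum_eq_zero fun j _ => ?_).le
              rw [hloc T hT i j (Or.inl hiT), abs_zero, zero_mul]
    have h2 := pow_le_pow_left₀ (abs_nonneg _) h1 2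
    rw [sq_abs] at h2
    have h3 := h2.trans (Finset.sum_mul_sq_le_sq_mul_sq s _ _)
    have h4 : ∑ T ∈ s, √(G T i i) ^ 2 = A i i := by
      rw [hsum]
      exact Finset.sum_congr rfl fun T _ => Real.sq_sqrt (hG0 T i)
    rw [h4] at h3
    rw [div_le_iff₀ hi, mul_comm]
    refine h3.trans (mul_le_mul_of_nonneg_left (Finset.sum_le_sum fun T hT => ?_) hi.le)
    split_ifs
    · exact hYZ T hT
    · simp
  calc ∑ i, ((lowerPart A)ᵀ *ᵥ x) i ^ 2 / A i i
      ≤ ∑ i, ∑ T ∈ s, (if i ∈ loc T then K * Z T else 0) := Finset.sum_le_sum fun i _ => row i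
    -- The quantity of an element is counted once for each of its local indices, which gives the
    -- second factor K.
    _ = ∑ T ∈ s, ((loc T).card : ℝ) * (K * Z T) := by
        rw [Finset.sum_comm]
        refine Finset.sum_congr rfl fun T _ => ?_
        rw [Finset.sum_ite_mem, Finset.univ_inter, Finset.sum_const, nsmul_eq_mul]
    _ ≤ ∑ T ∈ s, K ^ 2 * Z T := by
        refine Finset.sum_le_sum fun T hT => ?_
        have hK0 : 0 ≤ K := (Nat.cast_nonneg _).trans (hK T hT)
        rw [sq, mul_assoc]
        exact mul_le_mul_of_nonneg_right (hK T hT) (mul_nonneg hK0 (hZ0 T))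
    _ ≤ ∑ T ∈ s, K ^ 2 * ∑ j, G T j j * x j ^ 2 := by
        refine Finset.sum_le_sum fun T _ => mul_le_mul_of_nonneg_left ?_ (sq_nonneg K)
        exact Finset.sum_le_sum_of_subset_of_nonneg (Finset.subset_univ _)
          fun j _ _ => mul_nonneg (hG0 T j) (sq_nonneg _)
    _ = K ^ 2 * ∑ i, A i i * x i ^ 2 := by
        rw [← Finset.mul_sum, Finset.sum_comm]
        congr 1
        refine Finset.sum_congr rfl fun j _ => ?_
        rw [hsum, Finset.sum_mul]

end matrix

/-! ### Polynomials as smooth functions -/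

theorem contDiff_pev {d : ℕ} (p : Poly d) {n : WithTop ℕ∞} : ContDiff ℝ n (pev p) := by
  unfold pev
  simp only [MvPolynomial.eval_eq]
  refine ContDiff.sum fun s _ => contDiff_const.mul (contDiff_prod fun i _ => ?_)
  exact ContDiff.pow ((EuclideanSpace.proj (𝕜 := ℝ) i).contDiff) _

theorem continuous_pev {d : ℕ} (p : Poly d) : Continuous (pev p) :=
  (contDiff_pev p (n := 0)).continuous

/-- The differential of a polynomial. -/
noncomputable def polyDiff {d : ℕ} (p : Poly d) (x : Space d) : Space d →L[ℝ] ℝ :=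
  LinearMap.toContinuousLinearMap ((evalₗ fun i => x i).comp (dirDerivₗ p))

theorem polyDiff_apply {d : ℕ} (p : Poly d) (x t : Space d) :
    polyDiff p x t = pev (dirDeriv t p) x := by
  simp [polyDiff, evalₗ_apply, dirDerivₗ_apply]

theorem hasFDerivAt_pev {d : ℕ} (p : Poly d) (x : Space d) :
    HasFDerivAt (pev p) (polyDiff p x) x := by
  induction p using MvPolynomial.induction_on with
  | C a =>
    have h1 : polyDiff (C a : Poly d) x = 0 := by
      ext t
      rw [polyDiff_apply, ← algebraMap_eq, Derivation.map_algebraMap]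
      simp [pev]
    have h2 : pev (C a : Poly d) = fun _ => a := by
      funext y; simp [pev]
    rw [h1, h2]
    exact hasFDerivAt_const a x
  | add p q hp hq =>
    have h1 : polyDiff (p + q) x = polyDiff p x + polyDiff q x := by
      ext t
      simp [polyDiff_apply, pev]
    have h2 : pev (p + q) = fun y => pev p y + pev q y := by
      funext y; simp [pev]
    rw [h1, h2]
    exact hp.add hq
  | mul_X p i hp =>
    have h1 : polyDiff (p * X i) x
        = pev p x • (EuclideanSpace.proj (𝕜 := ℝ) i : Space d →L[ℝ] ℝ) + x i • polyDiff p x := by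
      ext t
      simp [polyDiff_apply, pev, dirDeriv_X, Derivation.leibniz]
    have h2 : pev (p * X i) = fun y =>
        pev p y * (EuclideanSpace.proj (𝕜 := ℝ) i : Space d →L[ℝ] ℝ) y := by
      funext y; simp [pev]
    rw [h1, h2]
    exact hp.mul (EuclideanSpace.proj (𝕜 := ℝ) i : Space d →L[ℝ] ℝ).hasFDerivAt

theorem fderiv_pev {d : ℕ} (p : Poly d) (x t : Space d) :
    fderiv ℝ (pev p) x t = pev (dirDeriv t p) x := by
  rw [(hasFDerivAt_pev p x).fderiv, polyDiff_apply]

theorem fderiv_fderiv_pev {d : ℕ} (p : Poly d) (x a b : Space d) :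
    fderiv ℝ (fderiv ℝ (pev p)) x a b = pev (dirDeriv a (dirDeriv b p)) x := by
  have h1 : DifferentiableAt ℝ (fderiv ℝ (pev p)) x :=
    ((contDiff_pev p (n := 2)).fderiv_right (m := 1) (by norm_num)).differentiable (by simp) x
  have h2 : fderiv ℝ (fun y => fderiv ℝ (pev p) y b) x a = fderiv ℝ (fderiv ℝ (pev p)) x a b := by
    rw [fderiv_clm_apply h1 (differentiableAt_const b)]
    simp
  rw [← h2]
  simp only [fderiv_pev]

section derivOn

variable {d : ℕ} {T : Finset (Space d)} {v : Space d → ℝ} {p : Poly d}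

theorem derivOn_eq (hT : UniqueDiffOn ℝ (hull T)) (hp : ∀ x ∈ hull T, v x = pev p x) {x : Space d}
    (hx : x ∈ hull T) (j : ℕ) : derivOn j v T x = iteratedFDeriv ℝ j (pev p) x := by
  rw [derivOn, iteratedFDerivWithin_congr hp hx,
    iteratedFDerivWithin_eq_iteratedFDeriv hT (contDiff_pev p).contDiffAt hx]

theorem derivOn_one_apply (hT : UniqueDiffOn ℝ (hull T)) (hp : ∀ x ∈ hull T, v x = pev p x)
    {x : Space d} (hx : x ∈ hull T) (t : Fin 1 → Space d) :
    derivOn 1 v T x t = pev (dirDeriv (t 0) p) x := by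
  rw [derivOn_eq hT hp hx, iteratedFDeriv_one_apply, fderiv_pev]

theorem derivOn_two_apply (hT : UniqueDiffOn ℝ (hull T)) (hp : ∀ x ∈ hull T, v x = pev p x)
    {x : Space d} (hx : x ∈ hull T) (t : Fin 2 → Space d) :
    derivOn 2 v T x t = pev (dirDeriv (t 0) (dirDeriv (t 1) p)) x := by
  rw [derivOn_eq hT hp hx, iteratedFDeriv_two_apply, fderiv_fderiv_pev]

end derivOn

/-- The gradient of a polynomial at a point. -/
noncomputable def polyGrad {d : ℕ} (p : Poly d) (x : Space d) : Space d :=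
  WithLp.toLp 2 fun i => pev (pderiv i p) x

theorem inner_polyGrad {d : ℕ} (p : Poly d) (x t : Space d) :
    inner ℝ (polyGrad p x) t = pev (dirDeriv t p) x := by
  rw [dirDeriv_eq_sum]
  simp [polyGrad, PiLp.inner_apply, pev, smul_eval]

theorem gradient_eq_polyGrad {d : ℕ} {v : Space d → ℝ} {p : Poly d} {x : Space d}
    (h : v =ᶠ[𝓝 x] pev p) : gradient v x = polyGrad p x := by
  refine HasGradientAt.gradient ?_
  rw [hasGradientAt_iff_hasFDerivAt]
  refine HasFDerivAt.congr_of_eventuallyEq ?_ h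
  convert! hasFDerivAt_pev p x using 1
  ext t
  rw [InnerProductSpace.toDual_apply_apply, inner_polyGrad, polyDiff_apply]

/-! ### Simplices -/

/-- `w` is a numbering of the vertices of the `m`-dimensional simplex `s`. -/
structure IsNumbering {d m : ℕ} (w : Fin (m + 1) → Space d) (s : Finset (Space d)) : Prop where
  card : s.card = m + 1
  injective : Function.Injective w
  mem : ∀ i, w i ∈ s

section simplex

variable {d m : ℕ} {w : Fin (m + 1) → Space d} {s : Finset (Space d)}

theorem IsNumbering.range_eq (h : IsNumbering w s) : Set.range w = s := by
  classical
  have h1 : Finset.univ.image w = s := by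
    refine Finset.eq_of_subset_of_card_le (fun x hx => ?_) ?_
    · obtain ⟨i, -, rfl⟩ := Finset.mem_image.1 hx
      exact h.mem i
    · rw [Finset.card_image_of_injective _ h.injective, h.card]; simp
  rw [← h1]; simp

theorem IsNumbering.exists_eq (h : IsNumbering w s) {x : Space d} (hx : x ∈ s) : ∃ i, w i = x := by
  have : x ∈ (s : Set (Space d)) := hx
  rwa [← h.range_eq] at this

theorem exists_isNumbering {s : Finset (Space d)} (hs : s.card = m + 1) :
    ∃ w : Fin (m + 1) → Space d, IsNumbering w s :=
  ⟨fun i => (s.equivFinOfCardEq hs).symm i, hs,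
    Subtype.val_injective.comp (Equiv.injective _), fun _ => Subtype.prop _⟩

theorem IsNumbering.comp_perm (h : IsNumbering w s) (e : Equiv.Perm (Fin (m + 1))) :
    IsNumbering (w ∘ e) s := ⟨h.card, h.injective.comp e.injective, fun _ => h.mem _⟩

theorem sum_smul_mem_hull {ι : Type*} [Fintype ι] {c : ι → ℝ} {u : ι → Space d}
    (hc : c ∈ stdSimplex ℝ ι) (hu : ∀ i, u i ∈ hull s) : ∑ i, c i • u i ∈ hull s :=
  (convex_convexHull ℝ _).sum_mem (fun i _ => hc.1 i) hc.2 fun i _ => hu i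

theorem mem_hull_of_mem {x : Space d} (hx : x ∈ s) : x ∈ hull s := subset_convexHull ℝ _ hx

theorem IsNumbering.hull_eq (h : IsNumbering w s) : hull s = param w '' refSimplex m := by
  refine Set.Subset.antisymm ?_ ?_
  · have h1 : param w '' refSimplex m
        = (fun c : Fin (m + 1) → ℝ => ∑ l, c l • w l) '' stdSimplex ℝ (Fin (m + 1)) := by
      ext y
      constructor
      · rintro ⟨x, hx, rfl⟩
        exact ⟨bary x, bary_mem_stdSimplex hx, rfl⟩
      · rintro ⟨c, hc, rfl⟩
        obtain ⟨x, hx, rfl⟩ := exists_bary_eq hc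
        exact ⟨x, hx, rfl⟩
    rw [h1]
    refine convexHull_min ?_ (Convex.is_linear_image (convex_stdSimplex ℝ _) ⟨?_, ?_⟩)
    · rw [← h.range_eq]
      rintro _ ⟨i, rfl⟩
      exact ⟨Pi.single i 1, single_mem_stdSimplex ℝ i, by simp [Pi.single_apply]⟩
    · intro a b; simp [add_smul, Finset.sum_add_distrib]
    · intro c a; simp [mul_smul, Finset.smul_sum]
  · rintro _ ⟨x, hx, rfl⟩
    exact sum_smul_mem_hull (bary_mem_stdSimplex hx) fun i => mem_hull_of_mem (h.mem i)

theorem IsNumbering.param_mem (h : IsNumbering w s) {x : Fin m → ℝ} (hx : x ∈ refSimplex m) :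
    param w x ∈ hull s := by
  rw [h.hull_eq]; exact ⟨x, hx, rfl⟩

theorem IsNumbering.forall_hull (h : IsNumbering w s) {P : Space d → Prop} :
    (∀ y ∈ hull s, P y) ↔ ∀ x ∈ refSimplex m, P (param w x) := by
  rw [h.hull_eq]; exact Set.forall_mem_image

theorem param_zero (w : Fin (m + 1) → Space d) : param w 0 = w 0 := by
  simp [param_eq]

/-- A point with a vanishing barycentric coordinate lies in the hull of the opposite facet. -/
theorem IsNumbering.param_mem_erase [DecidableEq (Space d)] (h : IsNumbering w s)
    {x : Fin m → ℝ} (hx : x ∈ refSimplex m) {j : Fin (m + 1)} (hj : bary x j = 0) :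
    param w x ∈ hull (s.erase (w j)) := by
  rw [param, ← Finset.sum_erase Finset.univ (a := j) (by rw [hj, zero_smul])]
  refine (convex_convexHull ℝ _).sum_mem (fun i _ => bary_nonneg hx i) ?_ fun i hi => ?_
  · rw [Finset.sum_erase _ hj, sum_bary]
  · exact mem_hull_of_mem (Finset.mem_erase.2
      ⟨fun h' => (Finset.ne_of_mem_erase hi) (h.injective h'), h.mem i⟩)

theorem isCompact_hull (s : Finset (Space d)) : IsCompact (hull s) :=
  s.finite_toSet.isCompact_convexHull (𝕜 := ℝ)

theorem dist_le_diameter {x y : Space d} (hx : x ∈ hull s) (hy : y ∈ hull s) :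
    ‖x - y‖ ≤ diameter s := by
  rw [← dist_eq_norm, diameter]
  exact Metric.dist_le_diam_of_mem (isCompact_hull s).isBounded hx hy

theorem integrableOn_pev (p : Poly d) (s : Finset (Space d)) : IntegrableOn (pev p) (hull s) :=
  (continuous_pev p).continuousOn.integrableOn_compact (isCompact_hull s)

end simplex

/-! ### Full-dimensional simplices -/

section cell

variable {d : ℕ} {z : Fin (d + 1) → Space d} {T : Finset (Space d)}

theorem linearIndependent_edges (h : AffineIndependent ℝ z) :
    LinearIndependent ℝ fun i : Fin d => z i.succ - z 0 := by
  have h1 := (affineIndependent_iff_linearIndependent_vsub ℝ z 0).1 h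
  exact h1.comp (fun i : Fin d => ⟨i.succ, Fin.succ_ne_zero i⟩) fun i j hij =>
    Fin.succ_injective _ (congrArg Subtype.val hij)

/-- The linear part of the parametrization of a full-dimensional simplex. -/
noncomputable def edgeEquiv (h : AffineIndependent ℝ z) : (Fin d → ℝ) ≃L[ℝ] Space d :=
  ((Module.Basis.mk (linearIndependent_edges h)
    ((linearIndependent_edges h).span_eq_top_of_card_eq_finrank' (by simp)).ge).equivFun.symm
    ).toContinuousLinearEquiv

theorem edgeEquiv_apply (h : AffineIndependent ℝ z) (x : Fin d → ℝ) :
    edgeEquiv h x = ∑ i, x i • (z i.succ - z 0) := by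
  simp [edgeEquiv, Module.Basis.equivFun_symm_apply]

theorem param_eq_edgeEquiv (h : AffineIndependent ℝ z) (x : Fin d → ℝ) :
    param z x = z 0 + edgeEquiv h x := by rw [param_eq, edgeEquiv_apply]

theorem param_injective (h : AffineIndependent ℝ z) : Function.Injective (param z) := by
  intro x y hxy
  rw [param_eq_edgeEquiv h, param_eq_edgeEquiv h] at hxy
  exact (edgeEquiv h).injective (add_left_cancel hxy)

/-- The image of Lebesgue measure under an affine bijection is translation invariant, hence a
multiple of the volume. The factor need not be computed: it cancels in scaled estimates. -/
theorem exists_integral_eq (h : AffineIndependent ℝ z) (hz : IsNumbering z T) :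
    ∃ J : ℝ, 0 < J ∧ ∀ f : Space d → ℝ,
      ∫ y in hull T, f y = J * ∫ x in refSimplex d, f (param z x) := by
  set B := edgeEquiv h
  have : (Measure.map B (volume : Measure (Fin d → ℝ))).IsAddHaarMeasure :=
    B.isAddHaarMeasure_map volume
  set μ := Measure.map B (volume : Measure (Fin d → ℝ)) with hμ
  set c := (volume : Measure (Space d)).addHaarScalarFactor μ with hc
  have hc0 : 0 < c := Measure.addHaarScalarFactor_pos_of_isAddHaarMeasure _ _
  have hvol : (volume : Measure (Space d)) = c • μ := Measure.isAddLeftInvariant_eq_smul _ _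
  have hmap : Measure.map (param z) volume = μ := by
    have h1 : param z = (fun y => z 0 + y) ∘ B := funext fun x => param_eq_edgeEquiv h x
    rw [h1, ← Measure.map_map (measurable_const_add _) B.continuous.measurable, ← hμ,
      map_add_left_eq_self]
  have hemb : MeasurableEmbedding (param z) := by
    have h1 : param z = (Homeomorph.addLeft (z 0)) ∘ B.toHomeomorph :=
      funext fun x => param_eq_edgeEquiv h x
    rw [h1]
    exact (Homeomorph.measurableEmbedding _).comp (Homeomorph.measurableEmbedding _)
  refine ⟨c, hc0, fun f => ?_⟩
  have h2 : ∫ y in hull T, f y = ∫ y in hull T, f y ∂(c • μ) := by rw [← hvol]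
  rw [h2, Measure.restrict_smul, integral_smul_nnreal_measure, ← hmap, hemb.setIntegral_map,
    hz.hull_eq, Set.preimage_image_eq _ (param_injective h)]
  rfl

end cell

/-! ### Scaled estimates on a simplex -/

section geometry

variable {d m : ℕ} {w : Fin (m + 1) → Space d} {s T : Finset (Space d)}

theorem IsNumbering.diameter_pos (hw : IsNumbering w s) (hm : 1 ≤ m) : 0 < diameter s := by
  have hne : w 0 ≠ w (Fin.last m) := fun h => by
    have := hw.injective h
    rw [Fin.ext_iff] at this
    simp at this
    omega
  refine lt_of_lt_of_le (norm_pos_iff.2 (sub_ne_zero.2 hne))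
    (dist_le_diameter (mem_hull_of_mem (hw.mem _)) (mem_hull_of_mem (hw.mem _)))

theorem hull_mono (h : s ⊆ T) : hull s ⊆ hull T := convexHull_mono (by exact_mod_cast h)

/-- Vectors of length at most one have bounded coordinates with respect to the edges of a simplex
that contains a ball. -/
theorem IsNumbering.exists_coord (hw : IsNumbering w T) {x : Space d} {r : ℝ} (hr : 0 < r)
    (hB : Metric.closedBall x r ⊆ hull T) {t : Space d} (ht : ‖t‖ ≤ 1) :
    ∃ a : Fin m → ℝ, (∀ i, |a i| ≤ r⁻¹) ∧ t = ∑ i, a i • (w i.succ - w 0) := by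
  have h1 : x ∈ hull T := hB (Metric.mem_closedBall_self hr.le)
  have h2 : x + r • t ∈ hull T := hB (by
    rw [Metric.mem_closedBall, dist_eq_norm, add_sub_cancel_left, norm_smul, Real.norm_eq_abs,
      abs_of_pos hr]
    exact mul_le_of_le_one_right hr.le ht)
  rw [hw.hull_eq] at h1 h2
  -- The coordinates of t are the differences of the parameters of x + r t and x, divided by r; all
  -- parameters lie in [0, 1].
  obtain ⟨u, hu, hux⟩ := h1
  obtain ⟨u', hu', hux'⟩ := h2
  refine ⟨fun i => r⁻¹ * (u' i - u i), fun i => ?_, ?_⟩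
  · rw [abs_mul, abs_of_pos (inv_pos.2 hr)]
    refine mul_le_of_le_one_right (inv_pos.2 hr).le (abs_le.2 ⟨?_, ?_⟩)
    · linarith [hu'.1 i, le_one_of_mem_refSimplex hu i]
    · linarith [hu.1 i, le_one_of_mem_refSimplex hu' i]
  · have h3 : r • t = ∑ i, (u' i - u i) • (w i.succ - w 0) := by
      have : r • t = param w u' - param w u := by rw [hux', hux]; abel
      rw [this, param_eq, param_eq]
      simp only [sub_smul _ _ (_ - _), Finset.sum_sub_distrib]
      abel
    have h4 : t = r⁻¹ • (r • t) := by rw [smul_smul, inv_mul_cancel₀ hr.ne', one_smul]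
    rw [h4, h3, Finset.smul_sum]
    exact Finset.sum_congr rfl fun i _ => by rw [smul_smul]

/-- A numbering that starts with a given vertex and continues with another one. -/
theorem IsNumbering.exists_start (hw : IsNumbering w s) {x : Space d} (hx : x ∈ s) :
    ∃ w' : Fin (m + 1) → Space d, IsNumbering w' s ∧ w' 0 = x := by
  obtain ⟨i, rfl⟩ := hw.exists_eq hx
  exact ⟨w ∘ Equiv.swap 0 i, hw.comp_perm _, by simp⟩

theorem IsNumbering.affineIndependent (hw : IsNumbering w s)
    (hs : AffineIndependent ℝ ((↑) : s → Space d)) : AffineIndependent ℝ w :=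
  hs.comp_embedding ⟨fun i => (⟨w i, hw.mem i⟩ : s), fun _ _ h =>
    hw.injective (congrArg Subtype.val h)⟩

/-- The unit vector along an edge e has the coordinate 1/‖e‖ with respect to that edge, while
coordinates of unit vectors are at most 1/r. -/
theorem radius_le_edge (hT : T.card = d + 1) (hs : AffineIndependent ℝ ((↑) : T → Space d))
    {x : Space d} {r : ℝ} (hr : 0 < r) (hB : Metric.closedBall x r ⊆ hull T) {a b : Space d}
    (ha : a ∈ T) (hb : b ∈ T) (hab : a ≠ b) : r ≤ ‖a - b‖ := by
  obtain ⟨w0, hw0⟩ := exists_isNumbering hT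
  obtain ⟨w, hw, rfl⟩ := hw0.exists_start hb
  obtain ⟨i, rfl⟩ := hw.exists_eq ha
  obtain ⟨l, rfl⟩ := Fin.exists_succ_eq.2 (fun h : i = 0 => hab (by rw [h]))
  set e := w l.succ - w 0 with he
  have he0 : 0 < ‖e‖ := norm_pos_iff.2 (sub_ne_zero.2 hab)
  obtain ⟨c, hc, hce⟩ := hw.exists_coord hr hB (t := ‖e‖⁻¹ • e)
    (by rw [norm_smul, norm_inv, norm_norm, inv_mul_cancel₀ he0.ne'])
  have hli := linearIndependent_edges (hw.affineIndependent hs)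
  have h1 : ∑ i, (‖e‖⁻¹ * (Pi.single l 1 : Fin d → ℝ) i - c i) • (w i.succ - w 0) = 0 := by
    simp only [sub_smul _ _ (_ - _), Finset.sum_sub_distrib, ← hce]
    rw [sub_eq_zero]
    simp only [mul_smul, ← Finset.smul_sum]
    congr 1
    simp [Pi.single_apply, he]
  have h2 := Fintype.linearIndependent_iff.1 hli _ h1 l
  have h3 : c l = ‖e‖⁻¹ := by
    have : ‖e‖⁻¹ - c l = 0 := by simpa using h2
    linarith
  have h4 := (le_abs_self _).trans (hc l)
  rw [h3] at h4
  exact (inv_le_inv₀ he0 hr).1 h4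

end geometry

/-! ### Inverse estimates -/

section inverse

variable {d : ℕ}

/-- Markov's inequality on the reference simplex, transported by `pderiv_pull`. The constant sees
neither the shape of the simplex nor the ambient dimension. -/
theorem exists_edge_deriv_bound (m k : ℕ) : ∃ C : ℝ, 0 ≤ C ∧ ∀ {d : ℕ} {s : Finset (Space d)}
    {w : Fin (m + 1) → Space d}, IsNumbering w s → ∀ p : Poly d, p.totalDegree ≤ k →
    ∀ M : ℝ, 0 ≤ M → (∀ y ∈ hull s, |pev p y| ≤ M) → ∀ i : Fin m, ∀ y ∈ hull s,
      |pev (dirDeriv (w i.succ - w 0) p) y| ≤ C * M := by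
  obtain ⟨C, hC0, hC⟩ := exists_pderiv_bound m k
  refine ⟨C, hC0, fun {d s w} hw p hp M hM h i => ?_⟩
  rw [hw.forall_hull] at h ⊢
  intro x hx
  have := hC i (pull w p) ((totalDegree_pull_le w p).trans hp) M hM
    (fun x hx => by rw [eval_pull]; exact h x hx) x hx
  rwa [pderiv_pull, eval_pull] at this

/-- Inverse estimate in the maximum norm. -/
theorem exists_inverse_bound (d k : ℕ) (σ : ℝ) : ∃ C : ℝ, 0 ≤ C ∧ ∀ {T : Finset (Space d)},
    T.card = d + 1 → (∃ (x : Space d) (r : ℝ),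
      0 < r ∧ Metric.closedBall x r ⊆ hull T ∧ diameter T ≤ σ * r) →
    ∀ p : Poly d, p.totalDegree ≤ k → ∀ M : ℝ, 0 ≤ M → (∀ y ∈ hull T, |pev p y| ≤ M) →
    ∀ t : Space d, ∀ y ∈ hull T, diameter T * |pev (dirDeriv t p) y| ≤ C * M * ‖t‖ := by
  obtain ⟨C, hC0, hC⟩ := exists_edge_deriv_bound d k
  refine ⟨|σ| * (d * C), by positivity, fun {T} hT hr p hp M hM h t y hy => ?_⟩
  obtain ⟨x, r, hr, hB, hσ⟩ := hr
  obtain ⟨w, hw⟩ := exists_isNumbering hT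
  -- A unit direction is expanded in the edges with coefficients at most 1/r; shape regularity
  -- enters through h/r ≤ σ.
  have unit : ∀ t : Space d, ‖t‖ ≤ 1 → diameter T * |pev (dirDeriv t p) y| ≤ |σ| * (d * C) * M := by
    intro t ht
    obtain ⟨a, ha, rfl⟩ := hw.exists_coord hr hB ht
    have h1 : |pev (dirDeriv (∑ i, a i • (w i.succ - w 0)) p) y| ≤ r⁻¹ * (d * C * M) := by
      rw [dirDeriv_sum, pev, map_sum]
      calc _ ≤ ∑ i : Fin d, |pev (dirDeriv (a i • (w i.succ - w 0)) p) y| :=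
            Finset.abs_sum_le_sum_abs _ _
        _ ≤ ∑ _i : Fin d, r⁻¹ * (C * M) := by
            refine Finset.sum_le_sum fun i _ => ?_
            rw [dirDeriv_smul, pev, smul_eval, abs_mul]
            exact mul_le_mul (ha i) (hC hw p hp M hM h i y hy) (abs_nonneg _)
              (inv_pos.2 hr).le
        _ = r⁻¹ * (d * C * M) := by simp; ring
    have h0 : 0 ≤ diameter T := Metric.diam_nonneg
    have h2 : diameter T * r⁻¹ ≤ |σ| := by
      rw [← div_eq_mul_inv, div_le_iff₀ hr]
      exact hσ.trans (mul_le_mul_of_nonneg_right (le_abs_self _) hr.le)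
    calc _ ≤ diameter T * (r⁻¹ * (d * C * M)) := mul_le_mul_of_nonneg_left h1 h0
      _ = (diameter T * r⁻¹) * (d * C * M) := by ring
      _ ≤ |σ| * (d * C * M) := mul_le_mul_of_nonneg_right h2 (by positivity)
      _ = _ := by ring
  rcases eq_or_ne t 0 with rfl | ht
  · have : dirDeriv (0 : Space d) p = 0 := (dirDerivₗ p).map_zero
    simp [this, pev]
  · have ht' : 0 < ‖t‖ := norm_pos_iff.2 ht
    have h1 := unit (‖t‖⁻¹ • t) (by rw [norm_smul, norm_inv, norm_norm, inv_mul_cancel₀ ht'.ne'])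
    rw [dirDeriv_smul, pev, smul_eval, abs_mul, abs_of_pos (inv_pos.2 ht')] at h1
    have h2 := mul_le_mul_of_nonneg_right h1 ht'.le
    refine le_trans (le_of_eq ?_) h2
    field_simp

theorem setIntegral_sq_le {T : Finset (Space d)} {p : Poly d} {M : ℝ}
    (h : ∀ y ∈ hull T, |pev p y| ≤ M) :
    ∫ y in hull T, pev p y ^ 2 ≤ M ^ 2 * volume.real (hull T) := by
  have hc := isCompact_hull T
  have h1 : ∫ y in hull T, pev p y ^ 2 ≤ ∫ _y in hull T, M ^ 2 := by
    refine setIntegral_mono_on ?_ ?_ hc.measurableSet fun y hy => ?_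
    · exact ((continuous_pev p).pow 2).continuousOn.integrableOn_compact hc
    · exact continuousOn_const.integrableOn_compact hc
    · rw [← sq_abs]; exact pow_le_pow_left₀ (abs_nonneg _) (h y hy) 2
  rw [setIntegral_const, smul_eq_mul, mul_comm] at h1
  exact h1

/-- The volume and the integral carry the same transformation factor, so the estimate on the
reference simplex transfers without shape regularity. -/
theorem exists_sq_le_setIntegral (d k : ℕ) : ∃ C : ℝ, 0 ≤ C ∧ ∀ {T : Finset (Space d)},
    T.card = d + 1 → AffineIndependent ℝ ((↑) : T → Space d) →
    ∀ p : Poly d, p.totalDegree ≤ k → ∀ y ∈ hull T,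
      pev p y ^ 2 * volume.real (hull T) ≤ C * ∫ y in hull T, pev p y ^ 2 := by
  obtain ⟨C, hC0, hC⟩ := exists_refInt_bound d k
  set V := volume.real (refSimplex d) with hV
  refine ⟨C * V, mul_nonneg hC0 measureReal_nonneg, fun {T} hT hs p hp => ?_⟩
  obtain ⟨w, hw⟩ := exists_isNumbering hT
  obtain ⟨J, hJ, hint⟩ := exists_integral_eq (hw.affineIndependent hs) hw
  rw [hw.forall_hull]
  intro x hx
  have h1 : volume.real (hull T) = J * V := by
    have := hint fun _ => 1
    simpa [setIntegral_const, hV] using this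
  have h2 : ∫ y in hull T, pev p y ^ 2 = J * refInt d (pull w p * pull w p) := by
    rw [hint, refInt_apply]
    simp only [map_mul, eval_pull, sq]
  have h3 := hC (pull w p) ((totalDegree_pull_le w p).trans hp) x hx
  rw [eval_pull] at h3
  rw [h1, h2]
  calc _ ≤ (C * refInt d (pull w p * pull w p)) * (J * V) :=
        mul_le_mul_of_nonneg_right h3 (mul_nonneg hJ.le measureReal_nonneg)
    _ = _ := by ring

/-- The squared Frobenius norm of the Hessian. -/
noncomputable def hessSq (p : Poly d) (y : Space d) : ℝ :=
  ∑ i, ∑ j, pev (pderiv i (pderiv j p)) y ^ 2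

theorem sq_dirDeriv_dirDeriv_le (p : Poly d) (a b y : Space d) :
    pev (dirDeriv a (dirDeriv b p)) y ^ 2 ≤ ‖a‖ ^ 2 * ‖b‖ ^ 2 * hessSq p y := by
  have h1 : pev (dirDeriv a (dirDeriv b p)) y
      = ∑ i, ∑ j, (a i * b j) * pev (pderiv i (pderiv j p)) y := by
    rw [dirDeriv_eq_sum, pev, map_sum]
    refine Finset.sum_congr rfl fun i _ => ?_
    rw [smul_eval, dirDeriv_eq_sum, map_sum, map_sum, Finset.mul_sum]
    refine Finset.sum_congr rfl fun j _ => ?_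
    rw [Derivation.map_smul, smul_eval, mul_assoc]
  rw [h1, ← Finset.sum_product', hessSq, ← Finset.sum_product']
  refine (Finset.sum_mul_sq_le_sq_mul_sq _ _ _).trans (le_of_eq ?_)
  congr 1
  simp only [mul_pow]
  rw [EuclideanSpace.real_norm_sq_eq,
    EuclideanSpace.real_norm_sq_eq, Finset.sum_mul_sum, Finset.sum_product]

theorem continuous_hessSq (p : Poly d) : Continuous (hessSq p) :=
  continuous_finsetSum _ fun _ _ => continuous_finsetSum _ fun _ _ => (continuous_pev _).pow 2

theorem hessSq_nonneg (p : Poly d) (y : Space d) : 0 ≤ hessSq p y :=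
  Finset.sum_nonneg fun _ _ => Finset.sum_nonneg fun _ _ => sq_nonneg _

/-- Poincaré inequality for polynomials with a first-order zero at a vertex. -/
theorem exists_poincare (d k : ℕ) : ∃ C : ℝ, 0 ≤ C ∧ ∀ {T : Finset (Space d)},
    T.card = d + 1 → AffineIndependent ℝ ((↑) : T → Space d) →
    ∀ p : Poly d, p.totalDegree ≤ k → ∀ z ∈ T, pev p z = 0 → (∀ t, pev (dirDeriv t p) z = 0) →
      ∫ y in hull T, pev p y ^ 2 ≤ C * diameter T ^ 4 * ∫ y in hull T, hessSq p y := by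
  obtain ⟨C1, hC10, hC1⟩ := exists_bound_second_deriv d k
  obtain ⟨C2, hC20, hC2⟩ := exists_sq_le_setIntegral d k
  refine ⟨C1 ^ 2 * C2, by positivity, fun {T} hT hs p hp z hz h0 h1 => ?_⟩
  obtain ⟨w0, hw0⟩ := exists_isNumbering hT
  obtain ⟨w, hw, rfl⟩ := hw0.exists_start hz
  have hc := isCompact_hull T
  set S := ∫ y in hull T, hessSq p y with hS
  have hS0 : 0 ≤ S := integral_nonneg fun y => hessSq_nonneg p y
  obtain ⟨J, hJ, hint⟩ := exists_integral_eq (hw.affineIndependent hs) hw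
  have hvol : 0 < volume.real (hull T) := by
    have := hint fun _ => 1
    have h2 : volume.real (hull T) = J * volume.real (refSimplex d) := by
      simpa [setIntegral_const] using this
    rw [h2]
    exact mul_pos hJ (ENNReal.toReal_pos (volume_refSimplex_pos d).ne' (volume_refSimplex_ne_top d))
  set V := volume.real (hull T) with hV
  -- A pointwise bound for second derivatives along two edges: such a derivative g is again a
  -- polynomial with |g|² V ≤ C2 ∫ g², and ∫ g² is at most h⁴ times the integrated squared Hessian.
  -- The volume cancels at the end.
  set M := √(C2 * diameter T ^ 4 * S / V) with hM
  have hδ : ∀ i : Fin d, ‖w i.succ - w 0‖ ^ 2 ≤ diameter T ^ 2 := fun i =>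
    pow_le_pow_left₀ (norm_nonneg _)
      (dist_le_diameter (mem_hull_of_mem (hw.mem _)) (mem_hull_of_mem (hw.mem _))) 2
  have h2 : ∀ i j, ∀ x ∈ refSimplex d, |eval x (pderiv i (pderiv j (pull w p)))| ≤ M := by
    intro i j x hx
    rw [pderiv_pull, pderiv_pull, eval_pull]
    refine Real.abs_le_sqrt ?_
    set g := dirDeriv (w i.succ - w 0) (dirDeriv (w j.succ - w 0) p) with hg
    have hgd : g.totalDegree ≤ k :=
      (totalDegree_dirDeriv_le _ _).trans ((Nat.sub_le _ _).trans
        ((totalDegree_dirDeriv_le _ _).trans ((Nat.sub_le _ _).trans hp)))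
    rw [le_div_iff₀ hvol]
    refine (hC2 hT hs g hgd _ (hw.param_mem hx)).trans ?_
    rw [mul_assoc]
    refine mul_le_mul_of_nonneg_left ?_ hC20
    rw [hS, ← integral_const_mul]
    refine setIntegral_mono_on ?_ ?_ hc.measurableSet fun y _ => ?_
    · exact ((continuous_pev g).pow 2).continuousOn.integrableOn_compact hc
    · exact (continuous_const.mul (continuous_hessSq p)).continuousOn.integrableOn_compact hc
    · refine (sq_dirDeriv_dirDeriv_le p _ _ y).trans ?_
      refine mul_le_mul_of_nonneg_right ?_ (hessSq_nonneg p y)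
      calc _ ≤ diameter T ^ 2 * diameter T ^ 2 :=
            mul_le_mul (hδ i) (hδ j) (sq_nonneg _) (sq_nonneg _)
        _ = _ := by ring
  have h3 := hC1 (pull w p) ((totalDegree_pull_le w p).trans hp)
    (by rw [eval_pull, param_zero]; exact h0)
    (fun i => by rw [pderiv_pull, eval_pull, param_zero]; exact h1 _) M (Real.sqrt_nonneg _) h2
  have h4 : ∀ y ∈ hull T, |pev p y| ≤ C1 * M := by
    rw [hw.forall_hull]
    intro x hx
    rw [← eval_pull]; exact h3 x hx
  refine (setIntegral_sq_le h4).trans (le_of_eq ?_)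
  rw [mul_pow, hM, Real.sq_sqrt (by positivity), ← hV]
  field_simp

end inverse

/-! ### Bounds from degrees of freedom -/

theorem iterate_pderiv_pull {d m : ℕ} (w : Fin (m + 1) → Space d) (p : Poly d) (j : Fin m) (l : ℕ) :
    (pderiv j)^[l] (pull w p) = pull w ((dirDeriv (w j.succ - w 0))^[l] p) := by
  have h : Function.Semiconj (pull w) (dirDeriv (w j.succ - w 0)) (pderiv j) :=
    fun q => (pderiv_pull w q j).symm
  exact ((h.iterate_right l).eq p).symm

/-- The estimate on the reference simplex, pulled back. Transversal derivatives become derivatives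
along edges of `s`, so the geometry of `s` does not affect the constant. -/
theorem Unisolvent.exists_pull_bound {m r n I : ℕ} {D : Fin I → RefDomain (m + 1)}
    (hD : Unisolvent (m + 1) r n D) (hr : r ≤ 3) :
    ∃ C : ℝ, 0 ≤ C ∧ ∀ {d : ℕ} {s : Finset (Space d)} {w : Fin (m + 2) → Space d},
      IsNumbering w s → ∀ p : Poly d, p.totalDegree ≤ n → ∀ M : ℝ, 0 ≤ M →
      (∀ x ∈ refSimplex (m + 1), ∀ j, bary x j = 0 → ∀ l < r,
        |pev ((dirDeriv (w (baryVar j).succ - w 0))^[l] p) (param w x)| ≤ M) →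
      (∀ i, |(D i).average (pull w p)| ≤ M) → ∀ y ∈ hull s, |pev p y| ≤ C * M := by
  obtain ⟨C, hC0, hC⟩ := hD.exists_bound hr
  refine ⟨C, hC0, fun {d s w} hw p hp M hM h1 h2 => ?_⟩
  rw [hw.forall_hull]
  intro x hx
  rw [← eval_pull]
  refine hC (pull w p) ((totalDegree_pull_le w p).trans hp) M hM (fun x hx j hj l hl => ?_) h2 x hx
  rw [iterate_pderiv_pull, eval_pull]
  exact h1 x hx j hj l hl

theorem param_edge {d : ℕ} (w : Fin 2 → Space d) {x : Fin 1 → ℝ} {j : Fin 2} (hj : bary x j = 0) :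
    ∃ i, param w x = w i := by
  have h := sum_bary x
  rw [Fin.sum_univ_two] at h
  have hp : param w x = bary x 0 • w 0 + bary x 1 • w 1 := Fin.sum_univ_two _
  fin_cases j
  · simp only [Fin.zero_eta] at hj
    refine ⟨1, ?_⟩
    rw [hj, zero_add] at h
    rw [hp, hj, h, zero_smul, one_smul, zero_add]
  · simp only [Fin.mk_one] at hj
    refine ⟨0, ?_⟩
    rw [hj, add_zero] at h
    rw [hp, hj, h, zero_smul, one_smul, add_zero]

theorem Unisolvent.exists_edge_bound {r n I : ℕ} {D : Fin I → RefDomain 1}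
    (hD : Unisolvent 1 r n D) (hr : r ≤ 3) :
    ∃ C : ℝ, 0 ≤ C ∧ ∀ {d : ℕ} {s : Finset (Space d)} {w : Fin 2 → Space d},
      IsNumbering w s → ∀ p : Poly d, p.totalDegree ≤ n → ∀ M : ℝ, 0 ≤ M →
      (∀ a ∈ s, ∀ l < r, |pev ((dirDeriv (w 1 - w 0))^[l] p) a| ≤ M) →
      (∀ i, |(D i).average (pull w p)| ≤ M) → ∀ y ∈ hull s, |pev p y| ≤ C * M := by
  obtain ⟨C, hC0, hC⟩ := hD.exists_pull_bound hr
  refine ⟨C, hC0, fun {d s w} hw p hp M hM h1 h2 => hC hw p hp M hM (fun x _ j hj l hl => ?_) h2⟩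
  obtain ⟨i, hi⟩ := param_edge w hj
  have hb : baryVar j = 0 := Subsingleton.elim (α := Fin 1) _ _
  rw [hi, hb]
  exact h1 _ (hw.mem i) l hl

theorem IsNumbering.edge_le {d m : ℕ} {w : Fin (m + 1) → Space d} {s T : Finset (Space d)}
    (hw : IsNumbering w s) (hs : s ⊆ T) (i j : Fin (m + 1)) : ‖w i - w j‖ ≤ diameter T :=
  dist_le_diameter (mem_hull_of_mem (hs (hw.mem i))) (mem_hull_of_mem (hs (hw.mem j)))

/-- Removes the scaling from bounds of the form h |∂_t p| ≤ M ‖t‖ when t is an edge, because then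
‖t‖ ≤ h. -/
theorem le_of_mul_le_mul_norm {δ a M : ℝ} {b : ℝ} (hδ : 0 < δ) (hM : 0 ≤ M) (hb : b ≤ δ)
    (h : δ * a ≤ M * b) : a ≤ M := by
  have : δ * a ≤ δ * M := h.trans (by rw [mul_comm]; exact mul_le_mul_of_nonneg_right hb hM)
  exact le_of_mul_le_mul_left this hδ

/-- The degrees of freedom of the Hermite element control a polynomial on a triangle. -/
theorem exists_local_bound_two {k : ℕ} (P : DofPattern 2 k) : ∃ C : ℝ, 0 ≤ C ∧
    ∀ {T : Finset (Space 2)} {num : ∀ m : ℕ, Finset (Space 2) → Fin (m + 1) → Space 2},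
    T.card = 3 → (∀ m, ∀ s ⊆ T, s.card = m + 1 → IsNumbering (num m s) s) →
    ∀ p : Poly 2, p.totalDegree ≤ k → ∀ M : ℝ, 0 ≤ M →
    (∀ x ∈ T, |pev p x| ≤ M) →
    (∀ x ∈ T, ∀ t, diameter T * |pev (dirDeriv t p) x| ≤ M * ‖t‖) →
    (∀ m, 1 ≤ m → m ≤ 2 → ∀ s ⊆ T, s.card = m + 1 → ∀ a,
      |(P.val m a).average (pull (num m s) p)| ≤ M) →
    ∀ y ∈ hull T, |pev p y| ≤ C * M := by
  classical
  -- The exponent d + 1 - m is 2 on edges, which asks for values and tangential derivatives at the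
  -- end points, and 1 on the triangle, which asks for the trace on the edges only.
  obtain ⟨C1, hC10, hC1⟩ := Unisolvent.exists_edge_bound (P.val_unisolvent 1 le_rfl (by norm_num))
    (by norm_num)
  obtain ⟨C2, hC20, hC2⟩ := Unisolvent.exists_pull_bound
    (P.val_unisolvent 2 (by norm_num) le_rfl) (by norm_num)
  refine ⟨C2 * (1 + C1), by positivity, ?_⟩
  intro T num hT hnum p hp M hM h0 h1 hv
  have hδ : 0 < diameter T := (hnum 2 T subset_rfl hT).diameter_pos (by norm_num)
  have edge : ∀ s ⊆ T, s.card = 2 → ∀ y ∈ hull s, |pev p y| ≤ C1 * M := by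
    intro s hs hc
    have hw := hnum 1 s hs hc
    refine hC1 hw p hp M hM (fun a ha l hl => ?_) (hv 1 le_rfl (by norm_num) s hs hc)
    interval_cases l
    · exact h0 a (hs ha)
    · exact le_of_mul_le_mul_norm hδ hM (hw.edge_le hs 1 0) (h1 a (hs ha) _)
  have hw := hnum 2 T subset_rfl hT
  have hM1 : M ≤ (1 + C1) * M := by nlinarith
  have hM2 : C1 * M ≤ (1 + C1) * M := by nlinarith
  rw [mul_assoc]
  intro y hy
  refine hC2 hw p hp ((1 + C1) * M) (by positivity) (fun x hx j hj l hl => ?_)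
    (fun i => (hv 2 (by norm_num) le_rfl T subset_rfl hT i).trans hM1) y hy
  have hl' : l = 0 := by omega
  subst hl'
  refine (edge (T.erase (num 2 T j)) (Finset.erase_subset _ _) ?_ _
    (hw.param_mem_erase hx hj)).trans hM2
  rw [Finset.card_erase_of_mem (hw.mem j), hT]

/-- The degrees of freedom of the Argyris element control a polynomial on a tetrahedron. -/
theorem exists_local_bound_three {k : ℕ} (P : DofPattern 3 k) (σ : ℝ) : ∃ C : ℝ, 0 ≤ C ∧
    ∀ {T : Finset (Space 3)} {num : ∀ m : ℕ, Finset (Space 3) → Fin (m + 1) → Space 3},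
    T.card = 4 → (∀ m, ∀ s ⊆ T, s.card = m + 1 → IsNumbering (num m s) s) →
    AffineIndependent ℝ ((↑) : T → Space 3) → (∃ (x : Space 3) (r : ℝ),
      0 < r ∧ Metric.closedBall x r ⊆ hull T ∧ diameter T ≤ σ * r) →
    ∀ p : Poly 3, p.totalDegree ≤ k → ∀ M : ℝ, 0 ≤ M →
    (∀ x ∈ T, |pev p x| ≤ M) →
    (∀ x ∈ T, ∀ t, diameter T * |pev (dirDeriv t p) x| ≤ M * ‖t‖) →
    (∀ x ∈ T, ∀ t u, diameter T ^ 2 * |pev (dirDeriv t (dirDeriv u p)) x| ≤ M * (‖t‖ * ‖u‖)) →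
    (∀ m, 1 ≤ m → m ≤ 3 → ∀ s ⊆ T, s.card = m + 1 → ∀ a,
      |(P.val m a).average (pull (num m s) p)| ≤ M) →
    (∀ s ⊆ T, s.card = 2 → ∀ a t, (∀ x ∈ s, ∀ y ∈ s, inner ℝ t (x - y) = 0) →
      diameter T * |(P.edge a).average (pull (num 1 s) (dirDeriv t p))| ≤ M * ‖t‖) →
    ∀ y ∈ hull T, |pev p y| ≤ C * M := by
  classical
  -- The exponents are 3 for values on edges, 2 for normal derivatives on edges, 2 on faces and 1 in
  -- the interior; each stage supplies the boundary data of the next.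
  obtain ⟨C1, hC10, hC1⟩ := Unisolvent.exists_edge_bound (P.val_unisolvent 1 le_rfl (by norm_num))
    (by norm_num)
  obtain ⟨C2, hC20, hC2⟩ := Unisolvent.exists_edge_bound (P.edge_unisolvent rfl) (by norm_num)
  obtain ⟨C3, hC30, hC3⟩ := exists_edge_deriv_bound 1 k
  obtain ⟨C4, hC40, hC4⟩ := Unisolvent.exists_pull_bound
    (P.val_unisolvent 2 (by norm_num) (by norm_num)) (by norm_num)
  obtain ⟨C5, hC50, hC5⟩ := Unisolvent.exists_pull_bound
    (P.val_unisolvent 3 (by norm_num) le_rfl) (by norm_num)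
  set K := 1 + C1 + (|σ| * (C3 * C1) + C2) with hK
  have hK0 : 0 ≤ K := by positivity
  refine ⟨C5 * (1 + C4 * K), by positivity, ?_⟩
  intro T num hT hnum hind hball p hp M hM h0 h1 h2 hv hn
  have hδ : 0 < diameter T := (hnum 3 T subset_rfl hT).diameter_pos (by norm_num)
  have e1 : 0 ≤ C1 * M := by positivity
  have e2 : 0 ≤ |σ| * (C3 * C1) * M := by positivity
  have e3 : 0 ≤ C2 * M := by positivity
  have hMK : K * M = M + C1 * M + (|σ| * (C3 * C1) * M + C2 * M) := by rw [hK]; ring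
  have edge : ∀ s ⊆ T, s.card = 2 → ∀ y ∈ hull s, |pev p y| ≤ C1 * M := by
    intro s hs hc
    have hw := hnum 1 s hs hc
    refine hC1 hw p hp M hM (fun a ha l hl => ?_) (hv 1 le_rfl (by norm_num) s hs hc)
    have he := hw.edge_le hs 1 0
    interval_cases l
    · exact h0 a (hs ha)
    · exact le_of_mul_le_mul_norm hδ hM he (h1 a (hs ha) _)
    · refine le_of_mul_le_mul_norm (pow_pos hδ 2) hM ?_ (h2 a (hs ha) _ _)
      rw [sq]; exact mul_le_mul he he (norm_nonneg _) hδ.le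
  -- On the edge, ∂_t p is a polynomial of degree k - 1. Its end-point data are a first derivative
  -- of p and a mixed second derivative, so the C² data at the vertices suffice.
  have normal : ∀ s ⊆ T, s.card = 2 → ∀ t, (∀ x ∈ s, ∀ y ∈ s, inner ℝ t (x - y) = 0) →
      ∀ y ∈ hull s, diameter T * |pev (dirDeriv t p) y| ≤ C2 * (M * ‖t‖) := by
    intro s hs hc t ht y hy
    have hw := hnum 1 s hs hc
    have he := hw.edge_le hs 1 0
    have hMt : 0 ≤ M * ‖t‖ := by positivity
    have := hC2 hw (dirDeriv t p)
      ((totalDegree_dirDeriv_le _ _).trans (Nat.sub_le_sub_right hp 1)) (M * ‖t‖ / diameter T)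
      (by positivity) (fun a ha l hl => ?_) (fun a => ?_) y hy
    · rw [← mul_div_assoc, le_div_iff₀ hδ] at this
      rwa [mul_comm]
    · rw [le_div_iff₀ hδ]
      interval_cases l
      · rw [mul_comm]; exact h1 a (hs ha) t
      · have h3 := h2 a (hs ha) (num 1 s 1 - num 1 s 0) t
        simp only [Function.iterate_one]
        have h4 : diameter T * (|pev (dirDeriv (num 1 s 1 - num 1 s 0) (dirDeriv t p)) a|
            * diameter T) ≤ M * ‖t‖ * ‖num 1 s 1 - num 1 s 0‖ := by
          calc _ = diameter T ^ 2 * |pev (dirDeriv (num 1 s 1 - num 1 s 0) (dirDeriv t p)) a| := by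
                ring
            _ ≤ _ := h3
            _ = _ := by ring
        exact le_of_mul_le_mul_norm hδ hMt he h4
    · rw [le_div_iff₀ hδ, mul_comm]
      exact hn s hs hc a t ht
  -- Split b into a multiple α e of the edge and a normal part t. The tangential part follows from
  -- the values on the edge, the normal part from `normal`. Shape regularity gives |α| ≤ h/‖e‖ ≤ h/r
  -- ≤ σ.
  have grad : ∀ s ⊆ T, s.card = 2 → ∀ b : Space 3, ‖b‖ ≤ diameter T → ∀ y ∈ hull s,
      |pev (dirDeriv b p) y| ≤ K * M := by
    intro s hs hc b hb y hy
    have hw := hnum 1 s hs hc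
    obtain ⟨x, r, hr, hB, hσ⟩ := hball
    set e := num 1 s 1 - num 1 s 0 with he
    have hre : r ≤ ‖e‖ := radius_le_edge hT hind hr hB (hs (hw.mem 1)) (hs (hw.mem 0))
      fun h => by simpa using hw.injective h
    have he0 : 0 < ‖e‖ := hr.trans_le hre
    set α := inner ℝ b e / ‖e‖ ^ 2 with hα
    set t := b - α • e with ht
    have hte : inner ℝ t e = 0 := by
      rw [ht, inner_sub_left, inner_smul_left, real_inner_self_eq_norm_sq, hα]
      simp only [conj_trivial]
      field_simp
      ring
    have hts : ∀ x ∈ s, ∀ y ∈ s, inner ℝ t (x - y) = 0 := by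
      intro x hx y hy
      obtain ⟨i, rfl⟩ := hw.exists_eq hx
      obtain ⟨j, rfl⟩ := hw.exists_eq hy
      have h3 : inner ℝ t (num 1 s 0 - num 1 s 1) = 0 := by
        rw [← neg_sub, inner_neg_right, ← he, hte, neg_zero]
      fin_cases i <;> fin_cases j <;> simp only [Fin.zero_eta, Fin.mk_one, sub_self,
        inner_zero_right, h3]
      exact hte
    have hb' : b = α • e + t := by rw [ht]; abel
    have htb : ‖t‖ ≤ ‖b‖ := by
      have h3 : ‖b‖ * ‖b‖ = ‖α • e‖ * ‖α • e‖ + ‖t‖ * ‖t‖ := by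
        conv_lhs => rw [hb']
        refine norm_add_sq_eq_norm_sq_add_norm_sq_real ?_
        rw [inner_smul_left, real_inner_comm, hte, mul_zero]
      nlinarith [norm_nonneg t, norm_nonneg b, mul_self_nonneg ‖α • e‖]
    have hαs : |α| ≤ |σ| := by
      rw [hα, abs_div, abs_of_pos (pow_pos he0 2), div_le_iff₀ (pow_pos he0 2)]
      calc |inner ℝ b e| ≤ ‖b‖ * ‖e‖ := abs_real_inner_le_norm b e
        _ ≤ (|σ| * ‖e‖) * ‖e‖ := by
            refine mul_le_mul_of_nonneg_right (hb.trans (hσ.trans ?_)) he0.le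
            exact mul_le_mul (le_abs_self _) hre hr.le (abs_nonneg _)
        _ = |σ| * ‖e‖ ^ 2 := by ring
    have h3 : |pev (dirDeriv e p) y| ≤ C3 * (C1 * M) :=
      hC3 hw p hp (C1 * M) e1 (edge s hs hc) 0 y hy
    have h4 : |pev (dirDeriv t p) y| ≤ C2 * M := by
      refine le_of_mul_le_mul_norm hδ e3 (htb.trans hb) ((normal s hs hc t hts y hy).trans ?_)
      rw [mul_assoc]
    have h5 : pev (dirDeriv b p) y = α * pev (dirDeriv e p) y + pev (dirDeriv t p) y := by
      conv_lhs => rw [hb']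
      rw [dirDeriv_add, dirDeriv_smul, pev, map_add, smul_eval]
    rw [h5]
    calc _ ≤ |α| * |pev (dirDeriv e p) y| + |pev (dirDeriv t p) y| := by
          rw [← abs_mul]; exact abs_add_le _ _
      _ ≤ |σ| * (C3 * (C1 * M)) + C2 * M :=
          add_le_add (mul_le_mul hαs h3 (abs_nonneg _) (abs_nonneg _)) h4
      _ ≤ K * M := by rw [hMK]; linarith
  -- On a face, values and one transversal derivative on the boundary edges are needed; the latter
  -- is along an edge of the face, so `grad` covers it.
  have face : ∀ s ⊆ T, s.card = 3 → ∀ y ∈ hull s, |pev p y| ≤ C4 * (K * M) := by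
    intro s hs hc
    have hw := hnum 2 s hs hc
    refine hC4 hw p hp (K * M) (by positivity) (fun x hx j hj l hl => ?_)
      fun i => (hv 2 (by norm_num) (by norm_num) s hs hc i).trans (by rw [hMK]; linarith)
    have h3 := hw.param_mem_erase hx hj
    have h4 : (s.erase (num 2 s j)).card = 2 := by
      rw [Finset.card_erase_of_mem (hw.mem j), hc]
    have h5 := (Finset.erase_subset (num 2 s j) s).trans hs
    interval_cases l
    · exact (edge _ h5 h4 _ h3).trans (by rw [hMK]; linarith)
    · exact grad _ h5 h4 _ (hw.edge_le hs _ _) _ h3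
  have hw := hnum 3 T subset_rfl hT
  have e4 : 0 ≤ C4 * (K * M) := by positivity
  have hM1 : M ≤ (1 + C4 * K) * M := by nlinarith
  have hM2 : C4 * (K * M) ≤ (1 + C4 * K) * M := by nlinarith
  rw [mul_assoc]
  intro y hy
  refine hC5 hw p hp ((1 + C4 * K) * M) (by positivity) (fun x hx j hj l hl => ?_)
    (fun i => (hv 3 (by norm_num) le_rfl T subset_rfl hT i).trans hM1) y hy
  have hl' : l = 0 := by omega
  subst hl'
  refine (face (T.erase (num 3 T j)) (Finset.erase_subset _ _) ?_ _
    (hw.param_mem_erase hx hj)).trans hM2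
  rw [Finset.card_erase_of_mem (hw.mem j), hT]

/-! ### The energy of polynomials on an element -/

section cellForm

variable {d : ℕ}

/-- Integration of polynomials over a simplex. -/
noncomputable def cellInt (T : Finset (Space d)) : Poly d →ₗ[ℝ] ℝ where
  toFun p := ∫ y in hull T, pev p y
  map_add' p q := by
    simp only [pev, map_add]
    exact integral_add (integrableOn_pev p T) (integrableOn_pev q T)
  map_smul' c p := by
    simp only [pev, smul_eval, RingHom.id_apply, smul_eq_mul]
    exact integral_const_mul _ _

theorem cellInt_apply (T : Finset (Space d)) (p : Poly d) :
    cellInt T p = ∫ y in hull T, pev p y := rfl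

/-- The integrand of the energy. -/
noncomputable def energyDensity (lam : ℝ) : Poly d →ₗ[ℝ] Poly d →ₗ[ℝ] Poly d :=
  (∑ i, ∑ j, (LinearMap.mul ℝ (Poly d)).compl₁₂
      ((pderiv i).toLinearMap.comp (pderiv j).toLinearMap)
      ((pderiv i).toLinearMap.comp (pderiv j).toLinearMap))
    + (2 * lam) • (∑ i, (LinearMap.mul ℝ (Poly d)).compl₁₂
      (pderiv i).toLinearMap (pderiv i).toLinearMap)
    + (lam ^ 2) • LinearMap.mul ℝ (Poly d)

theorem energyDensity_apply (lam : ℝ) (p q : Poly d) : energyDensity lam p q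
    = (∑ i, ∑ j, pderiv i (pderiv j p) * pderiv i (pderiv j q))
      + (2 * lam) • (∑ i, pderiv i p * pderiv i q) + (lam ^ 2) • (p * q) := by
  simp only [energyDensity, LinearMap.add_apply, LinearMap.sum_apply, LinearMap.smul_apply,
    LinearMap.compl₁₂_apply, LinearMap.mul_apply', LinearMap.comp_apply]
  rfl

/-- The contribution of the element `T` to the energy. -/
noncomputable def cellForm (lam : ℝ) (T : Finset (Space d)) : LinearMap.BilinForm ℝ (Poly d) :=
  (energyDensity lam).compr₂ (cellInt T)

theorem cellForm_apply (lam : ℝ) (T : Finset (Space d)) (p q : Poly d) :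
    cellForm lam T p q
    = (∫ y in hull T, ∑ i, ∑ j, pev (pderiv i (pderiv j p)) y * pev (pderiv i (pderiv j q)) y)
      + 2 * lam * (∫ y in hull T, ∑ i, pev (pderiv i p) y * pev (pderiv i q) y)
      + lam ^ 2 * ∫ y in hull T, pev p y * pev q y := by
  rw [cellForm, LinearMap.compr₂_apply, energyDensity_apply]
  simp only [map_add, map_smul, smul_eq_mul, cellInt_apply]
  simp only [pev, map_sum, map_mul]

theorem cellForm_comm (lam : ℝ) (T : Finset (Space d)) (p q : Poly d) :
    cellForm lam T p q = cellForm lam T q p := by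
  have h : energyDensity lam p q = energyDensity lam q p := by
    rw [energyDensity_apply, energyDensity_apply]
    simp only [mul_comm]
  rw [cellForm, LinearMap.compr₂_apply, LinearMap.compr₂_apply, h]

theorem continuous_gradSq (p : Poly d) : Continuous fun y => ∑ i, pev (pderiv i p) y ^ 2 :=
  continuous_finsetSum _ fun _ _ => (continuous_pev _).pow 2

theorem cellForm_self (lam : ℝ) (T : Finset (Space d)) (p : Poly d) :
    cellForm lam T p p = (∫ y in hull T, hessSq p y)
      + 2 * lam * (∫ y in hull T, ∑ i, pev (pderiv i p) y ^ 2)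
      + lam ^ 2 * ∫ y in hull T, pev p y ^ 2 := by
  simp only [cellForm_apply, hessSq, sq (pev _ _)]

theorem integral_hessSq_nonneg (T : Finset (Space d)) (p : Poly d) :
    0 ≤ ∫ y in hull T, hessSq p y := integral_nonneg fun _ => hessSq_nonneg _ _

theorem integral_gradSq_nonneg (T : Finset (Space d)) (p : Poly d) :
    0 ≤ ∫ y in hull T, ∑ i, pev (pderiv i p) y ^ 2 :=
  integral_nonneg fun _ => Finset.sum_nonneg fun _ _ => sq_nonneg _

theorem integral_sq_nonneg (T : Finset (Space d)) (p : Poly d) :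
    0 ≤ ∫ y in hull T, pev p y ^ 2 := integral_nonneg fun _ => sq_nonneg _

theorem cellForm_self_nonneg {lam : ℝ} (hl : 0 ≤ lam) (T : Finset (Space d)) (p : Poly d) :
    0 ≤ cellForm lam T p p := by
  rw [cellForm_self]
  have := integral_hessSq_nonneg T p
  have := integral_gradSq_nonneg T p
  have := integral_sq_nonneg T p
  positivity

theorem cellForm_sq_le {lam : ℝ} (hl : 0 ≤ lam) (T : Finset (Space d)) (p q : Poly d) :
    cellForm lam T p q ^ 2 ≤ cellForm lam T p p * cellForm lam T q q :=
  LinearMap.BilinForm.apply_sq_le_of_symm (cellForm lam T) (cellForm_self_nonneg hl T)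
    ⟨fun p q => cellForm_comm lam T p q⟩ p q

theorem abs_le_sqrt_of_sq_mul_le {a V C I : ℝ} (hV : 0 < V) (h : a ^ 2 * V ≤ C * I) :
    |a| ≤ √(C * I / V) :=
  Real.abs_le_sqrt ((le_div_iff₀ hV).2 h)

theorem volume_hull_pos {T : Finset (Space d)} (hT : T.card = d + 1)
    (hs : AffineIndependent ℝ ((↑) : T → Space d)) : 0 < volume.real (hull T) := by
  obtain ⟨w, hw⟩ := exists_isNumbering hT
  obtain ⟨J, hJ, hint⟩ := exists_integral_eq (hw.affineIndependent hs) hw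
  have h2 : volume.real (hull T) = J * volume.real (refSimplex d) := by
    simpa [setIntegral_const] using hint fun _ => 1
  rw [h2]
  exact mul_pos hJ (ENNReal.toReal_pos (volume_refSimplex_pos d).ne' (volume_refSimplex_ne_top d))

theorem norm_unitVec (i : Fin d) : ‖(unitVec i : Space d)‖ = 1 := by simp [unitVec]

/-- Inverse estimate for the energy. -/
theorem exists_cellForm_le (d k : ℕ) (σ : ℝ) (hd : 1 ≤ d) : ∃ C : ℝ, 0 ≤ C ∧
    ∀ {T : Finset (Space d)},
    T.card = d + 1 → AffineIndependent ℝ ((↑) : T → Space d) → (∃ (x : Space d) (r : ℝ),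
      0 < r ∧ Metric.closedBall x r ⊆ hull T ∧ diameter T ≤ σ * r) →
    ∀ p : Poly d, p.totalDegree ≤ k → ∀ lam : ℝ, 0 ≤ lam →
      cellForm lam T p p
        ≤ C * (((diameter T ^ 2)⁻¹ + lam) ^ 2 * ∫ y in hull T, pev p y ^ 2) := by
  obtain ⟨C1, hC10, hC1⟩ := exists_inverse_bound d k σ
  obtain ⟨C2, hC20, hC2⟩ := exists_sq_le_setIntegral d k
  -- The second summand bounds the Hessian term (two inverse estimates), the third the gradient term
  -- (one), and the first the mass term.
  refine ⟨1 + d ^ 2 * C1 ^ 4 * C2 + d * C1 ^ 2 * C2, by positivity, ?_⟩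
  intro T hT hs hball p hp lam hl
  have hV := volume_hull_pos hT hs
  obtain ⟨w, hw⟩ := exists_isNumbering hT
  have hδ := hw.diameter_pos hd
  have hc := isCompact_hull T
  set V := volume.real (hull T) with hVdef
  set δ := diameter T with hδdef
  set I := ∫ y in hull T, pev p y ^ 2 with hI
  have hI0 : 0 ≤ I := integral_sq_nonneg T p
  set M := √(C2 * I / V) with hM
  have hM0 : 0 ≤ M := Real.sqrt_nonneg _
  have hM2 : M ^ 2 * V = C2 * I := by
    rw [hM, Real.sq_sqrt (by positivity)]; field_simp
  have h0 : ∀ y ∈ hull T, |pev p y| ≤ M := fun y hy =>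
    abs_le_sqrt_of_sq_mul_le hV (hC2 hT hs p hp y hy)
  have h1 : ∀ j, ∀ y ∈ hull T, |pev (pderiv j p) y| ≤ C1 * M / δ := fun j y hy => by
    have := hC1 hT hball p hp M hM0 h0 (unitVec j) y hy
    rw [norm_unitVec, mul_one, dirDeriv_unitVec] at this
    rw [le_div_iff₀ hδ, mul_comm]; exact this
  have h2 : ∀ i j, ∀ y ∈ hull T, |pev (pderiv i (pderiv j p)) y| ≤ C1 * (C1 * M / δ) / δ :=
    fun i j y hy => by
    have := hC1 hT hball (pderiv j p)
      ((totalDegree_pderiv_le j p).trans ((Nat.sub_le _ _).trans hp))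
      (C1 * M / δ) (by positivity) (h1 j) (unitVec i) y hy
    rw [norm_unitVec, mul_one, dirDeriv_unitVec] at this
    rw [le_div_iff₀ hδ, mul_comm]; exact this
  have hconst : ∀ c : ℝ, IntegrableOn (fun _ : Space d => c) (hull T) := fun c =>
    continuousOn_const.integrableOn_compact hc
  have i1 : ∫ y in hull T, ∑ i, pev (pderiv i p) y ^ 2 ≤ d * C1 ^ 2 * C2 * ((δ ^ 2)⁻¹ * I) := by
    have : ∫ y in hull T, ∑ i, pev (pderiv i p) y ^ 2
        ≤ ∫ _y in hull T, d * (C1 * M / δ) ^ 2 := by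
      refine setIntegral_mono_on ((continuous_gradSq p).continuousOn.integrableOn_compact hc)
        (hconst _) hc.measurableSet fun y hy => ?_
      calc _ ≤ ∑ _i : Fin d, (C1 * M / δ) ^ 2 := Finset.sum_le_sum fun i _ => by
            rw [← sq_abs]; exact pow_le_pow_left₀ (abs_nonneg _) (h1 i y hy) 2
        _ = _ := by simp
    rw [setIntegral_const, smul_eq_mul, ← hVdef] at this
    refine this.trans (le_of_eq ?_)
    calc _ = d * C1 ^ 2 * (δ ^ 2)⁻¹ * (M ^ 2 * V) := by field_simp
      _ = _ := by rw [hM2]; ring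
  have i2 : ∫ y in hull T, hessSq p y ≤ d ^ 2 * C1 ^ 4 * C2 * ((δ ^ 2)⁻¹ ^ 2 * I) := by
    have : ∫ y in hull T, hessSq p y ≤ ∫ _y in hull T, d ^ 2 * (C1 * (C1 * M / δ) / δ) ^ 2 := by
      refine setIntegral_mono_on ((continuous_hessSq p).continuousOn.integrableOn_compact hc)
        (hconst _) hc.measurableSet fun y hy => ?_
      calc _ ≤ ∑ _i : Fin d, ∑ _j : Fin d, (C1 * (C1 * M / δ) / δ) ^ 2 :=
            Finset.sum_le_sum fun i _ => Finset.sum_le_sum fun j _ => by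
              rw [← sq_abs]; exact pow_le_pow_left₀ (abs_nonneg _) (h2 i j y hy) 2
        _ = _ := by simp; ring
    rw [setIntegral_const, smul_eq_mul, ← hVdef] at this
    refine this.trans (le_of_eq ?_)
    calc _ = d ^ 2 * C1 ^ 4 * (δ ^ 2)⁻¹ ^ 2 * (M ^ 2 * V) := by field_simp
      _ = _ := by rw [hM2]; ring
  rw [cellForm_self, ← hI]
  set ρ := (δ ^ 2)⁻¹ with hρ
  have hρ0 : 0 ≤ ρ := by positivity
  have hA : 0 ≤ (d : ℝ) ^ 2 * C1 ^ 4 * C2 := by positivity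
  have hB : 0 ≤ (d : ℝ) * C1 ^ 2 * C2 := by positivity
  set A := (d : ℝ) ^ 2 * C1 ^ 4 * C2
  set B := (d : ℝ) * C1 ^ 2 * C2
  have i3 := mul_le_mul_of_nonneg_left i1 (by positivity : (0 : ℝ) ≤ 2 * lam)
  -- The three quantities are the surplus of the right-hand side after (ρ + λ)² is expanded.
  have j1 : 0 ≤ (1 + A) * (2 * lam * (ρ * I)) := by positivity
  have j2 : 0 ≤ (1 + B) * (ρ ^ 2 * I) := by positivity
  have j3 : 0 ≤ (A + B) * (lam ^ 2 * I) := by positivity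
  have e : (1 + A + B) * ((ρ + lam) ^ 2 * I) = A * (ρ ^ 2 * I) + 2 * lam * (B * (ρ * I))
      + lam ^ 2 * I + ((1 + A) * (2 * lam * (ρ * I)) + (1 + B) * (ρ ^ 2 * I)
      + (A + B) * (lam ^ 2 * I)) := by ring
  rw [e]
  linarith

/-- Uniform in λ because (ρ + λ)² ≤ 2ρ² + 2λ²: Poincaré absorbs the first part into the Hessian
term, the second is the mass term of the energy, and the gradient term is not needed. -/
theorem scaled_le_of_poincare {C lam δ S G I : ℝ} (hC : 0 ≤ C) (hl : 0 ≤ lam) (hδ : 0 < δ)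
    (hS : 0 ≤ S) (hG : 0 ≤ G) (hI : 0 ≤ I) (h : I ≤ C * δ ^ 4 * S) :
    ((δ ^ 2)⁻¹ + lam) ^ 2 * I ≤ (2 * C + 2) * (S + 2 * lam * G + lam ^ 2 * I) := by
  have h3 : (δ ^ 2)⁻¹ ^ 2 * I ≤ C * S := by
    have h4 : (δ ^ 2)⁻¹ ^ 2 * δ ^ 4 = 1 := by field_simp
    calc (δ ^ 2)⁻¹ ^ 2 * I ≤ (δ ^ 2)⁻¹ ^ 2 * (C * δ ^ 4 * S) :=
          mul_le_mul_of_nonneg_left h (sq_nonneg _)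
      _ = ((δ ^ 2)⁻¹ ^ 2 * δ ^ 4) * (C * S) := by ring
      _ = C * S := by rw [h4, one_mul]
  generalize (δ ^ 2)⁻¹ = ρ at *
  have e1 : (ρ + lam) ^ 2 * I = 2 * (ρ ^ 2 * I) + 2 * (lam ^ 2 * I) - (ρ - lam) ^ 2 * I := by ring
  have j1 := mul_nonneg (sq_nonneg (ρ - lam)) hI
  have j2 : 0 ≤ C * (lam ^ 2 * I) := by positivity
  have j3 : 0 ≤ (2 * C + 2) * (2 * lam * G) := by positivity
  have e : (2 * C + 2) * (S + 2 * lam * G + lam ^ 2 * I) = 2 * (C * S) + 2 * S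
      + (2 * C + 2) * (2 * lam * G) + 2 * (C * (lam ^ 2 * I)) + 2 * (lam ^ 2 * I) := by ring
  rw [e]
  linarith

/-- The energy controls the scaled `L²` norm of polynomials with a first-order zero at a vertex. -/
theorem exists_le_cellForm (d k : ℕ) (hd : 1 ≤ d) : ∃ C : ℝ, 0 ≤ C ∧ ∀ {T : Finset (Space d)},
    T.card = d + 1 → AffineIndependent ℝ ((↑) : T → Space d) →
    ∀ p : Poly d, p.totalDegree ≤ k → ∀ z ∈ T, pev p z = 0 → (∀ t, pev (dirDeriv t p) z = 0) →
    ∀ lam : ℝ, 0 ≤ lam →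
      ((diameter T ^ 2)⁻¹ + lam) ^ 2 * (∫ y in hull T, pev p y ^ 2) ≤ C * cellForm lam T p p := by
  obtain ⟨C, hC0, hC⟩ := exists_poincare d k
  refine ⟨2 * C + 2, by positivity, fun {T} hT hs p hp z hz h0 h1 lam hl => ?_⟩
  obtain ⟨w, hw⟩ := exists_isNumbering hT
  rw [cellForm_self]
  exact scaled_le_of_poincare hC0 hl (hw.diameter_pos hd) (integral_hessSq_nonneg T p)
    (integral_gradSq_nonneg T p) (integral_sq_nonneg T p) (hC hT hs p hp z hz h0 h1)

end cellForm

/-! ### Triangulations -/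

theorem IsConvexPolytope.isOpen {d : ℕ} {Ω : Set (Space d)} (h : IsConvexPolytope Ω) :
    IsOpen Ω := by
  obtain ⟨-, S, rfl⟩ := h
  exact isOpen_interior

theorem IsConvexPolytope.convex {d : ℕ} {Ω : Set (Space d)} (h : IsConvexPolytope Ω) :
    Convex ℝ Ω := by
  obtain ⟨-, S, rfl⟩ := h
  exact (convex_convexHull ℝ _).interior

namespace Mesh

variable {d : ℕ} {Ω : Set (Space d)} {M : Mesh d Ω} {T T' s : Finset (Space d)}

theorem mem_faces_of_mem_cells (hT : T ∈ M.cells) : T ∈ M.faces :=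
  M.finite.mem_toFinset.1 (Finset.mem_filter.1 hT).1

theorem card_of_mem_cells (hT : T ∈ M.cells) : T.card = d + 1 := (Finset.mem_filter.1 hT).2

theorem indep_of_mem_cells (hT : T ∈ M.cells) : AffineIndependent ℝ ((↑) : T → Space d) :=
  M.complex.indep (mem_faces_of_mem_cells hT)

theorem mem_faces_of_subset (hT : T ∈ M.cells) (hs : s ⊆ T) (hne : s.Nonempty) : s ∈ M.faces :=
  M.complex.down_closed (mem_faces_of_mem_cells hT) hs hne

theorem singleton_mem_faces (hT : T ∈ M.cells) {z : Space d} (hz : z ∈ T) : {z} ∈ M.faces :=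
  mem_faces_of_subset hT (Finset.singleton_subset_iff.2 hz) (Finset.singleton_nonempty z)

theorem exists_cell (hs : s ∈ M.faces) : ∃ T ∈ M.cells, s ⊆ T := by
  obtain ⟨T, hT, hsT, hc⟩ := M.pure s hs
  exact ⟨T, Finset.mem_filter.2 ⟨M.finite.mem_toFinset.2 hT, hc⟩, hsT⟩

theorem card_le (hs : s ∈ M.faces) : s.card ≤ d + 1 := by
  obtain ⟨T, hT, hsT⟩ := exists_cell hs
  exact (Finset.card_le_card hsT).trans (card_of_mem_cells hT).le

theorem hull_subset (hT : T ∈ M.cells) : hull T ⊆ closure Ω := by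
  rw [← M.space_eq]
  exact M.complex.convexHull_subset_space (mem_faces_of_mem_cells hT)

theorem exists_mem_hull {x : Space d} (hx : x ∈ closure Ω) : ∃ T ∈ M.cells, x ∈ hull T := by
  rw [← M.space_eq, Geometry.SimplicialComplex.mem_space_iff] at hx
  obtain ⟨s, hs, hx⟩ := hx
  obtain ⟨T, hT, hsT⟩ := exists_cell hs
  exact ⟨T, hT, hull_mono hsT hx⟩

theorem closure_eq_iUnion : closure Ω = ⋃ T : M.cells, hull (T : Finset (Space d)) := by
  ext x
  rw [Set.mem_iUnion]
  constructor
  · intro hx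
    obtain ⟨T, hT, hx⟩ := exists_mem_hull (M := M) hx
    exact ⟨⟨T, hT⟩, hx⟩
  · rintro ⟨T, hx⟩
    exact hull_subset T.2 hx

/-- In a simplicial complex the intersection lies in the hull of the common vertices. Distinct
elements share at most d of them, which span a proper affine subspace. -/
theorem volume_inter_eq_zero (hT : T ∈ M.cells) (hT' : T' ∈ M.cells) (h : T ≠ T') :
    volume (hull T ∩ hull T') = 0 := by
  classical
  have h1 : hull T ∩ hull T' ⊆ affineSpan ℝ ((T ∩ T' : Finset (Space d)) : Set (Space d)) := by
    refine (M.complex.inter_subset_convexHull (mem_faces_of_mem_cells hT)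
      (mem_faces_of_mem_cells hT')).trans ?_
    rw [Finset.coe_inter]
    exact convexHull_subset_affineSpan _
  refine measure_mono_null h1 (Measure.addHaar_affineSubspace _ _ fun htop => ?_)
  have hlt : (T ∩ T').card < T.card := by
    refine Finset.card_lt_card
      (Finset.ssubset_iff_subset_ne.2 ⟨Finset.inter_subset_left, fun he => ?_⟩)
    have h2 : T ⊆ T' := by rw [← he]; exact Finset.inter_subset_right
    exact h (Finset.eq_of_subset_of_card_le h2
      ((card_of_mem_cells hT').trans (card_of_mem_cells hT).symm).le)
  have hind : AffineIndependent ℝ ((↑) : (T ∩ T' : Finset (Space d)) → Space d) :=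
    AffineIndependent.mono (t := (T : Set (Space d))) (indep_of_mem_cells hT)
      (Finset.coe_subset.2 Finset.inter_subset_left)
  have h3 := hind.affineSpan_eq_top_iff_card_eq_finrank_add_one.1 (by
    have : Set.range ((↑) : (T ∩ T' : Finset (Space d)) → Space d)
        = ((T ∩ T' : Finset (Space d)) : Set (Space d)) := Subtype.range_coe
    rw [this]; exact htop)
  rw [Fintype.card_coe, finrank_euclideanSpace_fin] at h3
  have := card_of_mem_cells hT
  omega

/-- The elements cover the closure and overlap in null sets; the boundary of a convex set is a null
set. -/
theorem setIntegral_eq_sum (M : Mesh d Ω) (hc : Convex ℝ Ω) {f : Space d → ℝ}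
    (hf : ∀ T ∈ M.cells, IntegrableOn f (hull T)) :
    ∫ x in Ω, f x = ∑ T ∈ M.cells, ∫ x in hull T, f x := by
  have h1 : (closure Ω : Set (Space d)) =ᵐ[volume] Ω := by
    refine closure_ae_eq_of_null_frontier (hc.addHaar_frontier _)
  rw [← setIntegral_congr_set h1, closure_eq_iUnion (M := M), integral_iUnion_ae]
  · rw [tsum_fintype]
    exact Finset.sum_coe_sort M.cells fun T => ∫ x in hull T, f x
  · exact fun T => (isCompact_hull _).measurableSet.nullMeasurableSet
  · intro T T' hTT'
    exact volume_inter_eq_zero T.2 T'.2 fun h => hTT' (Subtype.ext h)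
  · exact integrableOn_finite_iUnion.2 fun T => hf T T.2

/-- A segment in the closure of the domain starts inside one of the elements. -/
theorem exists_initial_segment {x y : Space d} (h : segment ℝ x y ⊆ closure Ω) :
    ∃ T ∈ M.cells, x ∈ hull T ∧ ∃ ε : ℝ, 0 < ε ∧ ε ≤ 1 ∧ x + ε • (y - x) ∈ hull T := by
  set u : ℕ → ℝ := fun n => 1 / ((n : ℝ) + 1) with hu
  have hu1 : ∀ n, 0 < u n ∧ u n ≤ 1 := fun n => by
    refine ⟨by simp only [hu]; positivity, ?_⟩
    simp only [hu]
    rw [div_le_one (by positivity)]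
    linarith [(Nat.cast_nonneg n : (0 : ℝ) ≤ n)]
  have hlim : Tendsto (fun n => x + u n • (y - x)) atTop (𝓝 x) := by
    have h1 : Tendsto u atTop (𝓝 0) := tendsto_one_div_add_atTop_nhds_zero_nat
    have h2 := (h1.smul_const (y - x)).const_add x
    simpa using h2
  have hmem : ∀ n, ∃ T ∈ M.cells, x + u n • (y - x) ∈ hull T := fun n => by
    refine exists_mem_hull (h ?_)
    rw [segment_eq_image']
    exact ⟨u n, ⟨(hu1 n).1.le, (hu1 n).2⟩, rfl⟩
  -- Points of the segment converging to x are distributed over finitely many elements. One element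
  -- contains infinitely many of them, and contains x because it is closed.
  obtain ⟨T, hT, hfreq⟩ : ∃ T ∈ M.cells, ∃ᶠ n in atTop, x + u n • (y - x) ∈ hull T := by
    by_contra! hcon
    have h1 : ∀ T ∈ M.cells, ∀ᶠ n in atTop, x + u n • (y - x) ∉ hull T := hcon
    have h2 := (Filter.eventually_all_finset M.cells).2 h1
    obtain ⟨n, hn⟩ := h2.exists
    obtain ⟨T, hT, hx⟩ := hmem n
    exact hn T hT hx
  refine ⟨T, hT, ?_, ?_⟩
  · exact (isCompact_hull T).isClosed.mem_of_frequently_of_tendsto hfreq hlim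
  · obtain ⟨n, hn⟩ := hfreq.exists
    exact ⟨u n, (hu1 n).1, (hu1 n).2, hn⟩

end Mesh

/-! ### Finite element functions as piecewise polynomials -/

section feSpace

variable {d k : ℕ} {Ω : Set (Space d)} {M : Mesh d Ω} {T T' s : Finset (Space d)}

theorem eq_zero_of_hull (hT : T ∈ M.cells) {p : Poly d} (h : ∀ y ∈ hull T, pev p y = 0) :
    p = 0 := by
  obtain ⟨w, hw⟩ := exists_isNumbering (Mesh.card_of_mem_cells hT)
  have hind := hw.affineIndependent (Mesh.indep_of_mem_cells hT)
  have h1 : pull w p = 0 := eq_zero_of_refSimplex fun x hx => by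
    rw [eval_pull]; exact h _ (hw.param_mem hx)
  refine MvPolynomial.funext fun y => ?_
  obtain ⟨x, hx⟩ := (edgeEquiv hind).surjective (WithLp.toLp 2 y - w 0)
  have h2 : param w x = WithLp.toLp 2 y := by rw [param_eq_edgeEquiv hind, hx]; abel
  have h3 := eval_pull w p x
  rw [h1, map_zero, h2] at h3
  rw [map_zero]
  exact h3.symm

theorem eq_of_hull (hT : T ∈ M.cells) {p q : Poly d} (h : ∀ y ∈ hull T, pev p y = pev q y) :
    p = q :=
  sub_eq_zero.1 (eq_zero_of_hull hT fun y hy => by rw [pev, map_sub, sub_eq_zero]; exact h y hy)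

theorem exists_cellPoly (v : feSpace M k) (T : Finset (Space d)) : ∃ p : Poly d,
    T ∈ M.cells → p.totalDegree ≤ k ∧ ∀ x ∈ hull T, (v : Space d → ℝ) x = pev p x := by
  by_cases hT : T ∈ M.cells
  · obtain ⟨p, hp⟩ := v.2.2.2.1 T hT
    exact ⟨p, fun _ => hp⟩
  · exact ⟨0, fun h => absurd h hT⟩

/-- The polynomial that represents `v` on the element `T`. -/
noncomputable def cellPoly (v : feSpace M k) (T : Finset (Space d)) : Poly d :=
  (exists_cellPoly v T).choose

theorem totalDegree_cellPoly (v : feSpace M k) (hT : T ∈ M.cells) :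
    (cellPoly v T).totalDegree ≤ k := ((exists_cellPoly v T).choose_spec hT).1

theorem eq_cellPoly (v : feSpace M k) (hT : T ∈ M.cells) :
    ∀ x ∈ hull T, (v : Space d → ℝ) x = pev (cellPoly v T) x :=
  ((exists_cellPoly v T).choose_spec hT).2

theorem cellPoly_sum {ι : Type*} (t : Finset ι) (c : ι → ℝ) (φ : ι → feSpace M k)
    (hT : T ∈ M.cells) :
    cellPoly (∑ i ∈ t, c i • φ i) T = ∑ i ∈ t, c i • cellPoly (φ i) T := by
  refine eq_of_hull hT fun y hy => ?_
  rw [← eq_cellPoly _ hT y hy, pev, map_sum]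
  simp only [smul_eval, Submodule.coe_sum, Submodule.coe_smul, Finset.sum_apply, Pi.smul_apply,
    smul_eq_mul]
  exact Finset.sum_congr rfl fun i _ => by rw [eq_cellPoly _ hT y hy]

theorem derivOn_one_cellPoly (v : feSpace M k) (hT : T ∈ M.cells) {x : Space d} (hx : x ∈ hull T)
    (t : Fin 1 → Space d) :
    derivOn 1 (v : Space d → ℝ) T x t = pev (dirDeriv (t 0) (cellPoly v T)) x :=
  derivOn_one_apply (M.uniqueDiffOn hT) (eq_cellPoly v hT) hx t

theorem derivOn_two_cellPoly (v : feSpace M k) (hT : T ∈ M.cells) {x : Space d} (hx : x ∈ hull T)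
    (t : Fin 2 → Space d) :
    derivOn 2 (v : Space d → ℝ) T x t
      = pev (dirDeriv (t 0) (dirDeriv (t 1) (cellPoly v T))) x :=
  derivOn_two_apply (M.uniqueDiffOn hT) (eq_cellPoly v hT) hx t

/-- In the interior of an element, v agrees with its polynomial on a neighbourhood; the boundary of
the element is a null set. -/
theorem ae_gradient_eq (v : feSpace M k) (hT : T ∈ M.cells) :
    ∀ᵐ x ∂(volume.restrict (hull T)),
      gradient (v : Space d → ℝ) x = polyGrad (cellPoly v T) x := by
  have h1 : ∀ᵐ x ∂(volume.restrict (interior (hull T))),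
      gradient (v : Space d → ℝ) x = polyGrad (cellPoly v T) x := by
    refine ae_restrict_of_forall_mem isOpen_interior.measurableSet fun x hx => ?_
    refine gradient_eq_polyGrad ?_
    filter_upwards [isOpen_interior.mem_nhds hx] with y hy
    exact eq_cellPoly v hT y (interior_subset hy)
  have h2 : (interior (hull T) : Set (Space d)) =ᵐ[volume] hull T :=
    interior_ae_eq_of_null_frontier ((convex_convexHull ℝ _).addHaar_frontier _)
  rwa [Measure.restrict_congr_set h2] at h1

theorem inner_polyGrad_polyGrad (p q : Poly d) (x : Space d) :
    inner ℝ (polyGrad p x) (polyGrad q x) = ∑ i, pev (pderiv i p) x * pev (pderiv i q) x := by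
  rw [inner_polyGrad, dirDeriv_eq_sum, pev, map_sum]
  exact Finset.sum_congr rfl fun i _ => by rw [smul_eval, mul_comm]; rfl

theorem energy_eq_sum (hc : Convex ℝ Ω) (lam : ℝ) (w v : feSpace M k) :
    energy M lam w v = ∑ T ∈ M.cells, cellForm lam T (cellPoly w T) (cellPoly v T) := by
  have h1 : ∀ T ∈ M.cells, ∀ᵐ x ∂(volume.restrict (hull T)),
      inner ℝ (gradient (w : Space d → ℝ) x) (gradient (v : Space d → ℝ) x)
        = ∑ i, pev (pderiv i (cellPoly w T)) x * pev (pderiv i (cellPoly v T)) x := by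
    intro T hT
    filter_upwards [ae_gradient_eq w hT, ae_gradient_eq v hT] with x hx hx'
    rw [hx, hx', inner_polyGrad_polyGrad]
  have h2 : ∀ T ∈ M.cells, ∀ x ∈ hull T, (w : Space d → ℝ) x * (v : Space d → ℝ) x
      = pev (cellPoly w T) x * pev (cellPoly v T) x := fun T hT x hx => by
    rw [eq_cellPoly w hT x hx, eq_cellPoly v hT x hx]
  have i1 : ∀ T : Finset (Space d), IntegrableOn (fun x =>
      ∑ i, pev (pderiv i (cellPoly w T)) x * pev (pderiv i (cellPoly v T)) x) (hull T) := fun T =>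
    (continuous_finsetSum _ fun i _ => (continuous_pev _).mul
      (continuous_pev _)).continuousOn.integrableOn_compact (isCompact_hull T)
  have i2 : ∀ T : Finset (Space d), IntegrableOn (fun x =>
      pev (cellPoly w T) x * pev (cellPoly v T) x) (hull T) := fun T =>
    ((continuous_pev _).mul (continuous_pev _)).continuousOn.integrableOn_compact (isCompact_hull T)
  rw [energy, M.setIntegral_eq_sum hc fun T hT =>
      (i1 T).congr ((h1 T hT).mono fun x hx => hx.symm),
    M.setIntegral_eq_sum hc fun T hT =>
      (i2 T).congr_fun (fun x hx => (h2 T hT x hx).symm) (isCompact_hull T).measurableSet,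
    Finset.mul_sum, Finset.mul_sum, ← Finset.sum_add_distrib, ← Finset.sum_add_distrib]
  refine Finset.sum_congr rfl fun T hT => ?_
  rw [cellForm_apply]
  congr 1
  · congr 1
    · refine setIntegral_congr_fun (isCompact_hull T).measurableSet fun x hx => ?_
      refine Finset.sum_congr rfl fun i _ => Finset.sum_congr rfl fun j _ => ?_
      rw [derivOn_two_cellPoly w hT hx, derivOn_two_cellPoly v hT hx]
      simp [dirDeriv_unitVec]
    · congr 1
      exact integral_congr_ae (h1 T hT)
  · congr 1
    exact setIntegral_congr_fun (isCompact_hull T).measurableSet (h2 T hT)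

theorem weightedL2_eq_sum (lam : ℝ) (v : feSpace M k) :
    weightedL2 M lam v = ∑ T ∈ M.cells,
      ((diameter T ^ 2)⁻¹ + lam) ^ 2 * ∫ y in hull T, pev (cellPoly v T) y ^ 2 := by
  refine Finset.sum_congr rfl fun T hT => ?_
  congr 1
  refine setIntegral_congr_fun (isCompact_hull T).measurableSet fun x hx => ?_
  simp only [eq_cellPoly v hT x hx]

/-! ### Behaviour at the boundary -/

theorem eq_zero_of_notMem (v : feSpace M k) {x : Space d} (hx : x ∉ Ω) :
    (v : Space d → ℝ) x = 0 := v.2.2.1 x hx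

theorem eq_zero_of_mem_frontier (ho : IsOpen Ω) (v : feSpace M k) {x : Space d}
    (hx : x ∈ frontier Ω) : (v : Space d → ℝ) x = 0 := by
  refine eq_zero_of_notMem v fun h => ?_
  rw [ho.frontier_eq] at hx
  exact hx.2 h

theorem smoothAt_vertex (hd : d = 2 ∨ d = 3) (v : feSpace M k) {z : Space d} (hz : {z} ∈ M.faces) :
    SmoothAt M 1 (v : Space d → ℝ) z := by
  obtain ⟨-, -, -, h2, h3⟩ := v.2
  rcases hd with hd | hd
  · exact h2 hd z hz
  · exact fun T hT T' hT' hx hx' j hj => (h3 hd).2 z hz T hT T' hT' hx hx' j (hj.trans one_le_two)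

theorem dirDeriv_eq_of_smoothAt {v : feSpace M k} {x : Space d}
    (h : SmoothAt M 1 (v : Space d → ℝ) x) (hT : T ∈ M.cells) (hT' : T' ∈ M.cells)
    (hx : x ∈ hull T) (hx' : x ∈ hull T') (t : Space d) :
    pev (dirDeriv t (cellPoly v T)) x = pev (dirDeriv t (cellPoly v T')) x := by
  have h1 := h T hT T' hT' hx hx' 1 le_rfl
  have h2 := derivOn_one_cellPoly v hT hx ![t]
  have h3 := derivOn_one_cellPoly v hT' hx' ![t]
  simp only [Matrix.cons_val_zero] at h2 h3
  rw [← h2, ← h3, h1]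

theorem dirDeriv_dirDeriv_eq_of_smoothAt {v : feSpace M k} {x : Space d}
    (h : SmoothAt M 2 (v : Space d → ℝ) x) (hT : T ∈ M.cells) (hT' : T' ∈ M.cells)
    (hx : x ∈ hull T) (hx' : x ∈ hull T') (t u : Space d) :
    pev (dirDeriv t (dirDeriv u (cellPoly v T))) x
      = pev (dirDeriv t (dirDeriv u (cellPoly v T'))) x := by
  have h1 := h T hT T' hT' hx hx' 2 le_rfl
  have h2 := derivOn_two_cellPoly v hT hx ![t, u]
  have h3 := derivOn_two_cellPoly v hT' hx' ![t, u]
  simp only [Matrix.cons_val_zero, Matrix.cons_val_one] at h2 h3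
  rw [← h2, ← h3, h1]

/-- An initial piece of the segment lies in a single element. The univariate polynomial that v
induces there vanishes on an interval, hence identically, together with its derivatives at x. -/
theorem exists_dirDeriv_eq_zero (v : feSpace M k) {x y : Space d}
    (h : segment ℝ x y ⊆ closure Ω) (hv : ∀ u ∈ segment ℝ x y, (v : Space d → ℝ) u = 0) :
    ∃ T ∈ M.cells, x ∈ hull T ∧ pev (dirDeriv (y - x) (cellPoly v T)) x = 0 ∧
      pev (dirDeriv (y - x) (dirDeriv (y - x) (cellPoly v T))) x = 0 := by
  obtain ⟨T, hT, hx, ε, hε, hε1, hy⟩ := M.exists_initial_segment h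
  refine ⟨T, hT, hx, ?_⟩
  set p := cellPoly v T
  set w : Fin 2 → Space d := ![x, y] with hw
  have hpar : ∀ c : Fin 1 → ℝ, param w c = x + c 0 • (y - x) := fun c => by
    rw [param_eq]; simp [hw]
  have h0 : pull w p = 0 := by
    refine funext_set (fun _ => Set.Icc 0 ε) (fun _ => Set.Icc_infinite hε) fun c hc => ?_
    have hc' := hc 0 (Set.mem_univ _)
    rw [map_zero, eval_pull, hpar]
    have hmem : x + c 0 • (y - x) ∈ hull T := by
      have h1 := (convex_convexHull ℝ (T : Set (Space d))).add_smul_sub_mem hx hy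
        (t := c 0 / ε) ⟨div_nonneg hc'.1 hε.le, (div_le_one hε).2 hc'.2⟩
      have h2 : (c 0 / ε) • (x + ε • (y - x) - x) = c 0 • (y - x) := by
        rw [add_sub_cancel_left, smul_smul, div_mul_cancel₀ _ hε.ne']
      rw [h2] at h1
      exact h1
    rw [← eq_cellPoly v hT _ hmem]
    refine hv _ ?_
    rw [segment_eq_image']
    exact ⟨c 0, ⟨hc'.1, hc'.2.trans hε1⟩, rfl⟩
  have hd1 : w (Fin.succ 0) - w 0 = y - x := by simp [hw]
  have hw0 : w 0 = x := by simp [hw]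
  have h1 := pderiv_pull w p 0
  rw [h0, map_zero, hd1] at h1
  have h2 := pderiv_pull w (dirDeriv (y - x) p) 0
  rw [← h1, map_zero, hd1] at h2
  constructor
  · have := congrArg (eval 0) h1
    rw [eval_pull, param_zero, map_zero, hw0] at this
    exact this.symm
  · have := congrArg (eval 0) h2
    rw [eval_pull, param_zero, map_zero, hw0] at this
    exact this.symm

/-- The element that contains the start of a boundary segment from z need not be T; continuity of
first derivatives at the vertex carries the vanishing derivative over to T. -/
theorem polyGrad_mem_gradSpace (ho : IsOpen Ω) (hd : d = 2 ∨ d = 3) (v : feSpace M k)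
    (hT : T ∈ M.cells) {z : Space d} (hz : z ∈ T) :
    polyGrad (cellPoly v T) z ∈ gradSpace Ω z := by
  intro y hy
  obtain ⟨T', hT', hz', h1, -⟩ := exists_dirDeriv_eq_zero v (hy.trans frontier_subset_closure)
    fun u hu => eq_zero_of_mem_frontier ho v (hy hu)
  rw [inner_polyGrad, dirDeriv_eq_of_smoothAt
    (smoothAt_vertex hd v (Mesh.singleton_mem_faces hT hz)) hT hT' (mem_hull_of_mem hz) hz', h1]

/-- The Hessian of a polynomial at a point. -/
noncomputable def polyHess (p : Poly d) (x : Space d) : LinearMap.BilinForm ℝ (Space d) :=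
  LinearMap.mk₂ ℝ (fun a b => pev (dirDeriv a (dirDeriv b p)) x)
    (fun a a' b => by rw [dirDeriv_add, pev, map_add])
    (fun c a b => by rw [dirDeriv_smul, pev, smul_eval]; rfl)
    (fun a b b' => by rw [dirDeriv_add, map_add, pev, map_add])
    (fun c a b => by rw [dirDeriv_smul, Derivation.map_smul, pev, smul_eval]; rfl)

theorem polyHess_apply (p : Poly d) (x a b : Space d) :
    polyHess p x a b = pev (dirDeriv a (dirDeriv b p)) x := rfl

theorem polyHess_mem_hessSpace (ho : IsOpen Ω) (hd : d = 3) (v : feSpace M k)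
    (hT : T ∈ M.cells) {z : Space d} (hz : z ∈ T) :
    polyHess (cellPoly v T) z ∈ hessSpace Ω z := by
  refine ⟨fun a b => by rw [polyHess_apply, polyHess_apply, dirDeriv_comm], fun y hy => ?_⟩
  obtain ⟨T', hT', hz', -, h1⟩ := exists_dirDeriv_eq_zero v (hy.trans frontier_subset_closure)
    fun u hu => eq_zero_of_mem_frontier ho v (hy hu)
  rw [polyHess_apply, dirDeriv_dirDeriv_eq_of_smoothAt
    ((v.2.2.2.2.2 hd).2 z (Mesh.singleton_mem_faces hT hz)) hT hT' (mem_hull_of_mem hz) hz', h1]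

end feSpace

/-! ### Frames -/

section frame

variable {d n : ℕ} {κ : ℝ}

/-- The components map onto ℝⁿ already from J, so n cannot exceed the ambient dimension. This bounds
the number of degrees of freedom per subsimplex. -/
theorem IsGradFrame.card_le {J : Set (Space d)} {t : Fin n → Space d} (h : IsGradFrame J κ t) :
    n ≤ d := by
  let L : Space d →ₗ[ℝ] (Fin n → ℝ) := LinearMap.pi fun i => (innerₗ (Space d)) (t i)
  have hL : Function.Surjective L := fun c => by
    obtain ⟨g, -, hg⟩ := h.2.1 c
    refine ⟨g, funext fun i => ?_⟩
    rw [← hg i, real_inner_comm]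
    rfl
  simpa using LinearMap.finrank_le_finrank_of_surjective hL

theorem IsHessFrame.card_le {J : Set (LinearMap.BilinForm ℝ (Space d))}
    {t : Fin n → Fin 2 → Space d} (h : IsHessFrame J κ t) : n ≤ d ^ 2 := by
  let L : LinearMap.BilinForm ℝ (Space d) →ₗ[ℝ] (Fin n → ℝ) :=
    LinearMap.pi fun i => (LinearMap.applyₗ (t i 1)).comp (LinearMap.applyₗ (t i 0))
  have hL : Function.Surjective L := fun c => by
    obtain ⟨H, -, hH⟩ := h.2.1 c
    exact ⟨H, funext fun i => hH i⟩
  have := LinearMap.finrank_le_finrank_of_surjective hL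
  rw [Module.finrank_linearMap, Module.finrank_linearMap] at this
  simpa [sq] using this

theorem sum_sq_le {f : Fin n → ℝ} {A : ℝ} (h : ∀ i, |f i| ≤ A) : ∑ i, f i ^ 2 ≤ n * A ^ 2 := by
  calc ∑ i, f i ^ 2 ≤ ∑ _i : Fin n, A ^ 2 := Finset.sum_le_sum fun i _ => by
        rw [← sq_abs]; exact pow_le_pow_left₀ (abs_nonneg _) (h i) 2
    _ = n * A ^ 2 := by simp

theorem frame_bound {f : Fin n → ℝ} {A B : ℝ} (hn : n ≤ d ^ 2) (h : ∀ i, |f i| ≤ A)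
    (hB : B ≤ κ * ∑ i, f i ^ 2) : B ≤ |κ| * d ^ 2 * A ^ 2 := by
  have h1 : (n : ℝ) ≤ (d : ℝ) ^ 2 := by exact_mod_cast hn
  have h0 : 0 ≤ ∑ i, f i ^ 2 := Finset.sum_nonneg fun i _ => sq_nonneg _
  calc B ≤ |κ| * ∑ i, f i ^ 2 := hB.trans (mul_le_mul_of_nonneg_right (le_abs_self κ) h0)
    _ ≤ |κ| * (d ^ 2 * A ^ 2) := mul_le_mul_of_nonneg_left
        ((sum_sq_le h).trans (mul_le_mul_of_nonneg_right h1 (sq_nonneg A))) (abs_nonneg κ)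
    _ = _ := by ring

/-- The constant in the estimates by frames. -/
noncomputable def frameConst (d : ℕ) (κ : ℝ) : ℝ := √(|κ| * d ^ 2)

theorem frameConst_nonneg : 0 ≤ frameConst d κ := Real.sqrt_nonneg _

theorem frameConst_sq : frameConst d κ ^ 2 = |κ| * d ^ 2 := Real.sq_sqrt (by positivity)

theorem IsGradFrame.norm_le {J : Set (Space d)} {t : Fin n → Space d} (h : IsGradFrame J κ t)
    {g : Space d} (hg : g ∈ J) {A : ℝ} (hA : 0 ≤ A) (hgt : ∀ i, |inner ℝ g (t i)| ≤ A) :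
    ‖g‖ ≤ frameConst d κ * A := by
  have hn : n ≤ d ^ 2 := h.card_le.trans (Nat.le_self_pow (by norm_num) d)
  have h1 := frame_bound hn hgt (h.2.2 g hg)
  rw [← frameConst_sq, ← mul_pow] at h1
  exact (pow_le_pow_iff_left₀ (norm_nonneg g) (mul_nonneg frameConst_nonneg hA) two_ne_zero).1 h1

end frame

/-! ### Evaluation of degrees of freedom -/

section dof

variable {d k : ℕ} {Ω : Set (Space d)} {M : Mesh d Ω} {P : DofPattern d k} {κ : ℝ}

namespace DofIndex

variable {S : DofChoice M P κ}

/-- The subsimplex at which a degree of freedom is located. -/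
def simplex : DofIndex S → Finset (Space d)
  | .vertexValue z _ _ => {z}
  | .vertexGrad z _ _ => {z}
  | .vertexHess _ z _ _ => {z}
  | .faceValue _ _ s _ _ _ _ => s
  | .edgeNormal _ s _ _ _ _ => s

/-- The order of the derivative in a degree of freedom. -/
def order : DofIndex S → ℕ
  | .vertexValue _ _ _ => 0
  | .vertexGrad _ _ _ => 1
  | .vertexHess _ _ _ _ => 2
  | .faceValue _ _ _ _ _ _ _ => 0
  | .edgeNormal _ _ _ _ _ _ => 1

/-- The value of a degree of freedom on a polynomial. -/
noncomputable def polyEval : DofIndex S → Poly d → ℝ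
  | .vertexValue z _ _, p => pev p z
  | .vertexGrad z _ i, p => pev (dirDeriv (S.gradDir z i) p) z
  | .vertexHess _ z _ i, p => pev (dirDeriv (S.hessDir z i 0) (dirDeriv (S.hessDir z i 1) p)) z
  | .faceValue m _ s _ _ _ a, p => (P.val m a).average (pull (S.num m s) p)
  | .edgeNormal _ s _ _ a i, p =>
      (P.edge a).average (pull (S.num 1 s) (dirDeriv (S.normalDir s i) p))

end DofIndex

variable {S : DofChoice M P κ}

theorem DofChoice.isNumbering (S : DofChoice M P κ) {m : ℕ} {s : Finset (Space d)}
    (hs : s ∈ M.faces) (hc : s.card = m + 1) : IsNumbering (S.num m s) s :=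
  ⟨hc, (S.num_spec m s hs hc).1, (S.num_spec m s hs hc).2⟩

theorem sum_smul_sum_smul {m j : ℕ} (D : Fin (j + 1) → Fin (m + 1) → ℝ)
    (w : Fin (m + 1) → Space d) (c : Fin (j + 1) → ℝ) :
    ∑ l, c l • ∑ i, D l i • w i = ∑ i, (∑ l, c l • D l) i • w i := by
  simp only [Finset.smul_sum, smul_smul, Finset.sum_apply, Pi.smul_apply, smul_eq_mul,
    Finset.sum_smul]
  exact Finset.sum_comm

theorem RefDomain.average_pull {m : ℕ} (D : RefDomain m) (w : Fin (m + 1) → Space d) (p : Poly d)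
    {f : Space d → ℝ} (h : ∀ x ∈ refSimplex m, f (param w x) = pev p (param w x)) :
    simplexAverage (fun l => ∑ j, D.pts l j • w j) f = D.average (pull w p) := by
  rw [RefDomain.average]
  refine simplexAverage_congr fun s hs => ?_
  rw [eval_pull, ← h _ (D.point_mem hs), param, D.bary_point, sum_smul_sum_smul]

/-- Derivatives are taken from `S.cell`, but the smoothness conditions of the space at vertices and
edges make them agree with those from any element that contains the subsimplex. -/
theorem eval_dof_eq (hd : d = 2 ∨ d = 3) (v : feSpace M k) {T : Finset (Space d)}
    (hT : T ∈ M.cells) (i : DofIndex S) (hi : i.simplex ⊆ T) :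
    (S.dof i).eval (v : Space d → ℝ) = i.polyEval (cellPoly v T) := by
  have cell : ∀ s ∈ M.faces, S.cell s ∈ M.cells ∧ hull s ⊆ hull (S.cell s) := fun s hs =>
    ⟨(S.cell_spec s hs).1, hull_mono (S.cell_spec s hs).2⟩
  have hz : ∀ z : Space d, z ∈ hull {z} := fun z => mem_hull_of_mem (Finset.mem_singleton_self z)
  cases i with
  | vertexValue z hz1 hz2 =>
    simp only [DofChoice.dof, Dof.eval, simplexAverage_const, DofIndex.polyEval]
    exact eq_cellPoly v hT z (hull_mono hi (hz z))
  | vertexGrad z hz1 i =>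
    simp only [DofChoice.dof, Dof.eval, simplexAverage_const, DofIndex.polyEval]
    obtain ⟨h1, h2⟩ := cell {z} hz1
    refine (derivOn_one_cellPoly v h1 (h2 (hz z)) ![S.gradDir z i]).trans ?_
    exact dirDeriv_eq_of_smoothAt (smoothAt_vertex hd v hz1) h1 hT (h2 (hz z))
      (hull_mono hi (hz z)) _
  | vertexHess hd3 z hz1 i =>
    simp only [DofChoice.dof, Dof.eval, simplexAverage_const, DofIndex.polyEval]
    obtain ⟨h1, h2⟩ := cell {z} hz1
    refine (derivOn_two_cellPoly v h1 (h2 (hz z)) (S.hessDir z i)).trans ?_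
    exact dirDeriv_dirDeriv_eq_of_smoothAt ((v.2.2.2.2.2 hd3).2 z hz1) h1 hT (h2 (hz z))
      (hull_mono hi (hz z)) _ _
  | faceValue m hm s hs hc hb a =>
    simp only [DofChoice.dof, Dof.eval, DofIndex.polyEval]
    refine (P.val m a).average_pull _ _ fun x hx => ?_
    exact eq_cellPoly v hT _ (hull_mono hi ((S.isNumbering hs hc).param_mem hx))
  | edgeNormal hd3 s hs hc a i =>
    simp only [DofChoice.dof, Dof.eval, DofIndex.polyEval]
    refine (P.edge a).average_pull _ _ fun x hx => ?_
    obtain ⟨h1, h2⟩ := cell s hs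
    have hx' := (S.isNumbering (m := 1) hs hc).param_mem hx
    refine (derivOn_one_cellPoly v h1 (h2 hx') ![S.normalDir s i]).trans ?_
    exact dirDeriv_eq_of_smoothAt ((v.2.2.2.2.2 hd3).1 s hs hc _ hx') h1 hT (h2 hx')
      (hull_mono hi hx') _

/-- Degrees of freedom are bounded by the maximum norm. -/
theorem exists_polyEval_bound (d k : ℕ) (σ : ℝ) : ∃ C : ℝ, 0 ≤ C ∧
    ∀ {Ω : Set (Space d)} {M : Mesh d Ω} {P : DofPattern d k} {κ : ℝ} {S : DofChoice M P κ}
      {T : Finset (Space d)}, T ∈ M.cells → (∃ (x : Space d) (r : ℝ),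
      0 < r ∧ Metric.closedBall x r ⊆ hull T ∧ diameter T ≤ σ * r) →
    ∀ p : Poly d, p.totalDegree ≤ k → ∀ A : ℝ, 0 ≤ A → (∀ y ∈ hull T, |pev p y| ≤ A) →
    ∀ i : DofIndex S, i.simplex ⊆ T → diameter T ^ i.order * |i.polyEval p| ≤ C * A := by
  obtain ⟨C, hC0, hC⟩ := exists_inverse_bound d k σ
  refine ⟨1 + C + C ^ 2, by positivity, ?_⟩
  intro Ω M P κ S T hT hball p hp A hA h i hi
  have hcard := Mesh.card_of_mem_cells hT
  set δ := diameter T with hδdef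
  have hδ0 : 0 ≤ δ := Metric.diam_nonneg
  have hCA : 0 ≤ C * A := by positivity
  have hCCA : 0 ≤ C ^ 2 * A := by positivity
  have e : (1 + C + C ^ 2) * A = A + C * A + C ^ 2 * A := by ring
  have one : ∀ t : Space d, ‖t‖ = 1 → ∀ y ∈ hull T, δ * |pev (dirDeriv t p) y| ≤ C * A :=
    fun t ht y hy => by simpa [ht] using hC hcard hball p hp A hA h t y hy
  -- The inverse estimate is applied to the scaled polynomial δ ∂_u p, which `one` has just bounded.
  have two : ∀ t u : Space d, ‖t‖ = 1 → ‖u‖ = 1 → ∀ y ∈ hull T,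
      δ ^ 2 * |pev (dirDeriv t (dirDeriv u p)) y| ≤ C ^ 2 * A := by
    intro t u ht hu y hy
    have h1 := hC hcard hball (δ • dirDeriv u p)
      ((totalDegree_smul_le _ _).trans
        ((totalDegree_dirDeriv_le _ _).trans ((Nat.sub_le _ _).trans hp))) (C * A) hCA
      (fun y hy => by
        rw [pev, smul_eval, abs_mul, abs_of_nonneg hδ0]; exact one u hu y hy) t y hy
    rw [Derivation.map_smul, pev, smul_eval, abs_mul, abs_of_nonneg hδ0, ht] at h1
    calc _ = δ * (δ * |pev (dirDeriv t (dirDeriv u p)) y|) := by ring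
      _ ≤ C * (C * A) * 1 := h1
      _ = _ := by ring
  cases i with
  | vertexValue z hz1 hz2 =>
    simp only [DofIndex.order, DofIndex.polyEval, pow_zero, one_mul]
    have := h z (hull_mono hi (mem_hull_of_mem (Finset.mem_singleton_self z)))
    rw [e]; linarith
  | vertexGrad z hz1 i =>
    simp only [DofIndex.order, DofIndex.polyEval, pow_one]
    have := one _ ((S.grad_frame z hz1).1 i) z
      (hull_mono hi (mem_hull_of_mem (Finset.mem_singleton_self z)))
    rw [e]; linarith
  | vertexHess hd3 z hz1 i =>
    simp only [DofIndex.order, DofIndex.polyEval]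
    have := two _ _ ((S.hess_frame hd3 z hz1).1 i 0) ((S.hess_frame hd3 z hz1).1 i 1) z
      (hull_mono hi (mem_hull_of_mem (Finset.mem_singleton_self z)))
    rw [e]; linarith
  | faceValue m hm s hs hc hb a =>
    simp only [DofIndex.order, DofIndex.polyEval, pow_zero, one_mul]
    have : |(P.val m a).average (pull (S.num m s) p)| ≤ A :=
      RefDomain.abs_average_le _ fun x hx => by
        rw [eval_pull]; exact h _ (hull_mono hi ((S.isNumbering hs hc).param_mem hx))
    rw [e]; linarith
  | edgeNormal hd3 s hs hc a i =>
    simp only [DofIndex.order, DofIndex.polyEval, pow_one]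
    have hw := S.isNumbering (m := 1) hs hc
    have h1 : δ * |(P.edge a).average (pull (S.num 1 s) (dirDeriv (S.normalDir s i) p))|
        = |(P.edge a).average (δ • pull (S.num 1 s) (dirDeriv (S.normalDir s i) p))| := by
      rw [← RefDomain.averageₗ_apply, ← RefDomain.averageₗ_apply, map_smul, smul_eq_mul, abs_mul,
        abs_of_nonneg hδ0]
    have : δ * |(P.edge a).average (pull (S.num 1 s) (dirDeriv (S.normalDir s i) p))| ≤ C * A := by
      rw [h1]
      refine RefDomain.abs_average_le _ fun x hx => ?_
      rw [smul_eval, eval_pull, abs_mul, abs_of_nonneg hδ0]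
      exact one _ ((S.normal_frame hd3 s hs hc).1.1 i) _ (hull_mono hi (hw.param_mem hx))
    rw [e]; linarith

/-- The number of degrees of freedom of an element is bounded. -/
theorem exists_card_bound (P : DofPattern d k) (κ : ℝ) : ∃ K : ℕ,
    ∀ {Ω : Set (Space d)} {M : Mesh d Ω} (S : DofChoice M P κ) {T : Finset (Space d)},
      T ∈ M.cells → ∀ t : Finset (DofIndex S), (∀ i ∈ t, i.simplex ⊆ T) → t.card ≤ K := by
  classical
  set B := 1 + d ^ 2 + P.nEdge + ∑ m ∈ Finset.range (d + 1), P.nVal m with hB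
  refine ⟨5 * (2 ^ (d + 1) * (B * B)), fun {Ω M} S {T} hT t ht => ?_⟩
  -- A label is encoded by its kind, its subsimplex and two numbers below B. The dimension m need
  -- not be recorded: it is read off from the cardinality of s.
  let code : DofIndex S → ℕ × Finset (Space d) × ℕ × ℕ := fun i => match i with
    | .vertexValue z _ _ => (0, {z}, 0, 0)
    | .vertexGrad z _ i => (1, {z}, i, 0)
    | .vertexHess _ z _ i => (2, {z}, i, 0)
    | .faceValue _ _ s _ _ _ a => (3, s, a, 0)
    | .edgeNormal _ s _ _ a i => (4, s, a, i)
  have hinj : Function.Injective code := by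
    intro i j hij
    cases i <;> cases j <;> simp only [code, Prod.mk.injEq, Finset.singleton_inj] at hij <;>
      first
        | (exfalso; have h0 := hij.1; omega)
        | skip
    · obtain ⟨-, rfl, -⟩ := hij; rfl
    · obtain ⟨-, rfl, h, -⟩ := hij
      rw [Fin.val_inj] at h; rw [h]
    · obtain ⟨-, rfl, h, -⟩ := hij
      rw [Fin.val_inj] at h; rw [h]
    · rename_i m _ s _ hc _ a m' _ s' _ hc' _ a'
      obtain ⟨-, rfl, h, -⟩ := hij
      obtain rfl : m = m' := by omega
      rw [Fin.val_inj] at h; rw [h]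
    · obtain ⟨-, rfl, h, h'⟩ := hij
      rw [Fin.val_inj] at h h'; rw [h, h']
  have hmem : ∀ i ∈ t, code i ∈
      Finset.range 5 ×ˢ T.powerset ×ˢ Finset.range B ×ˢ Finset.range B := by
    intro i hi
    have hs := ht i hi
    have hB0 : 0 < B := by rw [hB]; omega
    have hdd : d ≤ d ^ 2 := Nat.le_self_pow (by norm_num) d
    have hN0 : 0 ≤ ∑ m ∈ Finset.range (d + 1), P.nVal m := Nat.zero_le _
    simp only [Finset.mem_product, Finset.mem_range, Finset.mem_powerset]
    cases i with
    | vertexValue z hz1 hz2 => exact ⟨by norm_num, hs, hB0, hB0⟩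
    | vertexGrad z hz1 i =>
      have h1 := i.2
      have h2 := (S.grad_frame z hz1).card_le
      exact ⟨by norm_num, hs, by simp only [code]; omega, hB0⟩
    | vertexHess hd3 z hz1 i =>
      have h1 := i.2
      have h2 := (S.hess_frame hd3 z hz1).card_le
      exact ⟨by norm_num, hs, by simp only [code]; omega, hB0⟩
    | faceValue m hm s hsf hc hb a =>
      have h1 := a.2
      have h2 := Mesh.card_le hsf
      have h3 : P.nVal m ≤ ∑ m ∈ Finset.range (d + 1), P.nVal m :=
        Finset.single_le_sum (f := P.nVal) (fun _ _ => Nat.zero_le _)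
          (Finset.mem_range.2 (by omega))
      exact ⟨by norm_num, hs, by simp only [code]; omega, hB0⟩
    | edgeNormal hd3 s hsf hc a i =>
      have h1 := a.2
      have h2 := i.2
      have h3 := (S.normal_frame hd3 s hsf hc).1.card_le
      exact ⟨by norm_num, hs, by simp only [code]; omega, by simp only [code]; omega⟩
  have h := Finset.card_le_card_of_injOn code hmem hinj.injOn
  rw [Finset.card_product, Finset.card_product, Finset.card_product, Finset.card_powerset,
    Finset.card_range, Finset.card_range, Mesh.card_of_mem_cells hT] at h
  exact h

end dof

/-! ### Edges at the boundary -/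

section edge

variable {d k : ℕ} {Ω : Set (Space d)} {M : Mesh d Ω}

theorem IsNumbering.centroid_eq {w : Fin 2 → Space d} {s : Finset (Space d)}
    (hw : IsNumbering w s) : s.centroid ℝ id = (2⁻¹ : ℝ) • (w 0 + w 1) := by
  classical
  have hs : s = {w 0, w 1} := by
    rw [← Finset.coe_inj, ← hw.range_eq]
    ext x
    simp [Fin.exists_fin_two, eq_comm]
  rw [hs, Finset.centroid_pair]
  simp only [id, vsub_eq_sub, vadd_eq_add]
  module

/-- The trace and the tangential derivatives on an edge in a boundary facet vanish. -/
theorem pull_eq_zero_of_segment_subset (ho : IsOpen Ω) (hc : Convex ℝ Ω) (hd : d = 3)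
    (v : feSpace M k) {T s : Finset (Space d)} (hT : T ∈ M.cells) (hsT : s ⊆ T)
    {w : Fin 2 → Space d} (hw : IsNumbering (m := 1) w s) {y : Space d}
    (hy : segment ℝ (s.centroid ℝ id) y ⊆ frontier Ω) :
    pull w (cellPoly v T) = 0 ∧
      pull w (dirDeriv (y - s.centroid ℝ id) (cellPoly v T)) = 0 := by
  have hs : s ∈ M.faces := Mesh.mem_faces_of_subset hT hsT ⟨_, hw.mem 0⟩
  rw [hw.centroid_eq] at hy ⊢
  set c := (2⁻¹ : ℝ) • (w 0 + w 1) with hcdef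
  -- The midpoint of c and y lies on the boundary, so a functional f separates it from the convex
  -- set Ω.
  have hm : midpoint ℝ c y ∉ Ω := by
    have := hy (midpoint_mem_segment c y)
    rw [ho.frontier_eq] at this
    exact this.2
  obtain ⟨f, hf⟩ := geometric_hahn_banach_open_point hc ho hm
  set μ := f (midpoint ℝ c y) with hμ
  have hcl : ∀ a ∈ closure Ω, f a ≤ μ := fun a ha =>
    closure_minimal (t := {a | f a ≤ μ}) (fun a ha => (hf a ha).le)
      (isClosed_le f.continuous continuous_const) ha
  have hv : ∀ u, f u = μ → (v : Space d → ℝ) u = 0 := fun u hu =>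
    eq_zero_of_notMem v fun h => (hf u h).ne hu
  have hwc : ∀ i, w i ∈ closure Ω := fun i => Mesh.hull_subset hT (mem_hull_of_mem (hsT (hw.mem i)))
  have hyc : y ∈ closure Ω := frontier_subset_closure (hy (right_mem_segment ℝ c y))
  have hμ' : μ = 2⁻¹ * (2⁻¹ * (f (w 0) + f (w 1)) + f y) := by
    rw [hμ, midpoint_eq_smul_add, hcdef]
    simp only [map_smul, map_add, smul_eq_mul, invOf_eq_inv]
  have h0 := hcl _ (hwc 0)
  have h1 := hcl _ (hwc 1)
  have h2 := hcl _ hyc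
  -- The midpoint is a convex combination of w 0, w 1 and y with weights 1/4, 1/4, 1/2. As f ≤ μ at
  -- all three points, all lie in the supporting hyperplane f = μ, which misses Ω; so v vanishes on
  -- it.
  have e0 : f (w 0) = μ := by linarith
  have e1 : f (w 1) = μ := by linarith
  have e2 : f y = μ := by linarith
  have ec : f c = μ := by rw [hcdef]; simp [e0, e1]; ring
  have hpar : ∀ x : Fin 1 → ℝ, param w x = w 0 + x 0 • (w 1 - w 0) := fun x => by
    rw [param_eq]; simp
  have hfpar : ∀ x : Fin 1 → ℝ, f (param w x) = μ := fun x => by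
    rw [hpar]; simp [e0, e1]
  refine ⟨eq_zero_of_refSimplex fun x hx => ?_, eq_zero_of_refBox fun x hx => ?_⟩
  · rw [eval_pull, ← eq_cellPoly v hT _ (hull_mono hsT (hw.param_mem hx))]
    exact hv _ (hfpar x)
  -- From the edge point with parameter θ, move by θ (y - c). For θ < 1/2 the end point stays in the
  -- triangle w 0, w 1, y, hence in the closure, and the segment stays in the hyperplane. Since θ >
  -- 0, it can be cancelled from the resulting derivative; a box inside the edge suffices to
  -- identify the polynomial.
  · have hx' := refBox_subset 1 hx
    obtain ⟨hθ0, hθ1⟩ : 0 < x 0 ∧ x 0 < 1 / 2 := by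
      have := hx 0 (Set.mem_univ 0)
      norm_num at this
      exact this
    set θ := x 0
    have hxs := hw.param_mem hx'
    have hxc : param w x ∈ closure Ω := Mesh.hull_subset hT (hull_mono hsT hxs)
    have hyc' : param w x + θ • (y - c) ∈ closure Ω := by
      have : param w x + θ • (y - c)
          = ∑ i, (![1 - 3 * θ / 2, θ / 2, θ] i) • (![w 0, w 1, y] : Fin 3 → Space d) i := by
        rw [hpar, hcdef, Fin.sum_univ_three]
        simp only [Matrix.cons_val_zero, Matrix.cons_val_one, Matrix.cons_val]
        module
      rw [this]
      refine hc.closure.sum_mem (fun i _ => ?_) ?_ fun i _ => ?_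
      · fin_cases i <;> simp <;> linarith
      · rw [Fin.sum_univ_three]; simp; ring
      · fin_cases i
        · exact hwc 0
        · exact hwc 1
        · exact hyc
    obtain ⟨T', hT', hxT', hz, -⟩ := exists_dirDeriv_eq_zero v
      (hc.closure.segment_subset hxc hyc') fun u hu => by
        refine hv u ?_
        obtain ⟨a, b, -, -, hab, rfl⟩ := hu
        simp only [map_add, map_smul, map_sub, hfpar, e2, ec, smul_eq_mul]
        linear_combination μ * hab
    rw [add_sub_cancel_left, dirDeriv_smul, pev, smul_eval] at hz
    rw [eval_pull, dirDeriv_eq_of_smoothAt ((v.2.2.2.2.2 hd).1 s hs hw.card _ hxs) hT hT'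
      (hull_mono hsT hxs) hxT']
    exact (mul_eq_zero.1 hz).resolve_left hθ0.ne'

variable {P : DofPattern d k} {κ : ℝ} {S : DofChoice M P κ}

/-- The normal derivatives on an edge are controlled by the degrees of freedom. -/
theorem abs_average_dirDeriv_le (ho : IsOpen Ω) (hc : Convex ℝ Ω) (hd : d = 3)
    (v : feSpace M k) {T s : Finset (Space d)} (hT : T ∈ M.cells) (hsT : s ⊆ T)
    (hcard : s.card = 2) (a : Fin P.nEdge) {A : ℝ} (hA : 0 ≤ A)
    (h : ∀ i, |(P.edge a).average (pull (S.num 1 s)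
      (dirDeriv (S.normalDir s i) (cellPoly v T)))| ≤ A)
    {t : Space d} (ht : ∀ x ∈ s, ∀ y ∈ s, inner ℝ t (x - y) = 0) :
    |(P.edge a).average (pull (S.num 1 s) (dirDeriv t (cellPoly v T)))|
      ≤ frameConst d κ * A * ‖t‖ := by
  have hs : s ∈ M.faces := Mesh.mem_faces_of_subset hT hsT (Finset.card_pos.1 (by omega))
  have hw := S.isNumbering (m := 1) hs hcard
  obtain ⟨hframe, hperp⟩ := S.normal_frame hd s hs hcard
  set w := S.num 1 s
  set p := cellPoly v T
  set L := (P.edge a).averageₗ with hL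
  -- Averaging is linear, so the averaged derivatives of p are the components of one vector G. Its
  -- part normal to the edge belongs to the space on which the normal directions form a frame.
  set G : Space d := WithLp.toLp 2 fun i => L (pull w (pderiv i p)) with hG
  have inner_G : ∀ u : Space d, inner ℝ G u = L (pull w (dirDeriv u p)) := fun u => by
    rw [dirDeriv_eq_sum, map_sum, map_sum]
    simp only [map_smul, smul_eq_mul, hG, PiLp.inner_apply]
    exact Finset.sum_congr rfl fun i _ => by simp
  set e := w 1 - w 0 with he
  have he0 : inner ℝ e e ≠ (0 : ℝ) := by
    rw [inner_self_ne_zero, he, sub_ne_zero]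
    exact fun h => by simpa using hw.injective h
  set G' : Space d := G - (inner ℝ G e / inner ℝ e e) • e with hG'
  have hG'e : inner ℝ G' e = 0 := by
    rw [hG', inner_sub_left, inner_smul_left]
    simp only [conj_trivial]
    field_simp
    ring
  have hmem : G' ∈ edgeSpace Ω s := by
    refine ⟨fun y hy => ?_, fun x hx y hy => ?_⟩
    · obtain ⟨h1, h2⟩ := pull_eq_zero_of_segment_subset ho hc hd v hT hsT hw hy
      -- The trace vanishes along a boundary edge, so G is already normal to it.
      have h3 : inner ℝ G e = 0 := by
        have := pderiv_pull w p 0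
        rw [h1, map_zero] at this
        rw [inner_G, he]
        exact (congrArg L this.symm).trans (map_zero L)
      rw [hG', h3, zero_div, zero_smul, sub_zero, inner_G, h2, map_zero]
    · obtain ⟨i, rfl⟩ := hw.exists_eq hx
      obtain ⟨j, rfl⟩ := hw.exists_eq hy
      fin_cases i <;> fin_cases j
      · simp
      · have : w 0 - w 1 = -e := by rw [he]; abel
        simp only [Fin.zero_eta, Fin.mk_one]
        rw [this, inner_neg_right, hG'e, neg_zero]
      · exact hG'e
      · simp
  have eq : ∀ u : Space d, inner ℝ e u = 0 → inner ℝ G' u = inner ℝ G u := fun u hu => by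
    rw [hG', inner_sub_left, inner_smul_left, hu, mul_zero, sub_zero]
  have h1 := hframe.norm_le hmem hA fun i => by
    rw [eq _ (by rw [real_inner_comm]; exact hperp i _ (hw.mem 1) _ (hw.mem 0)), inner_G]
    exact h i
  rw [← RefDomain.averageₗ_apply, ← inner_G,
    ← eq t (by rw [real_inner_comm]; exact ht _ (hw.mem 1) _ (hw.mem 0))]
  exact (abs_real_inner_le_norm _ _).trans (mul_le_mul_of_nonneg_right h1 (norm_nonneg _))

end edge

/-! ### Local bounds by the degrees of freedom -/

section local_bound

variable {d k : ℕ} {Ω : Set (Space d)} {M : Mesh d Ω} {P : DofPattern d k} {κ : ℝ}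
  {S : DofChoice M P κ} {T : Finset (Space d)}

theorem abs_dirDeriv_vertex_le (ho : IsOpen Ω) (hd : d = 2 ∨ d = 3) (S : DofChoice M P κ)
    (v : feSpace M k) (hT : T ∈ M.cells) {z : Space d} (hz : z ∈ T) {A : ℝ} (hA : 0 ≤ A)
    (h : ∀ i, |pev (dirDeriv (S.gradDir z i) (cellPoly v T)) z| ≤ A) (t : Space d) :
    |pev (dirDeriv t (cellPoly v T)) z| ≤ frameConst d κ * A * ‖t‖ := by
  have h1 := (S.grad_frame z (Mesh.singleton_mem_faces hT hz)).norm_le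
    (polyGrad_mem_gradSpace ho hd v hT hz) hA fun i => by rw [inner_polyGrad]; exact h i
  rw [← inner_polyGrad]
  exact (abs_real_inner_le_norm _ _).trans (mul_le_mul_of_nonneg_right h1 (norm_nonneg _))

theorem abs_dirDeriv_dirDeriv_vertex_le (ho : IsOpen Ω) (hd : d = 3) (S : DofChoice M P κ)
    (v : feSpace M k) (hT : T ∈ M.cells) {z : Space d} (hz : z ∈ T) {A : ℝ} (hA : 0 ≤ A)
    (h : ∀ i, |pev (dirDeriv (S.hessDir z i 0) (dirDeriv (S.hessDir z i 1) (cellPoly v T))) z| ≤ A)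
    (t u : Space d) :
    |pev (dirDeriv t (dirDeriv u (cellPoly v T))) z| ≤ frameConst d κ * A * (‖t‖ * ‖u‖) := by
  have hframe := S.hess_frame hd z (Mesh.singleton_mem_faces hT hz)
  have h1 := hframe.2.2 _ (polyHess_mem_hessSpace ho hd v hT hz)
  simp only [polyHess_apply, dirDeriv_unitVec] at h1
  have h2 : hessSq (cellPoly v T) z ≤ (frameConst d κ * A) ^ 2 := by
    rw [mul_pow, frameConst_sq]
    exact frame_bound hframe.card_le h h1
  refine abs_le_of_sq_le_sq ((sq_dirDeriv_dirDeriv_le _ t u z).trans ?_)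
    (mul_nonneg (mul_nonneg frameConst_nonneg hA) (by positivity))
  calc ‖t‖ ^ 2 * ‖u‖ ^ 2 * hessSq (cellPoly v T) z
      ≤ ‖t‖ ^ 2 * ‖u‖ ^ 2 * (frameConst d κ * A) ^ 2 := mul_le_mul_of_nonneg_left h2 (by positivity)
    _ = _ := by ring

theorem abs_vertex_le (v : feSpace M k) (hT : T ∈ M.cells) {z : Space d} (hz : z ∈ T) {A : ℝ}
    (hA : 0 ≤ A) (h : z ∈ Ω → |pev (cellPoly v T) z| ≤ A) : |pev (cellPoly v T) z| ≤ A := by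
  by_cases hzΩ : z ∈ Ω
  · exact h hzΩ
  · rw [← eq_cellPoly v hT z (mem_hull_of_mem hz), eq_zero_of_notMem v hzΩ, abs_zero]
    exact hA

/-- A subsimplex in the boundary carries no value degrees of freedom, but there the trace, and with
it the average, is zero. -/
theorem abs_average_face_le (ho : IsOpen Ω) (S : DofChoice M P κ) (v : feSpace M k)
    (hT : T ∈ M.cells) {A : ℝ} (hA : 0 ≤ A)
    (h : ∀ i : DofIndex S, i.simplex ⊆ T → diameter T ^ i.order * |i.polyEval (cellPoly v T)| ≤ A)
    {m : ℕ} (hm : 1 ≤ m) {s : Finset (Space d)} (hsT : s ⊆ T) (hc : s.card = m + 1)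
    (a : Fin (P.nVal m)) : |(P.val m a).average (pull (S.num m s) (cellPoly v T))| ≤ A := by
  have hs : s ∈ M.faces := Mesh.mem_faces_of_subset hT hsT (Finset.card_pos.1 (by omega))
  by_cases hb : hull s ⊆ frontier Ω
  · have h0 : pull (S.num m s) (cellPoly v T) = 0 := eq_zero_of_refSimplex fun x hx => by
      have hx' := (S.isNumbering hs hc).param_mem hx
      rw [eval_pull, ← eq_cellPoly v hT _ (hull_mono hsT hx'),
        eq_zero_of_mem_frontier ho v (hb hx')]
    rw [h0, ← RefDomain.averageₗ_apply, map_zero, abs_zero]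
    exact hA
  · have := h (.faceValue m hm s hs hc hb a) hsT
    simpa only [DofIndex.order, DofIndex.polyEval, pow_zero, one_mul] using this

/-- The local bounds ask for values, full derivatives and averages, also at the boundary. Frames
recover the derivatives from the chosen directions, and the zero trace replaces what is missing; the
factor 1 + c covers data taken directly and data recovered through a frame. -/
theorem exists_cellPoly_bound (hd : d = 2 ∨ d = 3) (P : DofPattern d k) (σ κ : ℝ) :
    ∃ C : ℝ, 0 ≤ C ∧ ∀ {Ω : Set (Space d)} {M : Mesh d Ω} {S : DofChoice M P κ}
      {T : Finset (Space d)}, IsOpen Ω → Convex ℝ Ω → T ∈ M.cells → (∃ (x : Space d) (r : ℝ),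
      0 < r ∧ Metric.closedBall x r ⊆ hull T ∧ diameter T ≤ σ * r) →
    ∀ v : feSpace M k, ∀ A : ℝ, 0 ≤ A → (∀ i : DofIndex S, i.simplex ⊆ T →
      diameter T ^ i.order * |i.polyEval (cellPoly v T)| ≤ A) →
    ∀ y ∈ hull T, |pev (cellPoly v T) y| ≤ C * A := by
  set c := frameConst d κ with hc
  have hc0 : 0 ≤ c := frameConst_nonneg
  have main : ∀ {Ω : Set (Space d)} {M : Mesh d Ω} {S : DofChoice M P κ}
      {T : Finset (Space d)}, IsOpen Ω → Convex ℝ Ω → T ∈ M.cells →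
      ∀ v : feSpace M k, ∀ A : ℝ, 0 ≤ A → (∀ i : DofIndex S, i.simplex ⊆ T →
        diameter T ^ i.order * |i.polyEval (cellPoly v T)| ≤ A) →
      (∀ x ∈ T, |pev (cellPoly v T) x| ≤ (1 + c) * A) ∧
      (∀ x ∈ T, ∀ t, diameter T * |pev (dirDeriv t (cellPoly v T)) x| ≤ (1 + c) * A * ‖t‖) ∧
      (d = 3 → ∀ x ∈ T, ∀ t u, diameter T ^ 2 * |pev (dirDeriv t (dirDeriv u (cellPoly v T))) x|
        ≤ (1 + c) * A * (‖t‖ * ‖u‖)) ∧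
      (∀ m, 1 ≤ m → ∀ s ⊆ T, s.card = m + 1 → ∀ a,
        |(P.val m a).average (pull (S.num m s) (cellPoly v T))| ≤ (1 + c) * A) ∧
      (d = 3 → ∀ s ⊆ T, s.card = 2 → ∀ a t, (∀ x ∈ s, ∀ y ∈ s, inner ℝ t (x - y) = 0) →
        diameter T * |(P.edge a).average (pull (S.num 1 s) (dirDeriv t (cellPoly v T)))|
          ≤ (1 + c) * A * ‖t‖) := by
    intro Ω M S T ho hconv hT v A hA h
    obtain ⟨w, hw⟩ := exists_isNumbering (Mesh.card_of_mem_cells hT)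
    have hδ : 0 < diameter T := hw.diameter_pos (by omega)
    set δ := diameter T
    have hAδ : 0 ≤ A / δ := by positivity
    have hAδ2 : 0 ≤ A / δ ^ 2 := by positivity
    have hle : A ≤ (1 + c) * A := by nlinarith
    have hle' : c * A ≤ (1 + c) * A := by nlinarith
    have fin1 : ∀ {b r : ℝ}, 0 ≤ r → b ≤ c * (A / δ) * r → δ * b ≤ (1 + c) * A * r :=
      fun {b r} hr hb => calc
        δ * b ≤ δ * (c * (A / δ) * r) := mul_le_mul_of_nonneg_left hb hδ.le
        _ = c * A * r := by field_simp
        _ ≤ _ := mul_le_mul_of_nonneg_right hle' hr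
    have fin2 : ∀ {b r : ℝ}, 0 ≤ r → b ≤ c * (A / δ ^ 2) * r → δ ^ 2 * b ≤ (1 + c) * A * r :=
      fun {b r} hr hb => calc
        δ ^ 2 * b ≤ δ ^ 2 * (c * (A / δ ^ 2) * r) := mul_le_mul_of_nonneg_left hb (by positivity)
        _ = c * A * r := by field_simp
        _ ≤ _ := mul_le_mul_of_nonneg_right hle' hr
    refine ⟨fun x hx => ?_, fun x hx t => ?_, fun hd3 x hx t u => ?_, fun m hm s hs hcard a => ?_,
      fun hd3 s hs hcard a t ht => ?_⟩
    · refine (abs_vertex_le v hT hx hA fun hxΩ => ?_).trans hle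
      simpa only [DofIndex.order, DofIndex.polyEval, pow_zero, one_mul] using
        h (.vertexValue x (Mesh.singleton_mem_faces hT hx) hxΩ)
          (Finset.singleton_subset_iff.2 hx)
    · refine fin1 (norm_nonneg t) (abs_dirDeriv_vertex_le ho hd S v hT hx hAδ (fun i => ?_) t)
      rw [le_div_iff₀ hδ, mul_comm]
      simpa only [DofIndex.order, DofIndex.polyEval, pow_one] using
        h (.vertexGrad x (Mesh.singleton_mem_faces hT hx) i) (Finset.singleton_subset_iff.2 hx)
    · refine fin2 (by positivity)
        (abs_dirDeriv_dirDeriv_vertex_le ho hd3 S v hT hx hAδ2 (fun i => ?_) t u)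
      rw [le_div_iff₀ (by positivity), mul_comm]
      simpa only [DofIndex.order, DofIndex.polyEval] using
        h (.vertexHess hd3 x (Mesh.singleton_mem_faces hT hx) i) (Finset.singleton_subset_iff.2 hx)
    · exact (abs_average_face_le ho S v hT hA h hm hs hcard a).trans hle
    · refine fin1 (norm_nonneg t)
        (abs_average_dirDeriv_le ho hconv hd3 v hT hs hcard a hAδ (fun i => ?_) ht)
      rw [le_div_iff₀ hδ, mul_comm]
      simpa only [DofIndex.order, DofIndex.polyEval, pow_one] using
        h (.edgeNormal hd3 s (Mesh.mem_faces_of_subset hT hs (Finset.card_pos.1 (by omega)))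
          hcard a i) hs
  have num : ∀ {Ω : Set (Space d)} {M : Mesh d Ω} (S : DofChoice M P κ)
      {T : Finset (Space d)}, T ∈ M.cells → ∀ m, ∀ s ⊆ T, s.card = m + 1 →
      IsNumbering (S.num m s) s := fun S T hT m s hs hcard =>
    S.isNumbering (Mesh.mem_faces_of_subset hT hs (Finset.card_pos.1 (by omega))) hcard
  have goal : ∃ C : ℝ, 0 ≤ C ∧ ∀ {Ω : Set (Space d)} {M : Mesh d Ω} {S : DofChoice M P κ}
      {T : Finset (Space d)}, IsOpen Ω → Convex ℝ Ω → T ∈ M.cells → (∃ (x : Space d) (r : ℝ),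
        0 < r ∧ Metric.closedBall x r ⊆ hull T ∧ diameter T ≤ σ * r) →
      ∀ v : feSpace M k, ∀ A : ℝ, 0 ≤ A → (∀ i : DofIndex S, i.simplex ⊆ T →
        diameter T ^ i.order * |i.polyEval (cellPoly v T)| ≤ A) →
      ∀ y ∈ hull T, |pev (cellPoly v T) y| ≤ C * ((1 + c) * A) := by
    clear_value c
    rcases hd with rfl | rfl
    · obtain ⟨C, hC0, hC⟩ := exists_local_bound_two P
      refine ⟨C, hC0, fun {Ω M S T} ho hconv hT _ v A hA h => ?_⟩
      obtain ⟨h0, h1, -, hv, -⟩ := main ho hconv hT v A hA h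
      exact hC (Mesh.card_of_mem_cells hT) (num S hT) _ (totalDegree_cellPoly v hT) _
        (by positivity) h0 h1 fun m hm _ => hv m hm
    · obtain ⟨C, hC0, hC⟩ := exists_local_bound_three P σ
      refine ⟨C, hC0, fun {Ω M S T} ho hconv hT hball v A hA h => ?_⟩
      obtain ⟨h0, h1, h2, hv, hn⟩ := main ho hconv hT v A hA h
      exact hC (Mesh.card_of_mem_cells hT) (num S hT) (Mesh.indep_of_mem_cells hT) hball _
        (totalDegree_cellPoly v hT) _ (by positivity) h0 h1 (h2 rfl) (fun m hm _ => hv m hm)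
        (hn rfl)
  obtain ⟨C, hC0, hC⟩ := goal
  refine ⟨C * (1 + c), by positivity, fun {Ω M S T} ho hconv hT hball v A hA h y hy => ?_⟩
  rw [mul_assoc]
  exact hC ho hconv hT hball v A hA h y hy

end local_bound

/-! ### The nodal basis -/

section nodal

variable {d k : ℕ} {Ω : Set (Space d)} {M : Mesh d Ω} {P : DofPattern d k} {κ σ : ℝ}
  {S : DofChoice M P κ} {T : Finset (Space d)} {n : ℕ} {e : Fin n ≃ DofIndex S}
  {φ : Module.Basis (Fin n) ℝ (feSpace M k)}

theorem IsNodalBasis.polyEval_eq (hφ : IsNodalBasis S e φ) (hd : d = 2 ∨ d = 3) (hT : T ∈ M.cells)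
    {i : Fin n} (hi : (e i).simplex ⊆ T) (j : Fin n) :
    (e i).polyEval (cellPoly (φ j) T) = if i = j then 1 else 0 := by
  rw [← eval_dof_eq hd (φ j) hT (e i) hi, hφ]

theorem IsNodalBasis.polyEval_eq_zero (hφ : IsNodalBasis S e φ) (hd : d = 2 ∨ d = 3)
    (hT : T ∈ M.cells) {i : DofIndex S} (hi : i.simplex ⊆ T) {j : Fin n}
    (hij : i.simplex ≠ (e j).simplex) : i.polyEval (cellPoly (φ j) T) = 0 := by
  obtain ⟨i, rfl⟩ := e.surjective i
  rw [hφ.polyEval_eq hd hT hi, if_neg fun h => hij (by rw [h])]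

/-- The support of a nodal basis function. -/
theorem IsNodalBasis.cellPoly_eq_zero (hφ : IsNodalBasis S e φ) (hd : d = 2 ∨ d = 3)
    (ho : IsOpen Ω) (hc : Convex ℝ Ω) (hσ : M.ShapeRegular σ) (hT : T ∈ M.cells) {j : Fin n}
    (hj : ¬ (e j).simplex ⊆ T) : cellPoly (φ j) T = 0 := by
  obtain ⟨C, -, hC⟩ := exists_cellPoly_bound hd P σ κ
  refine eq_zero_of_hull hT fun y hy => ?_
  -- The bound with A = 0: the j-th degree of freedom is not located in T, so all those of T vanish
  -- on φⱼ.
  have := hC (S := S) ho hc hT (hσ T hT) (φ j) 0 le_rfl (fun i hi => by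
    rw [hφ.polyEval_eq_zero hd hT hi fun h => hj (h ▸ hi), abs_zero, mul_zero]) y hy
  rw [mul_zero] at this
  exact abs_nonpos_iff.1 this

/-- A nodal basis function vanishes to first order at some vertex of each element. -/
theorem IsNodalBasis.exists_vertex (hφ : IsNodalBasis S e φ) (hd : d = 2 ∨ d = 3)
    (ho : IsOpen Ω) (hT : T ∈ M.cells) (j : Fin n) :
    ∃ z ∈ T, pev (cellPoly (φ j) T) z = 0 ∧ ∀ t, pev (dirDeriv t (cellPoly (φ j) T)) z = 0 := by
  -- T has several vertices, so one of them is not where the j-th degree of freedom sits; all vertex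
  -- data of φⱼ vanish there.
  obtain ⟨z, hz, hne⟩ : ∃ z ∈ T, {z} ≠ (e j).simplex := by
    have hcard := Mesh.card_of_mem_cells hT
    by_cases h : ∃ z₀, (e j).simplex = {z₀}
    · obtain ⟨z₀, h⟩ := h
      obtain ⟨z, hz, hne⟩ := Finset.exists_mem_ne (s := T) (by omega) z₀
      exact ⟨z, hz, by rwa [h, Ne, Finset.singleton_inj]⟩
    · obtain ⟨z, hz⟩ := (Finset.card_pos (s := T)).1 (by omega)
      exact ⟨z, hz, fun h' => h ⟨z, h'.symm⟩⟩
  have hzf := Mesh.singleton_mem_faces hT hz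
  have hsub : {z} ⊆ T := Finset.singleton_subset_iff.2 hz
  refine ⟨z, hz, abs_nonpos_iff.1 (abs_vertex_le _ hT hz le_rfl fun hzΩ => ?_), fun t => ?_⟩
  · exact (abs_eq_zero.2 (hφ.polyEval_eq_zero hd hT (i := .vertexValue z hzf hzΩ) hsub hne)).le
  · have := abs_dirDeriv_vertex_le ho hd S (φ j) hT hz le_rfl (fun i =>
      (abs_eq_zero.2 (hφ.polyEval_eq_zero hd hT (i := .vertexGrad z hzf i) hsub hne)).le) t
    rw [mul_zero, zero_mul] at this
    exact abs_nonpos_iff.1 this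

theorem cellPoly_eq_sum_repr (φ : Module.Basis (Fin n) ℝ (feSpace M k)) (v : feSpace M k)
    (hT : T ∈ M.cells) : cellPoly v T = ∑ i, φ.repr v i • cellPoly (φ i) T := by
  conv_lhs => rw [← φ.sum_repr v]
  exact cellPoly_sum _ _ _ hT

/-- The degrees of freedom, as linear functionals. -/
noncomputable def DofIndex.polyEvalₗ : DofIndex S → Poly d →ₗ[ℝ] ℝ
  | .vertexValue z _ _ => evalₗ fun i => z i
  | .vertexGrad z _ i => (evalₗ fun i => z i).comp (dirDeriv (S.gradDir z i) : Poly d →ₗ[ℝ] Poly d)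
  | .vertexHess _ z _ i => (evalₗ fun i => z i).comp
      ((dirDeriv (S.hessDir z i 0) : Poly d →ₗ[ℝ] Poly d).comp
        (dirDeriv (S.hessDir z i 1) : Poly d →ₗ[ℝ] Poly d))
  | .faceValue m _ s _ _ _ a => (P.val m a).averageₗ.comp (pull (S.num m s)).toLinearMap
  | .edgeNormal _ s _ _ a i => (P.edge a).averageₗ.comp
      ((pull (S.num 1 s)).toLinearMap.comp (dirDeriv (S.normalDir s i) : Poly d →ₗ[ℝ] Poly d))

theorem DofIndex.polyEvalₗ_apply (i : DofIndex S) (p : Poly d) : i.polyEvalₗ p = i.polyEval p := by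
  cases i <;> rfl

/-- The degrees of freedom are the coefficients in the nodal basis. -/
theorem IsNodalBasis.polyEval_eq_repr (hφ : IsNodalBasis S e φ) (hd : d = 2 ∨ d = 3)
    (hT : T ∈ M.cells) {i : Fin n} (hi : (e i).simplex ⊆ T) (v : feSpace M k) :
    (e i).polyEval (cellPoly v T) = φ.repr v i := by
  rw [cellPoly_eq_sum_repr φ v hT, ← DofIndex.polyEvalₗ_apply, map_sum]
  simp only [map_smul, DofIndex.polyEvalₗ_apply, hφ.polyEval_eq hd hT hi, smul_eq_mul]
  simp

end nodal

/-! ### Stability of the nodal basis -/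

section stability

variable {d k : ℕ} {Ω : Set (Space d)} {M : Mesh d Ω} {P : DofPattern d k} {κ σ : ℝ}
  {S : DofChoice M P κ} {n : ℕ} {e : Fin n ≃ DofIndex S} {φ : Module.Basis (Fin n) ℝ (feSpace M k)}

/-- The degrees of freedom located at an element. -/
noncomputable def localDofs (e : Fin n ≃ DofIndex S) (T : Finset (Space d)) : Finset (Fin n) := by
  classical exact Finset.univ.filter fun i => (e i).simplex ⊆ T

theorem mem_localDofs {T : Finset (Space d)} {i : Fin n} :
    i ∈ localDofs e T ↔ (e i).simplex ⊆ T := by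
  simp [localDofs]

theorem exists_card_localDofs_le (P : DofPattern d k) (κ : ℝ) : ∃ K : ℕ,
    ∀ {Ω : Set (Space d)} {M : Mesh d Ω} {S : DofChoice M P κ} {n : ℕ} (e : Fin n ≃ DofIndex S)
      {T : Finset (Space d)}, T ∈ M.cells → (localDofs e T).card ≤ K := by
  obtain ⟨K, hK⟩ := exists_card_bound P κ
  refine ⟨K, fun {Ω M S n} e {T} hT => ?_⟩
  rw [← Finset.card_map e.toEmbedding]
  refine hK S hT _ fun i hi => ?_
  obtain ⟨j, hj, rfl⟩ := Finset.mem_map.1 hi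
  exact mem_localDofs.1 hj

/-- Scaled degrees of freedom are bounded in `L²`. -/
theorem exists_sq_polyEval_le (d k : ℕ) (σ : ℝ) : ∃ C : ℝ, 0 ≤ C ∧
    ∀ {Ω : Set (Space d)} {M : Mesh d Ω} {P : DofPattern d k} {κ : ℝ} {S : DofChoice M P κ},
      M.ShapeRegular σ → ∀ {T : Finset (Space d)}, T ∈ M.cells →
    ∀ p : Poly d, p.totalDegree ≤ k → ∀ i : DofIndex S, i.simplex ⊆ T →
      (diameter T ^ i.order * i.polyEval p) ^ 2 * volume.real (hull T)
        ≤ C * ∫ y in hull T, pev p y ^ 2 := by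
  obtain ⟨C1, hC10, hC1⟩ := exists_polyEval_bound d k σ
  obtain ⟨C2, hC20, hC2⟩ := exists_sq_le_setIntegral d k
  refine ⟨C1 ^ 2 * C2, by positivity, fun {Ω M P κ S} hσ {T} hT p hp i hi => ?_⟩
  have hV := volume_hull_pos (Mesh.card_of_mem_cells hT) (Mesh.indep_of_mem_cells hT)
  have hI := integral_sq_nonneg T p
  have h1 := hC1 (S := S) hT (hσ T hT) p hp _ (Real.sqrt_nonneg _) (fun y hy =>
    abs_le_sqrt_of_sq_mul_le hV
      (hC2 (Mesh.card_of_mem_cells hT) (Mesh.indep_of_mem_cells hT) p hp y hy)) i hi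
  have h0 : 0 ≤ diameter T ^ i.order := pow_nonneg Metric.diam_nonneg _
  have h2 : (diameter T ^ i.order * i.polyEval p) ^ 2
      ≤ (C1 * √(C2 * (∫ y in hull T, pev p y ^ 2) / volume.real (hull T))) ^ 2 := by
    rw [← sq_abs (diameter T ^ i.order * i.polyEval p), abs_mul, abs_of_nonneg h0]
    exact pow_le_pow_left₀ (by positivity) h1 2
  rw [mul_pow C1, Real.sq_sqrt (by positivity)] at h2
  calc _ ≤ _ := mul_le_mul_of_nonneg_right h2 hV.le
    _ = _ := by field_simp

/-- Everything is compared with the squares of the scaled coefficients, h to the order of the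
derivative times xᵢ, multiplied by the volume of T. Degrees of freedom bound a function, and the L²
norm bounds degrees of freedom; both are applied to v and to the basis functions. -/
theorem exists_nodal_stability (hd : d = 2 ∨ d = 3) (P : DofPattern d k) (σ κ : ℝ) :
    ∃ C : ℝ, 0 ≤ C ∧ ∀ {Ω : Set (Space d)} {M : Mesh d Ω} {S : DofChoice M P κ} {n : ℕ}
      {e : Fin n ≃ DofIndex S} {φ : Module.Basis (Fin n) ℝ (feSpace M k)},
      IsOpen Ω → Convex ℝ Ω → M.ShapeRegular σ → IsNodalBasis S e φ →
    ∀ {T : Finset (Space d)}, T ∈ M.cells → ∀ v : feSpace M k,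
      (∫ y in hull T, pev (cellPoly v T) y ^ 2 ≤ C * ∑ i ∈ localDofs e T,
        φ.repr v i ^ 2 * ∫ y in hull T, pev (cellPoly (φ i) T) y ^ 2) ∧
      ∀ i ∈ localDofs e T, φ.repr v i ^ 2 * (∫ y in hull T, pev (cellPoly (φ i) T) y ^ 2)
        ≤ C * ∫ y in hull T, pev (cellPoly v T) y ^ 2 := by
  obtain ⟨C1, hC10, hC1⟩ := exists_sq_polyEval_le d k σ
  obtain ⟨C2, hC20, hC2⟩ := exists_cellPoly_bound hd P σ κ
  refine ⟨C2 ^ 2 * C1, by positivity, ?_⟩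
  intro Ω M S n e φ ho hc hσ hφ T hT v
  set δ := diameter T with hδ
  have hδ0 : ∀ r, 0 ≤ δ ^ r := fun r => pow_nonneg Metric.diam_nonneg _
  set V := volume.real (hull T) with hVdef
  have hV : 0 ≤ V := measureReal_nonneg
  have bound : ∀ u : feSpace M k, ∀ A : ℝ, 0 ≤ A →
      (∀ i ∈ localDofs e T, δ ^ (e i).order * |φ.repr u i| ≤ A) →
      ∫ y in hull T, pev (cellPoly u T) y ^ 2 ≤ C2 ^ 2 * (A ^ 2 * V) := fun u A hA h => by
    have := setIntegral_sq_le (hC2 (S := S) ho hc hT (hσ T hT) u A hA fun i hi => by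
      obtain ⟨i, rfl⟩ := e.surjective i
      rw [hφ.polyEval_eq_repr hd hT hi]
      exact h i (mem_localDofs.2 hi))
    rwa [mul_pow, mul_assoc] at this
  constructor
  -- Each scaled coefficient is at most √Q. The terms of Q are then traded for ∫ φᵢ², since the i-th
  -- degree of freedom of φᵢ is 1.
  · set Q := ∑ i ∈ localDofs e T, (δ ^ (e i).order * φ.repr v i) ^ 2 with hQ
    have hQ0 : 0 ≤ Q := Finset.sum_nonneg fun i _ => sq_nonneg _
    have h1 := bound v (√Q) (Real.sqrt_nonneg Q) fun i hi => by
      rw [← abs_of_nonneg (hδ0 (e i).order), ← abs_mul]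
      exact Real.abs_le_sqrt (Finset.single_le_sum
        (f := fun i => (δ ^ (e i).order * φ.repr v i) ^ 2) (fun i _ => sq_nonneg _) hi)
    rw [Real.sq_sqrt hQ0] at h1
    refine h1.trans ?_
    rw [mul_assoc]
    refine mul_le_mul_of_nonneg_left ?_ (sq_nonneg C2)
    rw [hQ, Finset.sum_mul, Finset.mul_sum]
    refine Finset.sum_le_sum fun i hi => ?_
    have hi' := mem_localDofs.1 hi
    have h2 := hC1 hσ hT (cellPoly (φ i) T) (totalDegree_cellPoly _ hT) (e i) hi'
    rw [hφ.polyEval_eq hd hT hi', if_pos rfl, mul_one] at h2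
    calc (δ ^ (e i).order * φ.repr v i) ^ 2 * V
        = φ.repr v i ^ 2 * ((δ ^ (e i).order) ^ 2 * V) := by ring
      _ ≤ φ.repr v i ^ 2 * (C1 * _) := mul_le_mul_of_nonneg_left h2 (sq_nonneg _)
      _ = _ := by ring
  -- The only non-zero degree of freedom of φᵢ has the scaled size δ to its order, which bounds ∫
  -- φᵢ²; the coefficient xᵢ is a degree of freedom of v.
  · intro i hi
    have hi' := mem_localDofs.1 hi
    have h1 := bound (φ i) (δ ^ (e i).order) (hδ0 _) fun j _ => by
      rw [φ.repr_self, Finsupp.single_apply]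
      split_ifs with h
      · rw [h, abs_one, mul_one]
      · rw [abs_zero, mul_zero]; exact hδ0 _
    have h2 := hC1 hσ hT (cellPoly v T) (totalDegree_cellPoly _ hT) (e i) hi'
    rw [hφ.polyEval_eq_repr hd hT hi'] at h2
    calc φ.repr v i ^ 2 * (∫ y in hull T, pev (cellPoly (φ i) T) y ^ 2)
        ≤ φ.repr v i ^ 2 * (C2 ^ 2 * ((δ ^ (e i).order) ^ 2 * V)) :=
          mul_le_mul_of_nonneg_left h1 (sq_nonneg _)
      _ = C2 ^ 2 * ((δ ^ (e i).order * φ.repr v i) ^ 2 * V) := by ring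
      _ ≤ C2 ^ 2 * (C1 * _) := mul_le_mul_of_nonneg_left h2 (sq_nonneg _)
      _ = _ := by ring

/-! ### The stiffness matrix -/

/-- The contribution of an element to the stiffness matrix. -/
noncomputable def cellMatrix (lam : ℝ) (φ : Module.Basis (Fin n) ℝ (feSpace M k))
    (T : Finset (Space d)) : Matrix (Fin n) (Fin n) ℝ :=
  Matrix.of fun i j => cellForm lam T (cellPoly (φ j) T) (cellPoly (φ i) T)

theorem stiffness_eq_sum (hc : Convex ℝ Ω) (lam : ℝ) (i j : Fin n) :
    stiffness M lam φ i j = ∑ T ∈ M.cells, cellMatrix lam φ T i j :=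
  energy_eq_sum hc lam (φ j) (φ i)

theorem stiffness_form (hc : Convex ℝ Ω) (lam : ℝ) (v : feSpace M k) :
    (φ.repr v : Fin n → ℝ) ⬝ᵥ (stiffness M lam φ *ᵥ (φ.repr v : Fin n → ℝ))
      = ∑ T ∈ M.cells, cellForm lam T (cellPoly v T) (cellPoly v T) := by
  set x : Fin n → ℝ := ⇑(φ.repr v) with hx
  have h1 : ∀ T ∈ M.cells, cellForm lam T (cellPoly v T) (cellPoly v T)
      = ∑ i, ∑ j, x i * (cellMatrix lam φ T i j * x j) := fun T hT => by
    rw [cellPoly_eq_sum_repr φ v hT, map_sum]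
    simp only [LinearMap.sum_apply, map_sum, map_smul, LinearMap.smul_apply, smul_eq_mul,
      cellMatrix, Matrix.of_apply, Finset.mul_sum]
    exact Finset.sum_congr rfl fun i _ => Finset.sum_congr rfl fun j _ => by ring
  rw [Finset.sum_congr rfl h1, Finset.sum_comm]
  simp only [dotProduct, Matrix.mulVec, Finset.mul_sum, stiffness_eq_sum hc, Finset.sum_mul]
  refine Finset.sum_congr rfl fun i _ => ?_
  rw [Finset.sum_comm]

/-- Because λ > 0, the mass term alone forces a function of zero energy to vanish on every element,
and outside Ω members of the space are zero by convention. -/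
theorem posDef_stiffness (hc : Convex ℝ Ω) {lam : ℝ} (hl : 0 < lam) :
    (stiffness M lam φ).PosDef := by
  refine Matrix.PosDef.of_dotProduct_mulVec_pos ?_ fun x hx => ?_
  · ext i j
    simp only [Matrix.conjTranspose_apply, star_trivial, stiffness_eq_sum hc, cellMatrix,
      Matrix.of_apply]
    exact Finset.sum_congr rfl fun T _ => cellForm_comm _ _ _ _
  · set v := φ.equivFun.symm x with hv
    have hxv : (φ.repr v : Fin n → ℝ) = x := by
      rw [← φ.equivFun_apply, hv, LinearEquiv.apply_symm_apply]
    rw [star_trivial, ← hxv, stiffness_form hc]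
    have h0 : ∀ T ∈ M.cells, 0 ≤ cellForm lam T (cellPoly v T) (cellPoly v T) :=
      fun T _ => cellForm_self_nonneg hl.le T _
    refine lt_of_le_of_ne (Finset.sum_nonneg h0) fun h => hx ?_
    have hT0 := (Finset.sum_eq_zero_iff_of_nonneg h0).1 h.symm
    obtain ⟨C, -, hC⟩ := exists_sq_le_setIntegral d k
    have hcell : ∀ T ∈ M.cells, ∀ y ∈ hull T, (v : Space d → ℝ) y = 0 := fun T hT y hy => by
      have h1 := hT0 T hT
      rw [cellForm_self] at h1
      have h2 := integral_hessSq_nonneg T (cellPoly v T)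
      have h3 := mul_nonneg hl.le (integral_gradSq_nonneg T (cellPoly v T))
      have h4 := integral_sq_nonneg T (cellPoly v T)
      have h5 : lam ^ 2 * ∫ y in hull T, pev (cellPoly v T) y ^ 2 = 0 := by
        have := mul_nonneg (sq_nonneg lam) h4
        linarith
      have h6 := hC (Mesh.card_of_mem_cells hT) (Mesh.indep_of_mem_cells hT) _
        (totalDegree_cellPoly v hT) y hy
      rw [(mul_eq_zero.1 h5).resolve_left (by positivity), mul_zero] at h6
      have hV := volume_hull_pos (Mesh.card_of_mem_cells hT) (Mesh.indep_of_mem_cells hT)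
      rw [eq_cellPoly v hT y hy]
      exact pow_eq_zero_iff two_ne_zero |>.1
        (le_antisymm (nonpos_of_mul_nonpos_left h6 hV) (sq_nonneg _))
    have hv0 : v = 0 := Subtype.ext <| funext fun y => by
      by_cases hy : y ∈ Ω
      · obtain ⟨T, hT, hyT⟩ := Mesh.exists_mem_hull (M := M) (subset_closure hy)
        exact hcell T hT y hyT
      · exact eq_zero_of_notMem v hy
    rw [← hxv, hv0, map_zero]
    rfl

theorem IsNodalBasis.cellMatrix_eq_zero (hφ : IsNodalBasis S e φ) (hd : d = 2 ∨ d = 3)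
    (ho : IsOpen Ω) (hc : Convex ℝ Ω) (hσ : M.ShapeRegular σ) {T : Finset (Space d)}
    (hT : T ∈ M.cells) (lam : ℝ) {i j : Fin n} (h : i ∉ localDofs e T ∨ j ∉ localDofs e T) :
    cellMatrix lam φ T i j = 0 := by
  simp only [mem_localDofs] at h
  rw [cellMatrix, Matrix.of_apply]
  rcases h with h | h
  · rw [hφ.cellPoly_eq_zero hd ho hc hσ hT h, map_zero]
  · rw [hφ.cellPoly_eq_zero hd ho hc hσ hT h, map_zero, LinearMap.zero_apply]

theorem IsNodalBasis.diagonalPart_form_eq (hφ : IsNodalBasis S e φ) (hd : d = 2 ∨ d = 3)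
    (ho : IsOpen Ω) (hc : Convex ℝ Ω) (hσ : M.ShapeRegular σ) (lam : ℝ) (v : feSpace M k) :
    sqNorm φ (diagonalPart (stiffness M lam φ)) v
      = ∑ T ∈ M.cells, ∑ i ∈ localDofs e T,
        φ.repr v i ^ 2 * cellForm lam T (cellPoly (φ i) T) (cellPoly (φ i) T) := by
  rw [sqNorm, diagonalPart_form]
  simp only [stiffness_eq_sum hc, Finset.sum_mul]
  rw [Finset.sum_comm]
  refine Finset.sum_congr rfl fun T hT => ?_
  rw [← Finset.sum_subset (Finset.subset_univ (localDofs e T)) fun i _ hi => by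
    rw [hφ.cellMatrix_eq_zero hd ho hc hσ hT lam (Or.inl hi), zero_mul]]
  exact Finset.sum_congr rfl fun i _ => mul_comm _ _

/-- On each element, nodal stability reduces the comparison to single basis functions, for which
energy and weighted L² norm are equivalent. -/
theorem exists_weightedL2_equiv (hd : d = 2 ∨ d = 3) (P : DofPattern d k) (σ κ : ℝ) :
    ∃ C : ℝ, 0 ≤ C ∧ ∀ {Ω : Set (Space d)} {M : Mesh d Ω} {S : DofChoice M P κ} {n : ℕ}
      {e : Fin n ≃ DofIndex S} {φ : Module.Basis (Fin n) ℝ (feSpace M k)},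
      IsOpen Ω → Convex ℝ Ω → M.ShapeRegular σ → IsNodalBasis S e φ →
    ∀ lam : ℝ, 0 ≤ lam → ∀ v : feSpace M k,
      sqNorm φ (diagonalPart (stiffness M lam φ)) v ≤ C * weightedL2 M lam (v : Space d → ℝ) ∧
      weightedL2 M lam (v : Space d → ℝ)
        ≤ C * sqNorm φ (diagonalPart (stiffness M lam φ)) v := by
  have hd1 : 1 ≤ d := by omega
  obtain ⟨C1, hC10, hC1⟩ := exists_nodal_stability hd P σ κ
  obtain ⟨C2, hC20, hC2⟩ := exists_cellForm_le d k σ hd1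
  obtain ⟨C3, hC30, hC3⟩ := exists_le_cellForm d k hd1
  obtain ⟨K, hK⟩ := exists_card_localDofs_le P κ
  -- The first summand serves the upper bound of the diagonal, where K counts the local terms; the
  -- second serves the lower bound.
  refine ⟨K * (C2 * C1) + C1 * C3, by positivity, ?_⟩
  intro Ω M S n e φ ho hc hσ hφ lam hl v
  rw [hφ.diagonalPart_form_eq hd ho hc hσ, weightedL2_eq_sum, Finset.mul_sum, Finset.mul_sum]
  constructor
  · refine Finset.sum_le_sum fun T hT => ?_
    set W := ((diameter T ^ 2)⁻¹ + lam) ^ 2 with hW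
    have hW0 : 0 ≤ W := sq_nonneg _
    have hI := integral_sq_nonneg T (cellPoly v T)
    set I := ∫ y in hull T, pev (cellPoly v T) y ^ 2
    have h1 : ∀ i ∈ localDofs e T,
        φ.repr v i ^ 2 * cellForm lam T (cellPoly (φ i) T) (cellPoly (φ i) T)
          ≤ C2 * C1 * (W * I) := fun i hi => by
      have h2 := hC2 (Mesh.card_of_mem_cells hT) (Mesh.indep_of_mem_cells hT) (hσ T hT)
        (cellPoly (φ i) T) (totalDegree_cellPoly _ hT) lam hl
      have h3 := (hC1 ho hc hσ hφ hT v).2 i hi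
      calc _ ≤ φ.repr v i ^ 2 * (C2 * (W * ∫ y in hull T, pev (cellPoly (φ i) T) y ^ 2)) :=
            mul_le_mul_of_nonneg_left h2 (sq_nonneg _)
        _ = C2 * W * (φ.repr v i ^ 2 * ∫ y in hull T, pev (cellPoly (φ i) T) y ^ 2) := by ring
        _ ≤ C2 * W * (C1 * I) := mul_le_mul_of_nonneg_left h3 (by positivity)
        _ = _ := by ring
    have h4 : ((localDofs e T).card : ℝ) ≤ K := by exact_mod_cast hK e hT
    calc _ ≤ (localDofs e T).card • (C2 * C1 * (W * I)) := Finset.sum_le_card_nsmul _ _ _ h1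
      _ = (localDofs e T).card * (C2 * C1 * (W * I)) := nsmul_eq_mul _ _
      _ ≤ K * (C2 * C1 * (W * I)) := mul_le_mul_of_nonneg_right h4 (by positivity)
      _ = K * (C2 * C1) * (W * I) := by ring
      _ ≤ _ := mul_le_mul_of_nonneg_right (le_add_of_nonneg_right (by positivity)) (by positivity)
  · refine Finset.sum_le_sum fun T hT => ?_
    set W := ((diameter T ^ 2)⁻¹ + lam) ^ 2 with hW
    have hW0 : 0 ≤ W := sq_nonneg _
    have hD : 0 ≤ ∑ i ∈ localDofs e T,
        φ.repr v i ^ 2 * cellForm lam T (cellPoly (φ i) T) (cellPoly (φ i) T) :=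
      Finset.sum_nonneg fun i _ => mul_nonneg (sq_nonneg _) (cellForm_self_nonneg hl T _)
    calc _ ≤ W * (C1 * ∑ i ∈ localDofs e T,
            φ.repr v i ^ 2 * ∫ y in hull T, pev (cellPoly (φ i) T) y ^ 2) :=
          mul_le_mul_of_nonneg_left (hC1 ho hc hσ hφ hT v).1 hW0
      _ = C1 * ∑ i ∈ localDofs e T,
            φ.repr v i ^ 2 * (W * ∫ y in hull T, pev (cellPoly (φ i) T) y ^ 2) := by
          rw [mul_left_comm, Finset.mul_sum]
          congr 1
          exact Finset.sum_congr rfl fun i _ => by ring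
      _ ≤ C1 * ∑ i ∈ localDofs e T,
            φ.repr v i ^ 2 * (C3 * cellForm lam T (cellPoly (φ i) T) (cellPoly (φ i) T)) := by
          refine mul_le_mul_of_nonneg_left (Finset.sum_le_sum fun i _ => ?_) hC10
          -- The Poincaré inequality is available for φᵢ, though not for v itself, thanks to the
          -- first-order zero at z.
          obtain ⟨z, hz, h0, h1⟩ := hφ.exists_vertex hd ho hT i
          exact mul_le_mul_of_nonneg_left (hC3 (Mesh.card_of_mem_cells hT)
            (Mesh.indep_of_mem_cells hT) _ (totalDegree_cellPoly _ hT) z hz h0 h1 lam hl)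
            (sq_nonneg _)
      _ = C1 * C3 * ∑ i ∈ localDofs e T,
            φ.repr v i ^ 2 * cellForm lam T (cellPoly (φ i) T) (cellPoly (φ i) T) := by
          rw [mul_assoc, Finset.mul_sum _ _ C3]
          congr 1
          exact Finset.sum_congr rfl fun i _ => by ring
      _ ≤ _ := mul_le_mul_of_nonneg_right (le_add_of_nonneg_left (by positivity)) hD

/-- The matrix estimate with the element contributions of the energy; the local supports of the
nodal basis bound the number of active indices. -/
theorem exists_symGaussSeidel_equiv (hd : d = 2 ∨ d = 3) (P : DofPattern d k) (σ κ : ℝ) :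
    ∃ C : ℝ, 0 ≤ C ∧ ∀ {Ω : Set (Space d)} {M : Mesh d Ω} {S : DofChoice M P κ} {n : ℕ}
      {e : Fin n ≃ DofIndex S} {φ : Module.Basis (Fin n) ℝ (feSpace M k)},
      IsOpen Ω → Convex ℝ Ω → M.ShapeRegular σ → IsNodalBasis S e φ →
    ∀ lam : ℝ, 0 < lam → ∀ v : feSpace M k,
      sqNorm φ (symGaussSeidel (stiffness M lam φ))⁻¹ v
        ≤ C * sqNorm φ (diagonalPart (stiffness M lam φ)) v := by
  obtain ⟨K, hK⟩ := exists_card_localDofs_le P κ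
  refine ⟨(K : ℝ) ^ 2, by positivity, ?_⟩
  intro Ω M S n e φ ho hc hσ hφ lam hl v
  refine symGaussSeidel_inv_form_le (posDef_stiffness hc hl) M.cells (cellMatrix lam φ)
    (stiffness_eq_sum hc lam) (fun T i => cellForm_self_nonneg hl.le T _) (fun T i j => ?_)
    (localDofs e) (fun T hT => by exact_mod_cast hK e hT)
    (fun T hT i j h => hφ.cellMatrix_eq_zero hd ho hc hσ hT lam h) _
  rw [mul_comm]
  exact cellForm_sq_le hl.le T _ _

end stability

end SmootherFEM

/-! ### The norm equivalence -/

theorem mainTheorem7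
    (d k : ℕ) (hdk : (d = 2 ∧ 3 ≤ k) ∨ (d = 3 ∧ 5 ≤ k))
    (Ω : Set (SmootherFEM.Space d)) (hΩ : SmootherFEM.IsConvexPolytope Ω)
    (P : SmootherFEM.DofPattern d k) (σ κ : ℝ) :
    ∃ C : ℝ, 0 < C ∧
      ∀ (M : SmootherFEM.Mesh d Ω), M.ShapeRegular σ →
      ∀ (S : SmootherFEM.DofChoice M P κ) (n : ℕ) (e : Fin n ≃ SmootherFEM.DofIndex S)
        (φ : Module.Basis (Fin n) ℝ (SmootherFEM.feSpace M k)),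
        SmootherFEM.IsNodalBasis S e φ →
      ∀ lam : ℝ, 0 < lam →
        (SmootherFEM.stiffness M lam φ).PosDef ∧
        IsUnit (SmootherFEM.lowerPart (SmootherFEM.stiffness M lam φ)) ∧
        (SmootherFEM.symGaussSeidel (SmootherFEM.stiffness M lam φ)).PosDef ∧
        ∀ v : SmootherFEM.feSpace M k,
          SmootherFEM.sqNorm φ (SmootherFEM.symGaussSeidel (SmootherFEM.stiffness M lam φ))⁻¹ v
              ≤ C * SmootherFEM.sqNorm φ
                (SmootherFEM.diagonalPart (SmootherFEM.stiffness M lam φ)) v ∧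
          SmootherFEM.sqNorm φ (SmootherFEM.diagonalPart (SmootherFEM.stiffness M lam φ)) v
              ≤ C * SmootherFEM.sqNorm φ
                (SmootherFEM.symGaussSeidel (SmootherFEM.stiffness M lam φ))⁻¹ v ∧
          SmootherFEM.sqNorm φ (SmootherFEM.diagonalPart (SmootherFEM.stiffness M lam φ)) v
              ≤ C * SmootherFEM.weightedL2 M lam (v : SmootherFEM.Space d → ℝ) ∧
          SmootherFEM.weightedL2 M lam (v : SmootherFEM.Space d → ℝ)
              ≤ C * SmootherFEM.sqNorm φ
                (SmootherFEM.diagonalPart (SmootherFEM.stiffness M lam φ)) v := by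
  obtain ⟨C1, hC10, hC1⟩ :=
    SmootherFEM.exists_symGaussSeidel_equiv (hdk.imp And.left And.left) P σ κ
  obtain ⟨C2, hC20, hC2⟩ :=
    SmootherFEM.exists_weightedL2_equiv (hdk.imp And.left And.left) P σ κ
  -- The summand 4 comes from the matrix inequality D ≤ 4 R̄⁻¹; the sum dominates the constants of
  -- all four estimates.
  refine ⟨4 + C1 + C2, by positivity, fun M hσ S n e φ hφ lam hl => ?_⟩
  have hA := SmootherFEM.posDef_stiffness (φ := φ) hΩ.convex hl
  refine ⟨hA, SmootherFEM.isUnit_lowerPart hA, SmootherFEM.posDef_symGaussSeidel hA, fun v => ?_⟩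
  have h1 := hC1 hΩ.isOpen hΩ.convex hσ hφ lam hl v
  have h2 := hC2 hΩ.isOpen hΩ.convex hσ hφ lam hl.le v
  have h3 : SmootherFEM.sqNorm φ (SmootherFEM.diagonalPart (SmootherFEM.stiffness M lam φ)) v
      ≤ 4 * SmootherFEM.sqNorm φ
        (SmootherFEM.symGaussSeidel (SmootherFEM.stiffness M lam φ))⁻¹ v :=
    SmootherFEM.diagonalPart_form_le hA _
  have hD : 0 ≤ SmootherFEM.sqNorm φ
      (SmootherFEM.diagonalPart (SmootherFEM.stiffness M lam φ)) v := by
    rw [SmootherFEM.sqNorm, SmootherFEM.diagonalPart_form]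
    exact Finset.sum_nonneg fun i _ => mul_nonneg hA.diag_pos.le (sq_nonneg _)
  have hR : 0 ≤ SmootherFEM.sqNorm φ
      (SmootherFEM.symGaussSeidel (SmootherFEM.stiffness M lam φ))⁻¹ v := by linarith
  have hW : 0 ≤ SmootherFEM.weightedL2 M lam (v : SmootherFEM.Space d → ℝ) :=
    Finset.sum_nonneg fun T _ => mul_nonneg (sq_nonneg _) (integral_nonneg fun _ => sq_nonneg _)
  exact ⟨h1.trans (mul_le_mul_of_nonneg_right (by linarith) hD),
    h3.trans (mul_le_mul_of_nonneg_right (by linarith) hR),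
    h2.1.trans (mul_le_mul_of_nonneg_right (by linarith) hW),
    h2.2.trans (mul_le_mul_of_nonneg_right (by linarith) hD)⟩
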